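/- For $t>0$ let $O(t)$ be the right-angled hyperbolic octagon, with the symmetries of a square, whose side lengths alternate between $2t$ and $\sigma(t)$, where $\cosh\sigma(t)=\coth^2 t$. The cross $C(t)$ is the four-holed sphere obtained by gluing two copies of $O(t)$ along their sides of length $\sigma(t)$ by the identity; each of its four boundary geodesics has length $4t$. Let $a(t)$ be the length of a main diagonal of $O(t)$ (the distance between opposite vertices) and let $c(t)=2\sigma(t)$. Then there is a unique $t_1>0$ with $a(t_1)=c(t_1)$. Let $\Sigma(1)$ be the closed hyperbolic surface obtained from $C(t_1)$ by gluing opposite boundary geodesics with half twists, that is, by the gluing that matches the two copies of $O(t_1)$ front to front, followed by a rotation of the boundary geodesic by half of its length. Then $\Sigma(1)$ is isometric to the Bolza surface, the surface obtained from the regular hyperbolic octagon with interior angles $\pi/4$ by identifying opposite sides by hyperbolic translations. The shortest closed geodesics of $\Sigma(1)$ have length $2\operatorname{arccosh}(1+\sqrt2)$, which is $3.057$ to within $0.0005$, and there are exactly $12$ of them (up to parametrization and orientation). -/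

import Mathlib

open UpperHalfPlane
open scoped MatrixGroups

noncomputable section

namespace BolzaCross

/-! ### Points of the hyperbolic plane, seen from the base point `i` -/

/-- The rotation of the upper half-plane about `i` by the angle `θ` (counterclockwise). -/
def rot (θ : ℝ) : SL(2, ℝ) :=
  ⟨!![Real.cos (θ / 2), Real.sin (θ / 2); -Real.sin (θ / 2), Real.cos (θ / 2)], by
    rw [Matrix.det_fin_two_of]
    nlinarith [Real.sin_sq_add_cos_sq (θ / 2)]⟩

/-- The hyperbolic translation of (signed) length `ℓ` along the upward geodesic through `i`. -/
def trans (ℓ : ℝ) : SL(2, ℝ) :=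
  ⟨!![Real.exp (ℓ / 2), 0; 0, Real.exp (-(ℓ / 2))], by
    rw [Matrix.det_fin_two_of, ← Real.exp_add]
    simp⟩

/-- The point reached from `i` by walking the distance `d` in the direction `θ` (measured
counterclockwise from the upward direction). -/
def polar (d θ : ℝ) : ℍ := (rot θ * trans d) • I

/-- The point reached from `i` by walking the distance `d` in the direction `θ`, then turning left
by a right angle and walking the signed distance `s`. For fixed `d` and `θ`, this is a unit-speed
parametrization of the geodesic line orthogonal at `polar d θ` to the ray in the direction `θ`. -/
def foot (d θ s : ℝ) : ℍ := (rot θ * trans d * rot (Real.pi / 2) * trans s) • I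

/-- The half-plane which contains `i` and is bounded by the line `s ↦ foot d θ s`
(for `0 < d`): this line is the perpendicular bisector of `i` and `polar (2 * d) θ`. -/
def halfPlane (d θ : ℝ) : Set ℍ := {z | dist z I ≤ dist z (polar (2 * d) θ)}

/-! ### Gluing hyperbolic polygons -/

/-- A family of pieces of the hyperbolic plane together with the relation that says which points
of the pieces are to be glued (the relation is read on the pieces only). -/
structure Gluing (ι : Type) where
  piece : ι → Set ℍ
  rel : ι × ℍ → ι × ℍ → Prop

namespace Gluing

variable {ι : Type}

/-- The space obtained from the disjoint union of the pieces by identifying related points. -/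
def Space (G : Gluing ι) : Type :=
  Quot fun p q : (Σ i, G.piece i) => G.rel (p.1, p.2) (q.1, q.2)

/-- The point of the glued space given by the point `x` of the `i`-th piece. -/
def pt (G : Gluing ι) (i : ι) (x : G.piece i) : G.Space := Quot.mk _ ⟨i, x⟩

/-- `Chain a b ℓ`: one can go from `a` to `b` by finitely many moves, each within one piece, of
total length `ℓ`. -/
inductive Chain (G : Gluing ι) (a : G.Space) : G.Space → ENNReal → Prop
  | nil : Chain G a a 0
  | snoc {ℓ : ENNReal} (i : ι) (x y : G.piece i) :
      Chain G a (G.pt i x) ℓ → Chain G a (G.pt i y) (ℓ + edist x y)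

theorem Chain.append {G : Gluing ι} {a b c : G.Space} {k ℓ : ENNReal} (h : Chain G a b k)
    (h' : Chain G b c ℓ) : Chain G a c (k + ℓ) := by
  induction h' with
  | nil => simpa using h
  | snoc i x y _ ih => rw [← add_assoc]; exact Chain.snoc i x y ih

theorem Chain.symm {G : Gluing ι} {a b : G.Space} {ℓ : ENNReal} (h : Chain G a b ℓ) :
    Chain G b a ℓ := by
  induction h with
  | nil => exact Chain.nil
  | snoc i x y _ ih =>
    have h1 := (Chain.snoc i y x (Chain.nil (a := G.pt i y))).append ih
    rwa [zero_add, edist_comm, add_comm] at h1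

/-- The glued space carries the quotient distance: the infimum of the lengths of all chains. -/
instance (G : Gluing ι) : PseudoEMetricSpace G.Space where
  edist a b := ⨅ (ℓ : ENNReal) (_ : Chain G a b ℓ), ℓ
  edist_self a := le_antisymm (iInf₂_le 0 Chain.nil) (zero_le)
  edist_comm a b := le_antisymm (le_iInf₂ fun ℓ h => iInf₂_le ℓ h.symm)
    (le_iInf₂ fun ℓ h => iInf₂_le ℓ h.symm)
  edist_triangle a b c := by
    refine ENNReal.le_iInf₂_add_iInf₂ ?_
    intro k hk ℓ hℓ
    exact iInf₂_le (k + ℓ) (hk.append hℓ)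

end Gluing

/-! ### Closed geodesics and systoles -/

/-- `γ` is a closed geodesic of length `L`, parametrized by arc length: it has period `L`, and
near every parameter it preserves distances. -/
structure IsClosedGeodesic {X : Type} [PseudoEMetricSpace X] (γ : ℝ → X) (L : ℝ) : Prop where
  pos : 0 < L
  periodic : Function.Periodic γ L
  locally_isometric : ∀ s : ℝ, ∃ ε > 0, ∀ u v : ℝ, |u - s| < ε → |v - s| < ε →
    edist (γ u) (γ v) = ENNReal.ofReal |u - v|

/-- The lengths of the closed geodesics of `X`; the systole of `X` is the least of them. -/
def geodesicLengths (X : Type) [PseudoEMetricSpace X] : Set ℝ :=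
  {L | ∃ γ : ℝ → X, IsClosedGeodesic γ L}

/-- The systoles of `X`, as curves in `X`: the traces of the shortest closed geodesics, so that
neither the starting point nor the direction of travel matters. -/
def systoles (X : Type) [PseudoEMetricSpace X] : Set (Set X) :=
  {S | ∃ (γ : ℝ → X) (L : ℝ), IsClosedGeodesic γ L ∧ IsLeast (geodesicLengths X) L ∧
    S = Set.range γ}

/-! ### The cross with opposite boundaries glued -/

/-- The length `u` of the sides of the right-angled pentagon that meet at the vertex opposite to
the side `σ`, that is, the distance from the centre of the octagon to its sides of length `2t`:
`sinh u = coth t`. -/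
def uLen (t : ℝ) : ℝ := Real.arsinh (Real.cosh t / Real.sinh t)

/-- The distance `w` from the centre of the octagon to its sides of length `σ`. The quadrilateral
with successive sides `u`, `t`, `σ / 2`, `w` has an angle `π / 4` at the centre of the octagon and
three right angles, so that `cosh t = cosh w * sin (π / 4)`. -/
def wLen (t : ℝ) : ℝ := Real.arcosh (√2 * Real.cosh t)

/-- The direction, from the centre, of the `j`-th side of length `2t` (top, left, bottom, right). -/
def axis (j : Fin 4) : ℝ := (j : ℕ) * (Real.pi / 2)

/-- The direction, from the centre, of the `j`-th side of length `σ`. -/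
def diagonal (j : Fin 4) : ℝ := (j : ℕ) * (Real.pi / 2) + Real.pi / 4

/-- The right-angled octagon `O(t)`, centred at `i`, with sides of lengths alternating between
`2t` and `σ(t)`. -/
def octagon (t : ℝ) : Set ℍ :=
  {z | ∀ j : Fin 4, z ∈ halfPlane (uLen t) (axis j) ∧ z ∈ halfPlane (wLen t) (diagonal j)}

/-- The length of the `a`-curves of the surface glued from one cross: they are the main diagonals
of the octagons, from a vertex `foot (uLen t) 0 t` to the opposite vertex. -/
def aLen (t : ℝ) : ℝ := dist (foot (uLen t) 0 t) (foot (uLen t) Real.pi t)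

/-- The length of the `c`-curves of the surface glued from one cross: they are the unions of two
opposite seams, a seam being a side of length `σ(t)` of the octagon, here the one between the
vertices `foot (uLen t) 0 t` and `foot (uLen t) (π / 2) (-t)`. -/
def cLen (t : ℝ) : ℝ := 2 * dist (foot (uLen t) 0 t) (foot (uLen t) (Real.pi / 2) (-t))

/-- The identifications on two copies of the octagon, the front (`true`) and the back (`false`).

* `seam`: the copies are glued along the sides of length `σ`, by the identity. The result is the
  cross `C(t)`. Its `j`-th boundary geodesic, of length `4t`, is made of the `j`-th side of length
  `2t` of the front and of that of the back, and is parametrized by `β_j(s) = (front, foot u θ_j s)`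
  for `-t ≤ s ≤ t` and `β_j(s) = (back, foot u θ_j (2t - s))` for `t ≤ s ≤ 3t`.
* `twist`: opposite boundary geodesics, in the directions `θ_j` and `θ_j + π`, are glued with a
  half twist. Without twist, `β_j(s)` would be glued to `β_{j+2}(-s)`, front to front. A half twist
  turns the circle by half of its length `4t`, so that `β_j(s)` is glued to `β_{j+2}(2t - s)`, which
  means that the point `s` of the front side is glued to the point `s` of the opposite back side. -/
inductive CrossRel (t : ℝ) : Bool × ℍ → Bool × ℍ → Prop
  | seam (j : Fin 4) (s : ℝ) :
      CrossRel t (true, foot (wLen t) (diagonal j) s) (false, foot (wLen t) (diagonal j) s)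
  | twist (j : Fin 4) (s : ℝ) :
      CrossRel t (true, foot (uLen t) (axis j) s) (false, foot (uLen t) (axis j + Real.pi) s)

/-- The closed surface obtained from the cross `C(t)` by gluing opposite boundary geodesics with
half twists. -/
def crossGluing (t : ℝ) : Gluing Bool where
  piece _ := octagon t
  rel := CrossRel t

/-! ### The Bolza surface -/

/-- The inradius of the regular octagon with interior angles `π / 4`. The centre, the midpoint of
a side and a vertex span a right triangle with angles `π / 8` and `π / 8`, so that its hyperbolic
cosine is `cos (π / 8) / sin (π / 8) = 1 + √2`. -/
def bolzaInradius : ℝ := Real.arcosh (1 + √2)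

/-- The direction, from the centre, of the `j`-th side of the regular octagon. -/
def bolzaDirection (j : Fin 8) : ℝ := (j : ℕ) * (Real.pi / 4)

/-- Opposite sides of the regular octagon are identified by the hyperbolic translation along the
line through their midpoints. -/
inductive BolzaRel : Unit × ℍ → Unit × ℍ → Prop
  | side (j : Fin 8) (s : ℝ) :
      BolzaRel ((), foot bolzaInradius (bolzaDirection j) s)
        ((), foot bolzaInradius (bolzaDirection j + Real.pi) (-s))

/-- The Bolza surface: the regular hyperbolic octagon with interior angles `π / 4`, with opposite
sides identified by translations. -/
def bolza : Gluing Unit where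
  piece _ := {z | ∀ j : Fin 8, z ∈ halfPlane bolzaInradius (bolzaDirection j)}
  rel := BolzaRel

end BolzaCross

end

noncomputable section

namespace BolzaCross

/-! ### Minkowski space and quaternions over a commutative ring -/

/-! Both surfaces are shown to be the quotient of the hyperbolic plane by the same arithmetic group.
In the hyperboloid model, divide the two spatial coordinates by `eta`, the square root of `u = 1 +
√2`. The form becomes `x₀² - u (x₁² + x₂²)`, isometries become norm-one quaternions acting by
conjugation, and the side pairings of the regular octagon get coefficients in `ℤ[√2]`. The group
`bolzaGroup` consists of the norm-one quaternions over `ℤ[√2]` that satisfy three parity conditions.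

The conjugation `√2 ↦ -√2` sends `u` to a negative number, so the conjugate forms are positive
definite and bound the conjugates of all coordinates. This gives discreteness. With the parity
conditions it also gives `Admissible.abs_a`: a half trace is `±1`, and then the element acts
trivially, or it has absolute value at least `u`. Hence a nontrivial motion displaces every point by
at least `2 arcosh u`, and the closed geodesics of exactly this length are the projections of the
polars of integral vectors of norm `-2u` (`IsOrbitMap.systoles_eq`).

The equation `a = c` reduces to `sinh² t = √2 / 2`. There `uLen` and `wLen` agree, so the
right-angled octagon is regular, and its mirror images in its sides are centred at the vertices of
the Bolza octagon. A gluing whose pieces tile the plane under the group is the orbit space, with its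
quotient distance (`IsTessellation.exists_isOrbitMap`). The tilings by the Bolza octagon and by the
front and back octagons come from Voronoi inequalities. These are linear on the hyperboloid, so on
each triangular sector they need checking only at the centre and at two corners, where they follow
from arithmetic in `ℤ[√2]`; the equality cases give the identifications on the boundary.

For the count, side pairings move every axis to within the inradius of the base point
(`IsOrbitMap.exists_reduced`), and a finite computation leaves twelve vectors up to sign
(`reduced_classification`). The group preserves congruence classes modulo `2` and `4`, and these
separate the twelve (`IsOrbitMap.systoleVec_injective`). -/

/-- A vector of the three-dimensional space carrying the quadratic form
`x₀² - u * (x₁² + x₂²)`. -/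
@[ext]
structure Vec (R : Type) where
  x0 : R
  x1 : R
  x2 : R
deriving DecidableEq

/-- The element `a + b K + √u (c J + d K J)` of the quaternion algebra with `K² = -1`, `J² = 1` and
`J K = - K J`. -/
@[ext]
structure Quat (R : Type) where
  a : R
  b : R
  c : R
  d : R

section Ring

variable {R S : Type} [CommRing R] [CommRing S]

namespace Vec

/-- The Minkowski form with parameter `u`. -/
def form (u : R) (x y : Vec R) : R := x.x0 * y.x0 - u * (x.x1 * y.x1 + x.x2 * y.x2)

/-- The linear combination `s x + t y`. -/
def comb (s : R) (x : Vec R) (t : R) (y : Vec R) : Vec R :=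
  ⟨s * x.x0 + t * y.x0, s * x.x1 + t * y.x1, s * x.x2 + t * y.x2⟩

instance : Neg (Vec R) := ⟨fun x => ⟨-x.x0, -x.x1, -x.x2⟩⟩

/-- The image of a vector under a ring homomorphism. -/
def map (f : R →+* S) (x : Vec R) : Vec S := ⟨f x.x0, f x.x1, f x.x2⟩

/-- The determinant of three vectors. -/
def det (x y z : Vec R) : R :=
  x.x0 * (y.x1 * z.x2 - y.x2 * z.x1) - x.x1 * (y.x0 * z.x2 - y.x2 * z.x0)
    + x.x2 * (y.x0 * z.x1 - y.x1 * z.x0)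

/-- The vector product with respect to the form. -/
def cross (u : R) (x y : Vec R) : Vec R :=
  ⟨u * (x.x1 * y.x2 - x.x2 * y.x1), x.x0 * y.x2 - x.x2 * y.x0, x.x1 * y.x0 - x.x0 * y.x1⟩

/-- The base point `i` of the hyperbolic plane. -/
def base : Vec R := ⟨1, 0, 0⟩

@[simp] theorem neg_x0 (x : Vec R) : (-x).x0 = -x.x0 := rfl
@[simp] theorem neg_x1 (x : Vec R) : (-x).x1 = -x.x1 := rfl
@[simp] theorem neg_x2 (x : Vec R) : (-x).x2 = -x.x2 := rfl

theorem form_comm (u : R) (x y : Vec R) : form u x y = form u y x := by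
  simp only [form]; ring

theorem form_comb (u s t : R) (x y z : Vec R) :
    form u (comb s x t y) z = s * form u x z + t * form u y z := by
  simp only [form, comb]; ring

theorem form_base (u : R) (x : Vec R) : form u x base = x.x0 := by
  simp only [form, base]; ring

theorem form_neg (u : R) (x y : Vec R) : form u x (-y) = -form u x y := by
  simp only [form, neg_x0, neg_x1, neg_x2]; ring

/-- The product of two determinants is the determinant of the matrix of mutual products; `u ^ 2` is
the determinant of the form. It replaces dimension counts for vectors orthogonal to a plane. -/
theorem gram (u : R) (x y z x' y' z' : Vec R) : u ^ 2 * (det x y z * det x' y' z') =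
    form u x x' * (form u y y' * form u z z' - form u y z' * form u z y')
    - form u x y' * (form u y x' * form u z z' - form u y z' * form u z x')
    + form u x z' * (form u y x' * form u z y' - form u y y' * form u z x') := by
  simp only [form, det]; ring

theorem map_form (f : R →+* S) (u : R) (x y : Vec R) :
    form (f u) (x.map f) (y.map f) = f (form u x y) := by
  simp [form, map]

@[simp] theorem map_base (f : R →+* S) : (base : Vec R).map f = base := by simp [base, map]

@[simp] theorem map_neg (f : R →+* S) (x : Vec R) : (-x).map f = -x.map f := by
  ext <;> simp [map]

theorem map_injective {f : R →+* S} (hf : Function.Injective f) :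
    Function.Injective (Vec.map f) := by
  intro x y h
  simp only [map, Vec.mk.injEq] at h
  exact Vec.ext (hf h.1) (hf h.2.1) (hf h.2.2)

end Vec

namespace Quat

/-- The norm form. -/
def norm (u : R) (q : Quat R) : R := q.a ^ 2 + q.b ^ 2 - u * (q.c ^ 2 + q.d ^ 2)

/-- The product of the quaternion algebra. -/
def mul (u : R) (q r : Quat R) : Quat R :=
  ⟨q.a * r.a - q.b * r.b + u * (q.c * r.c + q.d * r.d),
    q.a * r.b + q.b * r.a + u * (q.d * r.c - q.c * r.d),
    q.a * r.c + q.c * r.a - q.b * r.d + q.d * r.b,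
    q.a * r.d + q.d * r.a + q.b * r.c - q.c * r.b⟩

/-- The conjugate quaternion. -/
def conj (q : Quat R) : Quat R := ⟨q.a, -q.b, -q.c, -q.d⟩

/-- The image of a quaternion under a ring homomorphism. -/
def map (f : R →+* S) (q : Quat R) : Quat S := ⟨f q.a, f q.b, f q.c, f q.d⟩

/-- The action of quaternions on vectors by conjugation. -/
def act (u : R) (q : Quat R) (x : Vec R) : Vec R :=
  ⟨x.x0 * (q.a ^ 2 + q.b ^ 2 + u * (q.c ^ 2 + q.d ^ 2))
      + 2 * u * ((q.a * q.c + q.b * q.d) * x.x1 + (q.a * q.d - q.b * q.c) * x.x2),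
    (q.a ^ 2 - q.b ^ 2) * x.x1 - 2 * q.a * q.b * x.x2 + 2 * x.x0 * (q.a * q.c - q.b * q.d)
      + u * ((q.c ^ 2 - q.d ^ 2) * x.x1 + 2 * q.c * q.d * x.x2),
    (q.a ^ 2 - q.b ^ 2) * x.x2 + 2 * q.a * q.b * x.x1 + 2 * x.x0 * (q.a * q.d + q.b * q.c)
      + u * (2 * q.c * q.d * x.x1 - (q.c ^ 2 - q.d ^ 2) * x.x2)⟩

/-- The pure part of a quaternion, as a vector. -/
def pure (q : Quat R) : Vec R := ⟨q.b, -q.d, q.c⟩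

/-- The quaternion with scalar part `a` and pure part `n`. -/
def ofPure (a : R) (n : Vec R) : Quat R := ⟨a, n.x0, n.x2, -n.x1⟩

theorem norm_mul (u : R) (q r : Quat R) : norm u (mul u q r) = norm u q * norm u r := by
  simp only [norm, mul]; ring

theorem norm_conj (u : R) (q : Quat R) : norm u (conj q) = norm u q := by
  simp only [norm, conj]; ring

theorem norm_map (f : R →+* S) (u : R) (q : Quat R) : norm (f u) (q.map f) = f (norm u q) := by
  simp [norm, map]

theorem act_map (f : R →+* S) (u : R) (q : Quat R) (x : Vec R) :
    act (f u) (q.map f) (x.map f) = (act u q x).map f := by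
  have h2 : f 2 = 2 := map_ofNat f 2
  ext <;> simp [act, map, Vec.map, h2]

theorem form_act (u : R) (q : Quat R) (x y : Vec R) :
    (act u q x).form u (act u q y) = norm u q ^ 2 * x.form u y := by
  simp only [Vec.form, act, norm]; ring

theorem act_comb (u s t : R) (q : Quat R) (x y : Vec R) :
    act u q (Vec.comb s x t y) = Vec.comb s (act u q x) t (act u q y) := by
  ext <;> simp only [act, Vec.comb] <;> ring

theorem act_neg (u : R) (q : Quat R) (x : Vec R) : act u q (-x) = -act u q x := by
  ext <;> simp only [act, Vec.neg_x0, Vec.neg_x1, Vec.neg_x2] <;> ring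

/-- The displacement of a vector by the action of a quaternion of norm one. -/
theorem form_act_self (u : R) (q : Quat R) (x : Vec R) (hq : norm u q = 1)
    (hx : x.form u x = 1) :
    x.form u (act u q x) = 2 * q.a ^ 2 - 1 + 2 * x.form u (pure q) ^ 2 := by
  -- With the norms kept as variables this is a polynomial identity, valid for every quaternion and
  -- vector.
  have : x.form u (act u q x) = (2 * q.a ^ 2 - norm u q) * x.form u x
      + 2 * x.form u (pure q) ^ 2 := by
    simp only [norm, Vec.form, act, pure]; ring
  rw [this, hq, hx]; ring

/-- A quaternion moves the vectors orthogonal to its pure part within that plane. -/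
theorem act_of_orthogonal (u : R) (q : Quat R) (x : Vec R) (hq : norm u q = 1)
    (hx : x.form u (pure q) = 0) :
    act u q x = Vec.comb (2 * q.a ^ 2 - 1) x (2 * q.a) (Vec.cross u x (pure q)) := by
  have h1 : norm u q - 1 = 0 := by rw [hq]; ring
  ext
  · have : (act u q x).x0 - (Vec.comb (2 * q.a ^ 2 - 1) x (2 * q.a)
        (Vec.cross u x (pure q))).x0 = -x.x0 * (norm u q - 1)
          + 2 * q.b * x.form u (pure q) := by
      simp only [norm, Vec.form, act, pure, Vec.comb, Vec.cross]; ring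
    rw [hx, h1] at this; linear_combination this
  · have : (act u q x).x1 - (Vec.comb (2 * q.a ^ 2 - 1) x (2 * q.a)
        (Vec.cross u x (pure q))).x1 = -x.x1 * (norm u q - 1)
          - 2 * q.d * x.form u (pure q) := by
      simp only [norm, Vec.form, act, pure, Vec.comb, Vec.cross]; ring
    rw [hx, h1] at this; linear_combination this
  · have : (act u q x).x2 - (Vec.comb (2 * q.a ^ 2 - 1) x (2 * q.a)
        (Vec.cross u x (pure q))).x2 = -x.x2 * (norm u q - 1)
          + 2 * q.c * x.form u (pure q) := by
      simp only [norm, Vec.form, act, pure, Vec.comb, Vec.cross]; ring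
    rw [hx, h1] at this; linear_combination this

end Quat

end Ring

/-! ### The hyperboloid model -/

/-- The unit `1 + √2`. -/
def unit : ℝ := 1 + √2

/-- The square root of `1 + √2`. -/
def eta : ℝ := √unit

theorem sqrt_two_sq : √2 * √2 = (2 : ℝ) := Real.mul_self_sqrt (by norm_num)

theorem sqrt_two_bounds : 1.4142 < √2 ∧ √2 < 1.41422 :=
  ⟨Real.lt_sqrt_of_sq_lt (by norm_num), (Real.sqrt_lt' (by norm_num)).2 (by norm_num)⟩

theorem unit_pos : 0 < unit := by unfold unit; positivity

theorem unit_sq : unit ^ 2 = 2 * unit + 1 := by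
  unfold unit; linear_combination sqrt_two_sq

theorem eta_pos : 0 < eta := Real.sqrt_pos.2 unit_pos

theorem eta_sq : eta ^ 2 = unit := Real.sq_sqrt unit_pos.le

/-- The Minkowski form of real vectors. -/
abbrev mink (x y : Vec ℝ) : ℝ := Vec.form unit x y

/-- The point of the hyperboloid corresponding to a point of the upper half-plane. -/
def vec (z : ℍ) : Vec ℝ :=
  -- Dividing the spatial coordinates by `eta` is what makes the points and isometries of interest
  -- integral over `ℤ[√2]`.
  ⟨(z.re ^ 2 + z.im ^ 2 + 1) / (2 * z.im), (z.re ^ 2 + z.im ^ 2 - 1) / (2 * z.im * eta),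
    -z.re / (z.im * eta)⟩

theorem mink_self (z : ℍ) : mink (vec z) (vec z) = 1 := by
  have h1 := z.im_pos.ne'
  have h2 := eta_pos.ne'
  simp only [mink, Vec.form, vec, ← eta_sq]
  field_simp
  ring

theorem cosh_dist_eq (z w : ℍ) : Real.cosh (dist z w) = mink (vec z) (vec w) := by
  have h1 := z.im_pos.ne'
  have h1 := w.im_pos.ne'
  have h2 := eta_pos.ne'
  rw [UpperHalfPlane.cosh_dist']
  simp only [mink, Vec.form, vec, ← eta_sq]
  field_simp
  ring

theorem vec_I : vec I = Vec.base := by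
  ext <;> simp [vec, Vec.base]

theorem vec_x0_pos (z : ℍ) : 0 < (vec z).x0 := by
  have := z.im_pos
  simp only [vec]; positivity

theorem eq_of_cosh_dist_eq_one {z w : ℍ} (h : Real.cosh (dist z w) = 1) : z = w := by
  by_contra hn
  exact (Real.one_lt_cosh.2 (dist_pos.2 hn).ne').ne' h

theorem vec_injective : Function.Injective vec := by
  intro z w h
  have h1 := cosh_dist_eq z w
  rw [h, mink_self] at h1
  exact eq_of_cosh_dist_eq_one h1

theorem one_le_mink (z w : ℍ) : 1 ≤ mink (vec z) (vec w) := by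
  rw [← cosh_dist_eq]; exact Real.one_le_cosh _

theorem dist_le_dist_iff (z w z' w' : ℍ) :
    dist z w ≤ dist z' w' ↔ mink (vec z) (vec w) ≤ mink (vec z') (vec w') := by
  rw [← cosh_dist_eq, ← cosh_dist_eq, Real.cosh_le_cosh, abs_of_nonneg dist_nonneg,
    abs_of_nonneg dist_nonneg]

theorem eq_of_mink_eq_one {z w : ℍ} (h : mink (vec z) (vec w) = 1) : z = w := by
  exact eq_of_cosh_dist_eq_one (by rw [cosh_dist_eq, h])

theorem dist_eq_of_mink {z w : ℍ} {r : ℝ} (h : mink (vec z) (vec w) = Real.cosh r) :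
    dist z w = |r| := by
  rw [← cosh_dist_eq, ← Real.cosh_abs r] at h
  exact Real.cosh_injOn (Set.mem_Ici.2 dist_nonneg) (Set.mem_Ici.2 (abs_nonneg r)) h

/-- Every vector of the upper sheet of the hyperboloid comes from the upper half-plane. -/
theorem exists_vec_eq (x : Vec ℝ) (h : mink x x = 1) (h0 : 0 < x.x0) : ∃ z : ℍ, vec z = x := by
  have he := eta_pos
  -- In light-cone coordinates the norm equation is a product. The factor `x.x0 - x.x1 * eta` is the
  -- inverse of the imaginary part of the desired point.
  have hf : (x.x0 - x.x1 * eta) * (x.x0 + x.x1 * eta) = 1 + (x.x2 * eta) ^ 2 := by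
    simp only [mink, Vec.form, ← eta_sq] at h; linear_combination h
  have hq : 0 < x.x0 - x.x1 * eta := by
    by_contra hn
    have : 0 < x.x0 + x.x1 * eta := by linarith
    nlinarith [sq_nonneg (x.x2 * eta), mul_nonneg (sub_nonneg.2 (not_lt.1 hn)) this.le]
  set y := (x.x0 - x.x1 * eta)⁻¹ with hy
  have hy0 : 0 < y := inv_pos.2 hq
  refine ⟨⟨⟨-(x.x2 * eta * y), y⟩, hy0⟩, ?_⟩
  have e1 : (x.x0 - x.x1 * eta) * y = 1 := mul_inv_cancel₀ hq.ne'
  have key : (x.x2 * eta * y) ^ 2 + y ^ 2 = (x.x0 + x.x1 * eta) * y := by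
    have : (x.x2 * eta * y) ^ 2 + y ^ 2 = (1 + (x.x2 * eta) ^ 2) * y * y := by ring
    rw [this, ← hf]
    linear_combination (x.x0 + x.x1 * eta) * y * e1
  ext
  · simp only [vec, UpperHalfPlane.re, UpperHalfPlane.im, neg_sq, key]
    rw [div_eq_iff (by positivity)]
    linear_combination -e1
  · simp only [vec, UpperHalfPlane.re, UpperHalfPlane.im, neg_sq, key]
    rw [div_eq_iff (by positivity)]
    linear_combination e1
  · simp only [vec, UpperHalfPlane.re, UpperHalfPlane.im, neg_neg]
    rw [div_eq_iff (by positivity)]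
    ring

/-- The quaternion of a matrix. -/
def quat (g : SL(2, ℝ)) : Quat ℝ :=
  ⟨(g 0 0 + g 1 1) / 2, (g 0 1 - g 1 0) / 2, (g 0 0 - g 1 1) / (2 * eta),
    -(g 0 1 + g 1 0) / (2 * eta)⟩

theorem det_eq (g : SL(2, ℝ)) : g 0 0 * g 1 1 - g 0 1 * g 1 0 = 1 := by
  have := g.2; rwa [Matrix.det_fin_two] at this

theorem norm_quat (g : SL(2, ℝ)) : (quat g).norm unit = 1 := by
  have h2 := eta_pos.ne'
  rw [← det_eq g]
  simp only [Quat.norm, quat, ← eta_sq]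
  field_simp
  ring

theorem quat_mul (g h : SL(2, ℝ)) : quat (g * h) = Quat.mul unit (quat g) (quat h) := by
  have h2 := eta_pos.ne'
  ext <;> simp only [quat, Quat.mul, Matrix.SpecialLinearGroup.coe_mul, Matrix.mul_apply,
    Fin.sum_univ_two, ← eta_sq] <;> field_simp <;> ring

theorem quat_inv (g : SL(2, ℝ)) : quat g⁻¹ = (quat g).conj := by
  ext <;> simp [quat, Quat.conj, Matrix.SpecialLinearGroup.SL2_inv_expl] <;> ring

/-- The matrix of a quaternion. -/
def ofQuat (q : Quat ℝ) (h : q.norm unit = 1) : SL(2, ℝ) :=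
  ⟨!![q.a + eta * q.c, q.b - eta * q.d; -q.b - eta * q.d, q.a - eta * q.c], by
    rw [Matrix.det_fin_two_of, ← h, Quat.norm, ← eta_sq]; ring⟩

theorem quat_ofQuat (q : Quat ℝ) (h : q.norm unit = 1) : quat (ofQuat q h) = q := by
  have h2 := eta_pos.ne'
  ext <;> simp [quat, ofQuat] <;> field_simp <;> ring

/-- This equivariance replaces Möbius transformations by the polynomial action of quaternions, in
which integrality and congruences can be followed. -/
theorem vec_smul (g : SL(2, ℝ)) (z : ℍ) : vec (g • z) = (quat g).act unit (vec z) := by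
  have h2 := eta_pos.ne'
  have h3 := z.im_pos
  have hd := det_eq g
  have hc : ((g • z : ℍ) : ℂ) = (g 0 0 * z + g 0 1) / (g 1 0 * z + g 1 1) := by
    rw [UpperHalfPlane.coe_specialLinearGroup_apply]; simp
  have hq : quat g = ⟨(g 0 0 + g 1 1) / 2, (g 0 1 - g 1 0) / 2, (g 0 0 - g 1 1) / (2 * eta),
    -(g 0 1 + g 1 0) / (2 * eta)⟩ := rfl
  generalize g 0 0 = a at *
  generalize g 0 1 = b at *
  generalize g 1 0 = c at *
  generalize g 1 1 = d at *
  obtain ⟨x, hx⟩ : ∃ x, z.re = x := ⟨_, rfl⟩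
  obtain ⟨y, hy⟩ : ∃ y, z.im = y := ⟨_, rfl⟩
  rw [hy] at h3
  have hD : 0 < (c * x + d) ^ 2 + (c * y) ^ 2 := by
    by_cases hc0 : c = 0
    · have : d ≠ 0 := by rintro rfl; rw [hc0] at hd; simp at hd
      rw [hc0]; simp; positivity
    · have := mul_ne_zero hc0 h3.ne'
      positivity
  obtain ⟨D, hDe⟩ : ∃ D, (c * x + d) ^ 2 + (c * y) ^ 2 = D := ⟨_, rfl⟩
  rw [hDe] at hD
  have hn : Complex.normSq ((c : ℂ) * z + d) = D := by
    rw [Complex.normSq_apply]; simp [hx, hy]; linear_combination hDe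
  have hD' := hD.ne'
  have him : (g • z).im = y / D := by
    rw [← UpperHalfPlane.coe_im, hc, Complex.div_im, hn]
    simp [hx, hy]
    field_simp
    linear_combination hd
  have hre : (g • z).re = ((a * x + b) * (c * x + d) + a * c * y ^ 2) / D := by
    rw [← UpperHalfPlane.coe_re, hc, Complex.div_re, hn]
    simp [hx, hy]
    field_simp
  -- This is `|g z|² = |a z + b|² / |c z + d|²`.
  have hsq : (g • z).re ^ 2 + (g • z).im ^ 2 = ((a * x + b) ^ 2 + (a * y) ^ 2) / D := by
    have : ((a * x + b) * (c * x + d) + a * c * y ^ 2) ^ 2 + y ^ 2 =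
        ((a * x + b) ^ 2 + (a * y) ^ 2) * D := by
      rw [← hDe]; linear_combination (-y ^ 2 * (a * d - b * c + 1)) * hd
    rw [him, hre, div_pow, div_pow, ← add_div, this]
    field_simp
  rw [hq]
  have h3' := h3.ne'
  ext
  · simp only [vec, hsq]
    simp only [him, Quat.act, ← eta_sq, hx, hy]
    field_simp
    rw [← hDe]
    ring
  · simp only [vec, hsq]
    simp only [him, Quat.act, ← eta_sq, hx, hy]
    field_simp
    rw [← hDe]
    ring
  · simp only [vec, hre, him, Quat.act, ← eta_sq, hx, hy]
    field_simp
    ring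

/-! ### The ring `ℤ[√2]` and the Bolza group -/

/-- The first real embedding of `ℤ[√2]`. -/
def emb : ℤ√2 →+* ℝ := Zsqrtd.lift ⟨√2, by rw [sqrt_two_sq]; norm_num⟩

/-- The second real embedding of `ℤ[√2]`. -/
def emb' : ℤ√2 →+* ℝ := Zsqrtd.lift ⟨-√2, by rw [neg_mul_neg, sqrt_two_sq]; norm_num⟩

theorem emb_apply (x : ℤ√2) : emb x = x.re + x.im * √2 := by simp [emb]

theorem emb'_apply (x : ℤ√2) : emb' x = x.re - x.im * √2 := by simp [emb']; ring

theorem not_square_two (n : ℤ) : (2 : ℤ) ≠ n * n := by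
  intro h
  have h1 : n ≤ 1 := by nlinarith
  have h2 : -1 ≤ n := by nlinarith
  interval_cases n <;> omega

theorem emb_injective : Function.Injective emb := Zsqrtd.lift_injective _ not_square_two

theorem emb'_injective : Function.Injective emb' := Zsqrtd.lift_injective _ not_square_two

/-- The unit `1 + √2` of `ℤ[√2]`. -/
def zunit : ℤ√2 := ⟨1, 1⟩

@[simp] theorem emb_zunit : emb zunit = unit := by simp [emb_apply, zunit, unit]

@[simp] theorem emb_two : emb 2 = 2 := map_ofNat emb 2

theorem emb'_zunit : emb' zunit = 1 - √2 := by simp [emb'_apply, zunit]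

theorem zunit_sq : zunit ^ 2 = 2 * zunit + 1 := by decide

/-- There are only finitely many elements of `ℤ[√2]` with given bounds on both conjugates. -/
theorem finite_bounded (M N : ℝ) : {x : ℤ√2 | |emb x| ≤ M ∧ |emb' x| ≤ N}.Finite := by
  have hf : (Set.Icc (-⌈M + N⌉) ⌈M + N⌉ ×ˢ Set.Icc (-⌈M + N⌉) ⌈M + N⌉ : Set (ℤ × ℤ)).Finite :=
    (Set.finite_Icc _ _).prod (Set.finite_Icc _ _)
  refine (hf.image fun p : ℤ × ℤ => (⟨p.1, p.2⟩ : ℤ√2)).subset ?_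
  rintro x ⟨h1, h2⟩
  rw [emb_apply, abs_le] at h1
  rw [emb'_apply, abs_le] at h2
  have hc := Int.le_ceil (M + N)
  obtain ⟨hs, -⟩ := sqrt_two_bounds
  refine ⟨(x.re, x.im), ⟨?_, ?_⟩, rfl⟩
  · have h3 : (x.re : ℝ) ≤ ⌈M + N⌉ := by nlinarith
    have h4 : -(⌈M + N⌉ : ℝ) ≤ x.re := by nlinarith
    exact ⟨by exact_mod_cast h4, by exact_mod_cast h3⟩
  · have h3 : (x.im : ℝ) ≤ ⌈M + N⌉ := by nlinarith
    have h4 : -(⌈M + N⌉ : ℝ) ≤ x.im := by nlinarith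
    exact ⟨by exact_mod_cast h4, by exact_mod_cast h3⟩

/-- An element of `ℤ[√2]` larger than `1` whose conjugate is at most `1` in absolute value is at
least `1 + √2`. -/
theorem unit_le_of_one_lt (t : ℤ√2) (h : |emb' t| ≤ 1) (h1 : 1 < emb t) : unit ≤ emb t := by
  rw [emb_apply] at *
  rw [emb'_apply, abs_le] at h
  obtain ⟨hs, hs'⟩ := sqrt_two_bounds
  -- The two conjugates differ by `2√2 * t.im`, and the first one is the larger.
  have hb : 0 < t.im := by
    have : (0 : ℝ) < t.im := by nlinarith
    exact_mod_cast this
  rcases (show t.im = 1 ∨ 2 ≤ t.im by omega) with hb | hb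
  · rw [hb] at *
    have : 0 < t.re := by
      have : (0 : ℝ) < t.re := by linarith
      exact_mod_cast this
    have : (1 : ℝ) ≤ t.re := by exact_mod_cast this
    unfold unit; push_cast; linarith
  · have : (2 : ℝ) ≤ t.im := by exact_mod_cast hb
    unfold unit; nlinarith

/-- The conjugate form is definite on unit vectors over `ℤ[√2]`. -/
theorem abs_emb'_form_le (x y : Vec (ℤ√2)) (hx : x.form zunit x = 1) (hy : y.form zunit y = 1) :
    |emb' (x.form zunit y)| ≤ 1 := by
  obtain ⟨hs, hs'⟩ := sqrt_two_bounds
  have h1 := congrArg emb' hx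
  have h2 := congrArg emb' hy
  rw [← Vec.map_form, emb'_zunit, map_one] at h1 h2
  rw [← Vec.map_form, emb'_zunit]
  generalize x.map emb' = x' at *
  generalize y.map emb' = y' at *
  simp only [Vec.form] at *
  have h3 : (0 : ℝ) ≤ √2 - 1 := by linarith
  rw [abs_le]
  -- This is the Cauchy–Schwarz inequality for the definite conjugate form, read off from the values
  -- of the form at `x' + y'` and `x' - y'`.
  constructor
  · nlinarith [sq_nonneg (x'.x0 + y'.x0), mul_nonneg h3 (sq_nonneg (x'.x1 + y'.x1)),
      mul_nonneg h3 (sq_nonneg (x'.x2 + y'.x2))]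
  · nlinarith [sq_nonneg (x'.x0 - y'.x0), mul_nonneg h3 (sq_nonneg (x'.x1 - y'.x1)),
      mul_nonneg h3 (sq_nonneg (x'.x2 - y'.x2))]

/-! ### Lattice points and their separation -/

/-- The points of the upper half-plane with coordinates in `ℤ[√2]`. -/
def IsLattice (z : ℍ) (x : Vec (ℤ√2)) : Prop := vec z = x.map emb

theorem isLattice_I : IsLattice I Vec.base := by simp [IsLattice, vec_I]

theorem IsLattice.form_self {z : ℍ} {x : Vec (ℤ√2)} (h : IsLattice z x) :
    x.form zunit x = 1 := by
  apply emb_injective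
  rw [← Vec.map_form, ← h, emb_zunit, map_one]
  exact mink_self z

theorem IsLattice.mink_eq {z w : ℍ} {x y : Vec (ℤ√2)} (hz : IsLattice z x) (hw : IsLattice w y) :
    mink (vec z) (vec w) = emb (x.form zunit y) := by
  rw [hz, hw, ← Vec.map_form, emb_zunit]

theorem IsLattice.unique {z : ℍ} {x y : Vec (ℤ√2)} (hz : IsLattice z x) (hw : IsLattice z y) :
    x = y :=
  Vec.map_injective emb_injective (hz.symm.trans hw)

theorem IsLattice.eq {z w : ℍ} {x : Vec (ℤ√2)} (hz : IsLattice z x) (hw : IsLattice w x) :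
    z = w :=
  vec_injective (hz.trans hw.symm)

/-- Distinct lattice points are far apart. -/
theorem IsLattice.unit_le_mink {z w : ℍ} {x y : Vec (ℤ√2)} (hz : IsLattice z x)
    (hw : IsLattice w y) (h : z ≠ w) : unit ≤ mink (vec z) (vec w) := by
  rw [hz.mink_eq hw]
  refine unit_le_of_one_lt _ (abs_emb'_form_le x y hz.form_self hw.form_self) ?_
  rw [← hz.mink_eq hw]
  exact lt_of_le_of_ne (one_le_mink z w) fun h1 => h (eq_of_mink_eq_one h1.symm)

/-- The distance bounds the coordinates in the first embedding and the definite conjugate form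
bounds them in the second one, so only finitely many elements of `ℤ[√2]` can occur. -/
theorem finite_lattice_near (z : ℍ) (M : ℝ) :
    {w : ℍ | (∃ x, IsLattice w x) ∧ dist z w ≤ M}.Finite := by
  obtain ⟨hs, hs'⟩ := sqrt_two_bounds
  set N := Real.cosh (dist I z + M)
  -- The conjugates of the spatial coordinates have square at most `1 / (√2 - 1) = 1 + √2 < 4`, so
  -- `2` serves as a bound for all three.
  set A : Set (ℤ√2) := {x | |emb x| ≤ N ∧ |emb' x| ≤ 2}
  have hA : A.Finite := finite_bounded _ _
  have hB : ((fun p : (ℤ√2) × (ℤ√2) × (ℤ√2) => (⟨p.1, p.2.1, p.2.2⟩ : Vec (ℤ√2))) ''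
      (A ×ˢ A ×ˢ A)).Finite := (hA.prod (hA.prod hA)).image _
  refine Set.Finite.of_finite_image (f := vec) ((hB.image (Vec.map emb)).subset ?_)
    vec_injective.injOn
  rintro _ ⟨w, ⟨⟨x, hx⟩, hw⟩, rfl⟩
  refine ⟨x, ⟨(x.x0, x.x1, x.x2), ?_, rfl⟩, hx.symm⟩
  have h0 : (vec w).x0 ≤ N := by
    have h1 := cosh_dist_eq w I
    rw [vec_I, mink, Vec.form_base] at h1
    rw [← h1, Real.cosh_le_cosh, abs_of_nonneg dist_nonneg]
    refine le_trans ?_ (le_abs_self _)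
    have := dist_triangle I z w
    rw [dist_comm w I]; linarith
  have hp := vec_x0_pos w
  have h1 := mink_self w
  have h2 := congrArg emb' hx.form_self
  rw [← Vec.map_form, emb'_zunit, map_one] at h2
  rw [hx] at h1 h0 hp
  simp only [Vec.form, Vec.map, mink, unit] at h0 h1 h2 hp
  have hN : 0 ≤ N := hp.le.trans h0
  have h3 : (0 : ℝ) ≤ √2 - 1.4 := by linarith
  refine ⟨⟨?_, ?_⟩, ⟨?_, ?_⟩, ⟨?_, ?_⟩⟩ <;> apply abs_le_of_sq_le_sq _ (by positivity)
  · nlinarith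
  · nlinarith [mul_nonneg h3 (sq_nonneg (emb' x.x1)), mul_nonneg h3 (sq_nonneg (emb' x.x2)),
      sq_nonneg (emb' x.x1), sq_nonneg (emb' x.x2)]
  · nlinarith [mul_nonneg h3 (sq_nonneg (emb x.x1)), mul_nonneg h3 (sq_nonneg (emb x.x2)),
      sq_nonneg (emb x.x1), sq_nonneg (emb x.x2)]
  · nlinarith [mul_nonneg h3 (sq_nonneg (emb' x.x1)), mul_nonneg h3 (sq_nonneg (emb' x.x2)),
      sq_nonneg (emb' x.x1), sq_nonneg (emb' x.x2), sq_nonneg (emb' x.x0)]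
  · nlinarith [mul_nonneg h3 (sq_nonneg (emb x.x1)), mul_nonneg h3 (sq_nonneg (emb x.x2)),
      sq_nonneg (emb x.x1), sq_nonneg (emb x.x2)]
  · nlinarith [mul_nonneg h3 (sq_nonneg (emb' x.x1)), mul_nonneg h3 (sq_nonneg (emb' x.x2)),
      sq_nonneg (emb' x.x1), sq_nonneg (emb' x.x2), sq_nonneg (emb' x.x0)]

/-! ### The arithmetic group and its minimal displacement -/

/-- The congruence conditions that single out the elements of the Bolza group. -/
structure Admissible (q : Quat (ℤ√2)) : Prop where
  odd_a : ¬Even q.a.re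
  even_b : Even q.b.re
  even_cd : Even (q.c.re + q.d.re)
  norm_eq : q.norm zunit = 1

/-- The parity of the rational part is the residue modulo `√2`, and `zunit` has residue `1`. Modulo
`√2` the conditions say `a = 1`, `b = 0`, `c = d`, which the product formula preserves. -/
theorem Admissible.mul {q r : Quat (ℤ√2)} (hq : Admissible q) (hr : Admissible r) :
    Admissible (q.mul zunit r) := by
  obtain ⟨h1, h2, h3, h4⟩ := hq
  obtain ⟨k1, k2, k3, k4⟩ := hr
  rw [Int.even_add] at h3 k3
  refine ⟨?_, ?_, ?_, ?_⟩
  · simp [Quat.mul, zunit, Int.even_add, Int.even_sub, Int.even_mul, h1, h3, k1, k2, k3]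
  · simp [Quat.mul, zunit, Int.even_add, Int.even_sub, Int.even_mul, h2, h3, k2, k3]
  · simp [Quat.mul, zunit, Int.even_add, Int.even_sub, Int.even_mul, h1, h2, h3, k1, k2, k3]
  · rw [Quat.norm_mul, h4, k4, mul_one]

theorem Admissible.conj {q : Quat (ℤ√2)} (hq : Admissible q) : Admissible q.conj := by
  obtain ⟨h1, h2, h3, h4⟩ := hq
  refine ⟨h1, by simpa [Quat.conj] using h2, ?_, by rw [Quat.norm_conj, h4]⟩
  have : q.conj.c.re + q.conj.d.re = -(q.c.re + q.d.re) := by simp [Quat.conj]; ring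
  rw [this]; exact h3.neg

/-- The Fuchsian group of the Bolza surface. -/
def bolzaGroup : Subgroup SL(2, ℝ) where
  carrier := {g | ∃ q, Admissible q ∧ quat g = q.map emb}
  mul_mem' := by
    rintro g h ⟨q, hq, hg⟩ ⟨r, hr, hh⟩
    refine ⟨_, hq.mul hr, ?_⟩
    rw [quat_mul, hg, hh]
    ext <;> simp [Quat.mul, Quat.map]
  one_mem' := by
    refine ⟨⟨1, 0, 0, 0⟩, ⟨by simp, by simp, by simp, by decide⟩, ?_⟩
    ext <;> simp [quat, Quat.map]
  inv_mem' := by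
    rintro g ⟨q, hq, hg⟩
    refine ⟨_, hq.conj, ?_⟩
    rw [quat_inv, hg]
    ext <;> simp [Quat.conj, Quat.map]

theorem norm_map_emb {q : Quat (ℤ√2)} (h : q.norm zunit = 1) : (q.map emb).norm unit = 1 := by
  rw [← emb_zunit, Quat.norm_map, h, map_one]

/-- The element of `SL(2, ℝ)` given by a quaternion of norm one over `ℤ[√2]`. -/
def toSL (q : Quat (ℤ√2)) (h : q.norm zunit = 1) : SL(2, ℝ) :=
  ofQuat (q.map emb) (norm_map_emb h)

theorem quat_toSL (q : Quat (ℤ√2)) (h : q.norm zunit = 1) : quat (toSL q h) = q.map emb :=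
  quat_ofQuat _ _

theorem toSL_mem {q : Quat (ℤ√2)} (h : Admissible q) : toSL q h.norm_eq ∈ bolzaGroup :=
  ⟨q, h, quat_toSL _ _⟩

theorem IsLattice.smul {z : ℍ} {x : Vec (ℤ√2)} (hz : IsLattice z x) {g : SL(2, ℝ)}
    {q : Quat (ℤ√2)} (hg : quat g = q.map emb) : IsLattice (g • z) (q.act zunit x) := by
  rw [IsLattice, vec_smul, hg, hz, ← emb_zunit, Quat.act_map]

theorem exists_isLattice_smul {z : ℍ} {x : Vec (ℤ√2)} (hz : IsLattice z x) {g : SL(2, ℝ)}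
    (hg : g ∈ bolzaGroup) : ∃ y, IsLattice (g • z) y := by
  obtain ⟨q, -, hq⟩ := hg
  exact ⟨_, hz.smul hq⟩

/-- The half traces of the elements of the Bolza group. -/
theorem Admissible.abs_a {q : Quat (ℤ√2)} (h : Admissible q) (hu : |emb q.a| < unit) :
    q.b = 0 ∧ q.c = 0 ∧ q.d = 0 ∧ (q.a = 1 ∨ q.a = -1) := by
  obtain ⟨hs, hs'⟩ := sqrt_two_bounds
  have h1 := congrArg emb' h.norm_eq
  rw [map_one, ← Quat.norm_map, emb'_zunit] at h1
  simp only [Quat.norm, Quat.map] at h1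
  have h3 : (0 : ℝ) < √2 - 1 := by linarith
  -- The conjugate norm equation is a sum of nonnegative terms equal to `1`.
  have h4 : |emb' q.a| ≤ 1 := by
    apply abs_le_of_sq_le_sq _ (by positivity)
    nlinarith [sq_nonneg (emb' q.b), mul_nonneg h3.le (sq_nonneg (emb' q.c)),
      mul_nonneg h3.le (sq_nonneg (emb' q.d))]
  have ha : q.a = 1 ∨ q.a = -1 := by
    have h5 := h.odd_a
    rw [emb_apply, abs_lt, unit] at hu
    rw [emb'_apply, abs_le] at h4
    have h6 : (q.a.im : ℝ) < 2 := by nlinarith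
    have h7 : -2 < (q.a.im : ℝ) := by nlinarith
    have h8 : (q.a.re : ℝ) < 2 := by nlinarith
    have h9 : -2 < (q.a.re : ℝ) := by nlinarith
    have h6 : q.a.im < 2 := by exact_mod_cast h6
    have h7 : -2 < q.a.im := by exact_mod_cast h7
    have h8 : q.a.re < 2 := by exact_mod_cast h8
    have h9 : -2 < q.a.re := by exact_mod_cast h9
    have h10 : q.a.re ≠ 0 := by intro h0; rw [h0] at h5; simp at h5
    have h11 : q.a.im = 0 := by
      by_contra h0
      -- If both parts are `±1`, one of the two conjugates has absolute value `1 + √2`, which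
      -- contradicts `hu` or `h4`.
      rcases (show q.a.re = 1 ∨ q.a.re = -1 by omega) with e | e <;>
      rcases (show q.a.im = 1 ∨ q.a.im = -1 by omega) with e' | e' <;>
      · rw [e, e'] at hu h4; push_cast at hu h4; linarith [hu.1, hu.2, h4.1, h4.2]
    rcases (show q.a.re = 1 ∨ q.a.re = -1 by omega) with e | e
    · left; ext <;> simp [e, h11]
    · right; ext <;> simp [e, h11]
  -- The scalar part now uses up the whole definite conjugate norm, so the other three coordinates
  -- vanish.
  have ha2 : emb' q.a ^ 2 = 1 := by rcases ha with e | e <;> simp [e]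
  have h5 : emb' q.b ^ 2 = 0 := by
    nlinarith [sq_nonneg (emb' q.b), mul_nonneg h3.le (sq_nonneg (emb' q.c)),
      mul_nonneg h3.le (sq_nonneg (emb' q.d))]
  have h6 : (√2 - 1) * emb' q.c ^ 2 = 0 := by
    nlinarith [sq_nonneg (emb' q.b), mul_nonneg h3.le (sq_nonneg (emb' q.c)),
      mul_nonneg h3.le (sq_nonneg (emb' q.d))]
  have h7 : (√2 - 1) * emb' q.d ^ 2 = 0 := by
    nlinarith [sq_nonneg (emb' q.b), mul_nonneg h3.le (sq_nonneg (emb' q.c)),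
      mul_nonneg h3.le (sq_nonneg (emb' q.d))]
  have key : ∀ t : ℤ√2, emb' t ^ 2 = 0 → t = 0 := fun t ht =>
    emb'_injective (by rw [map_zero]; exact pow_eq_zero_iff (two_ne_zero) |>.1 ht)
  exact ⟨key _ h5, key _ ((mul_eq_zero.1 h6).resolve_left h3.ne'),
    key _ ((mul_eq_zero.1 h7).resolve_left h3.ne'), ha⟩

/-- The length of the shortest closed geodesics of the Bolza surface. -/
def sysLength : ℝ := 2 * Real.arcosh (1 + √2)

theorem one_lt_unit : 1 < unit := by
  have := sqrt_two_bounds.1; unfold unit; linarith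

theorem sysLength_pos : 0 < sysLength :=
  mul_pos two_pos (Real.arcosh_pos one_lt_unit)

theorem cosh_sysLength : Real.cosh sysLength = 2 * unit ^ 2 - 1 := by
  have := Real.cosh_arcosh one_lt_unit.le
  rw [sysLength, Real.cosh_two_mul, Real.sinh_sq]
  unfold unit at *
  rw [this]; ring

theorem cosh_dist_smul {g : SL(2, ℝ)} (z : ℍ) :
    Real.cosh (dist z (g • z)) = 2 * (quat g).a ^ 2 - 1 + 2 * mink (vec z) (quat g).pure ^ 2 := by
  rw [cosh_dist_eq, vec_smul]
  exact Quat.form_act_self _ _ _ (norm_quat g) (mink_self z)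

/-- An element of the Bolza group that moves a point by less than the systole is trivial. -/
theorem smul_eq_self_of_dist_lt {g : SL(2, ℝ)} (hg : g ∈ bolzaGroup) {z : ℍ}
    (h : dist z (g • z) < sysLength) (w : ℍ) : g • w = w := by
  obtain ⟨q, hq, hgq⟩ := hg
  -- The hyperbolic cosine of the displacement is at least `2 a² - 1`, whereas that of `sysLength`
  -- is `2 u² - 1`.
  have h1 : |emb q.a| < unit := by
    rw [← abs_of_pos sysLength_pos, ← abs_of_nonneg (dist_nonneg (x := z)),
      ← Real.cosh_lt_cosh, cosh_dist_smul, cosh_sysLength, hgq] at h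
    apply abs_lt_of_sq_lt_sq _ unit_pos.le
    simp only [Quat.map] at h
    nlinarith [sq_nonneg (mink (vec z) (Quat.pure ⟨emb q.a, emb q.b, emb q.c, emb q.d⟩))]
  obtain ⟨hb, hc, hd, ha⟩ := hq.abs_a h1
  apply vec_injective
  have ha : emb q.a ^ 2 = 1 := by rcases ha with e | e <;> simp [e]
  rw [vec_smul, hgq]
  ext <;> simp [Quat.act, Quat.map, hb, hc, hd, ha]

/-- Apart from elements that act trivially, the group acts freely. Two motions that agree at one
point therefore agree everywhere, which is how group elements are identified in the tilings. -/
theorem smul_eq_self_of_fixed {g : SL(2, ℝ)} (hg : g ∈ bolzaGroup) {z : ℍ}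
    (h : g • z = z) (w : ℍ) : g • w = w :=
  smul_eq_self_of_dist_lt hg (z := z) (by rw [h, dist_self]; exact sysLength_pos) w

/-! ### Congruence classes invariant under the group -/

/-- The classes of vectors over `ℤ[√2]` that the Bolza group preserves. -/
def SameClass (x y : Vec (ℤ√2)) : Prop :=
  (2 : ℤ) ∣ x.x1.im - y.x1.im ∧ (2 : ℤ) ∣ x.x2.im - y.x2.im ∧
    (4 : ℤ) ∣ (x.x1.re + x.x2.re) - (y.x1.re + y.x2.re) ∧
    (4 : ℤ) ∣ (x.x2.re - x.x1.re) - (y.x2.re - y.x1.re)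

instance (x y : Vec (ℤ√2)) : Decidable (SameClass x y) := by
  unfold SameClass; infer_instance

theorem SameClass.symm {x y : Vec (ℤ√2)} (h : SameClass x y) : SameClass y x := by
  unfold SameClass at *; omega

theorem SameClass.trans {x y z : Vec (ℤ√2)} (h : SameClass x y) (h' : SameClass y z) :
    SameClass x z := by
  unfold SameClass at *; omega

/-- This invariant separates the twelve systoles, the centres of front and back octagons, the
centres from the corners, and the different pairs of opposite corners. -/
theorem sameClass_act {q : Quat (ℤ√2)} (hq : Admissible q) {x : Vec (ℤ√2)}
    (hx : Even (x.x1.re + x.x2.re)) : SameClass (q.act zunit x) x := by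
  obtain ⟨h1, h2, h3, -⟩ := hq
  obtain ⟨⟨a0, m⟩, ⟨b0, n⟩, ⟨c0, c1⟩, ⟨d0, d1⟩⟩ := q
  obtain ⟨⟨o, o'⟩, ⟨s, s'⟩, ⟨t, t'⟩⟩ := x
  obtain ⟨k, rfl⟩ := Int.not_even_iff_odd.1 h1
  obtain ⟨l, rfl⟩ := even_iff_exists_two_mul.1 h2
  obtain ⟨r, hr⟩ := even_iff_exists_two_mul.1 h3
  obtain ⟨y, hy⟩ := even_iff_exists_two_mul.1 hx
  obtain rfl : d0 = 2 * r - c0 := by simp only at hr; linarith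
  obtain rfl : t = 2 * y - s := by simp only at hy; linarith
  simp only [SameClass, Quat.act, zunit, pow_two, Zsqrtd.re_add, Zsqrtd.im_add, Zsqrtd.re_sub,
    Zsqrtd.im_sub, Zsqrtd.re_mul, Zsqrtd.im_mul, Zsqrtd.re_ofNat, Zsqrtd.im_ofNat]
  -- Once the parity conditions are solved by explicit halves, the differences are integer
  -- polynomials whose coefficients are divisible by the required modulus.
  refine ⟨?_, ?_, ?_, ?_⟩ <;> ring_nf <;> omega

/-! ### Geodesic lines -/

/-- A unit-speed geodesic line of the hyperbolic plane, in the hyperboloid model. -/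
def IsLine (c : ℝ → ℍ) : Prop :=
  ∃ A B : Vec ℝ, mink A A = 1 ∧ mink B B = -1 ∧ mink A B = 0 ∧
    ∀ s, vec (c s) = Vec.comb (Real.cosh s) A (Real.sinh s) B

theorem mink_comb_comb (s t s' t' : ℝ) (A B : Vec ℝ) (h1 : mink A A = 1) (h2 : mink B B = -1)
    (h3 : mink A B = 0) :
    mink (Vec.comb s A t B) (Vec.comb s' A t' B) = s * s' - t * t' := by
  have : mink (Vec.comb s A t B) (Vec.comb s' A t' B) =
      s * s' * mink A A + t * t' * mink B B + (s * t' + t * s') * mink A B := by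
    simp only [mink, Vec.form, Vec.comb]; ring
  rw [this, h1, h2, h3]; ring

theorem IsLine.dist_eq {c : ℝ → ℍ} (hc : IsLine c) (s t : ℝ) : dist (c s) (c t) = |s - t| := by
  obtain ⟨A, B, h1, h2, h3, h⟩ := hc
  apply dist_eq_of_mink
  rw [h, h, mink_comb_comb _ _ _ _ _ _ h1 h2 h3, Real.cosh_sub]

/-- The line through a point in the direction of a unit tangent vector. -/
theorem exists_line (z : ℍ) (B : Vec ℝ) (h2 : mink B B = -1) (h3 : mink (vec z) B = 0) :
    ∃ c : ℝ → ℍ, IsLine c ∧ c 0 = z ∧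
      ∀ s, vec (c s) = Vec.comb (Real.cosh s) (vec z) (Real.sinh s) B := by
  have h1 := mink_self z
  have hp := vec_x0_pos z
  have key : ∀ s, ∃ w : ℍ, vec w = Vec.comb (Real.cosh s) (vec z) (Real.sinh s) B := by
    intro s
    apply exists_vec_eq
    · rw [mink_comb_comb _ _ _ _ _ _ h1 h2 h3]
      have := Real.cosh_sq s
      linear_combination this
    · generalize vec z = A at *
      -- The Gram determinant of the spatial parts is nonnegative, so `|B.x0| ≤ A.x0`. Since `|sinh
      -- s| < cosh s`, the curve stays on the upper sheet.
      have e : A.x0 ^ 2 - B.x0 ^ 2 - 1 = unit ^ 2 * (A.x1 * B.x2 - A.x2 * B.x1) ^ 2 := by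
        simp only [mink, Vec.form] at h1 h2 h3
        have e1 : unit * (A.x1 * A.x1 + A.x2 * A.x2) = A.x0 ^ 2 - 1 := by linear_combination -h1
        have e2 : unit * (B.x1 * B.x1 + B.x2 * B.x2) = B.x0 ^ 2 + 1 := by linear_combination -h2
        have e3 : unit * (A.x1 * B.x1 + A.x2 * B.x2) = A.x0 * B.x0 := by linear_combination -h3
        have : unit ^ 2 * (A.x1 * B.x2 - A.x2 * B.x1) ^ 2 =
          (unit * (A.x1 * A.x1 + A.x2 * A.x2)) * (unit * (B.x1 * B.x1 + B.x2 * B.x2))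
            - (unit * (A.x1 * B.x1 + A.x2 * B.x2)) ^ 2 := by ring
        rw [this, e1, e2, e3]; ring
      have hB : |B.x0| ≤ A.x0 := by
        apply abs_le_of_sq_le_sq _ hp.le
        have : 0 ≤ unit ^ 2 * (A.x1 * B.x2 - A.x2 * B.x1) ^ 2 := by positivity
        linarith
      have hs : |Real.sinh s| < Real.cosh s := by
        apply abs_lt_of_sq_lt_sq _ (Real.cosh_pos s).le
        linarith [Real.cosh_sq s]
      simp only [Vec.comb]
      have h5 : |Real.sinh s * B.x0| ≤ |Real.sinh s| * A.x0 := by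
        rw [abs_mul]; exact mul_le_mul_of_nonneg_left hB (abs_nonneg _)
      have h6 := (abs_le.1 h5).1
      have h7 := mul_lt_mul_of_pos_right hs hp
      linarith
  choose c hc using key
  refine ⟨c, ⟨vec z, B, h1, h2, h3, hc⟩, ?_, hc⟩
  apply vec_injective
  rw [hc]; ext <;> simp [Vec.comb]

/-- A distance preserving map on an interval extends to a geodesic line. -/
theorem exists_line_of_isometric (f : ℝ → ℍ) (s ε : ℝ) (hε : 0 < ε)
    (hf : ∀ u v, |u - s| < ε → |v - s| < ε → dist (f u) (f v) = |u - v|) :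
    ∃ c : ℝ → ℍ, IsLine c ∧ ∀ u, |u| < ε → c u = f (s + u) := by
  have hm : ∀ u v, |u| < ε → |v| < ε → mink (vec (f (s + u))) (vec (f (s + v))) =
      Real.cosh (u - v) := by
    intro u v hu hv
    rw [← cosh_dist_eq, hf _ _ (by simpa using hu) (by simpa using hv), Real.cosh_abs]
    congr 1; ring
  have hh : 0 < ε / 2 := by positivity
  set h := ε / 2 with hdef
  have hh' : |h| < ε := by rw [abs_of_pos hh]; linarith
  have h0 : |(0 : ℝ)| < ε := by simpa using hε
  have hs : Real.sinh h ≠ 0 := (Real.sinh_pos_iff.2 hh).ne'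
  set A := vec (f (s + 0)) with hA
  set C := vec (f (s + h)) with hC
  -- Solving `C = cosh h * A + sinh h * B` gives the unit tangent vector at `A` pointing to `C`.
  set B : Vec ℝ := Vec.comb (1 / Real.sinh h) C (-(Real.cosh h / Real.sinh h)) A with hB
  have hCA : mink C A = Real.cosh h := by rw [hm h 0 hh' h0, sub_zero]
  have hBx : ∀ x, mink x B = (mink x C - Real.cosh h * mink x A) / Real.sinh h := by
    intro x
    rw [mink, Vec.form_comm, hB, Vec.form_comb, Vec.form_comm unit C, Vec.form_comm unit A]
    field_simp
    ring
  have hAA : mink A A = 1 := mink_self _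
  have hCC : mink C C = 1 := mink_self _
  have hAB : mink A B = 0 := by
    rw [hBx, hAA, mink, Vec.form_comm]
    change (mink C A - _) / _ = 0
    rw [hCA]; simp
  have hBB : mink B B = -1 := by
    have : mink B B = (mink B C - Real.cosh h * mink A B) / Real.sinh h := by
      rw [hBx]; congr 3; exact Vec.form_comm _ _ _
    rw [this, hAB, mink, Vec.form_comm]
    change (mink C B - _) / _ = _
    rw [hBx, hCC, hCA]
    field_simp
    linear_combination -(Real.cosh_sq h)
  obtain ⟨c, hc, -, hcv⟩ := exists_line _ B hBB hAB
  refine ⟨c, hc, fun u hu => ?_⟩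
  -- The distances to the two points `A` and `C` are known, and they give the product of `f (s + u)`
  -- with the point of the line.
  apply eq_of_mink_eq_one
  rw [hcv, mink, Vec.form_comb, Vec.form_comm, Vec.form_comm unit B]
  change _ * mink (vec (f (s + u))) A + _ * mink (vec (f (s + u))) B = 1
  rw [hBx, hm u 0 hu h0, hm u h hu hh', sub_zero, Real.cosh_sub]
  field_simp
  linear_combination Real.sinh h * Real.cosh_sq u

theorem IsLine.eq_of_eq {c c' : ℝ → ℍ} (hc : IsLine c) (hc' : IsLine c') {s t : ℝ} (hst : s ≠ t)
    (h1 : c s = c' s) (h2 : c t = c' t) : c = c' := by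
  obtain ⟨A, B, -, -, -, h⟩ := hc
  obtain ⟨A', B', -, -, -, h'⟩ := hc'
  have e1 := (h s).symm.trans ((congrArg vec h1).trans (h' s))
  have e2 := (h t).symm.trans ((congrArg vec h2).trans (h' t))
  -- This is the determinant of the linear system that recovers `A` and `B` from the values at `s`
  -- and `t`.
  have hd : Real.sinh (t - s) ≠ 0 := by
    rw [Real.sinh_ne_zero]; exact sub_ne_zero.2 hst.symm
  rw [Real.sinh_sub] at hd
  have key : ∀ a b a' b' : ℝ,
      Real.cosh s * a + Real.sinh s * b = Real.cosh s * a' + Real.sinh s * b' →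
      Real.cosh t * a + Real.sinh t * b = Real.cosh t * a' + Real.sinh t * b' →
      a = a' ∧ b = b' := by
    intro a b a' b' h3 h4
    constructor <;> apply mul_left_cancel₀ hd
    · linear_combination Real.sinh t * h3 - Real.sinh s * h4
    · linear_combination Real.cosh s * h4 - Real.cosh t * h3
  simp only [Vec.comb, Vec.mk.injEq] at e1 e2
  obtain ⟨a0, b0⟩ := key _ _ _ _ e1.1 e2.1
  obtain ⟨a1, b1⟩ := key _ _ _ _ e1.2.1 e2.2.1
  obtain ⟨a2, b2⟩ := key _ _ _ _ e1.2.2 e2.2.2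
  obtain rfl : A = A' := Vec.ext a0 a1 a2
  obtain rfl : B = B' := Vec.ext b0 b1 b2
  funext x
  exact vec_injective ((h x).trans (h' x).symm)

theorem mink_act (g : SL(2, ℝ)) (x y : Vec ℝ) :
    mink ((quat g).act unit x) ((quat g).act unit y) = mink x y := by
  rw [mink, Quat.form_act, norm_quat]; ring

theorem IsLine.smul {c : ℝ → ℍ} (hc : IsLine c) (g : SL(2, ℝ)) : IsLine fun s => g • c s := by
  obtain ⟨A, B, h1, h2, h3, h⟩ := hc
  refine ⟨(quat g).act unit A, (quat g).act unit B, ?_, ?_, ?_, fun s => ?_⟩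
  · rw [mink_act, h1]
  · rw [mink_act, h2]
  · rw [mink_act, h3]
  · rw [vec_smul, h, Quat.act_comb]

theorem IsLine.shift {c : ℝ → ℍ} (hc : IsLine c) (a : ℝ) : IsLine fun s => c (s + a) := by
  obtain ⟨A, B, h1, h2, h3, h⟩ := hc
  refine ⟨Vec.comb (Real.cosh a) A (Real.sinh a) B, Vec.comb (Real.sinh a) A (Real.cosh a) B,
    ?_, ?_, ?_, fun s => ?_⟩
  · rw [mink_comb_comb _ _ _ _ _ _ h1 h2 h3]; linear_combination Real.cosh_sq a
  · rw [mink_comb_comb _ _ _ _ _ _ h1 h2 h3]; linear_combination -Real.cosh_sq a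
  · rw [mink_comb_comb _ _ _ _ _ _ h1 h2 h3]; ring
  · rw [h, Real.cosh_add, Real.sinh_add]
    ext <;> simp only [Vec.comb] <;> ring

/-- The set of points of the hyperbolic plane orthogonal to a vector. -/
def axisOf (n : Vec ℝ) : Set ℍ := {z | mink (vec z) n = 0}

/-- A geodesic line contained in the polar of a spacelike vector is equal to it. -/
theorem IsLine.range_eq_axisOf {c : ℝ → ℍ} (hc : IsLine c) {n : Vec ℝ}
    (hn : mink n n = -(2 * unit)) (h : ∀ s, c s ∈ axisOf n) : Set.range c = axisOf n := by
  refine Set.Subset.antisymm (Set.range_subset_iff.2 h) fun z hz => ?_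
  obtain ⟨A, B, h1, h2, h3, hv⟩ := hc
  have hAn : mink A n = 0 := by
    have := h 0
    rw [axisOf, Set.mem_ofPred_eq, hv, mink, Vec.form_comb] at this
    simpa using this
  have hBn : mink B n = 0 := by
    have := h 1
    rw [axisOf, Set.mem_ofPred_eq, hv, mink, Vec.form_comb] at this
    change _ * mink A n + _ * mink B n = 0 at this
    rw [hAn, mul_zero, zero_add] at this
    exact (mul_eq_zero.1 this).resolve_left (Real.sinh_pos_iff.2 one_pos).ne'
  have hu := unit_pos
  set D := vec z
  have hDD : mink D D = 1 := mink_self z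
  have hDn : mink D n = 0 := hz
  -- As `D` is orthogonal to `n`, these identities give `b² = a² - 1`, which is what makes `D = a A
  -- - b B` a point of the line.
  have g1 := Vec.gram unit D A n D A n
  have g2 := Vec.gram unit D A n A B n
  have g3 := Vec.gram unit A B n A B n
  rw [Vec.form_comm unit A D, Vec.form_comm unit n D, Vec.form_comm unit n A] at g1
  rw [Vec.form_comm unit n B, Vec.form_comm unit n A] at g2
  rw [Vec.form_comm unit B A, Vec.form_comm unit n B, Vec.form_comm unit n A] at g3
  simp only [mink] at *
  rw [hDD, h1, hn, hAn, hDn] at g1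
  rw [h1, hn, hBn, hAn, hDn, h3] at g2
  rw [h1, h2, h3, hn, hAn, hBn] at g3
  set a := Vec.form unit D A
  set b := Vec.form unit D B
  set p := Vec.det D A n
  set q := Vec.det A B n
  have e1 : unit * p ^ 2 = 2 * (a ^ 2 - 1) := mul_left_cancel₀ hu.ne' (by linear_combination g1)
  have e2 : unit * (p * q) = 2 * b := mul_left_cancel₀ hu.ne' (by linear_combination g2)
  have e3 : unit * q ^ 2 = 2 := mul_left_cancel₀ hu.ne' (by linear_combination g3)
  have hab : b ^ 2 = a ^ 2 - 1 := by
    have : (unit * p ^ 2) * (unit * q ^ 2) = (unit * (p * q)) ^ 2 := by ring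
    rw [e1, e2, e3] at this; linarith
  have ha : 0 < a := by
    have h5 := one_le_mink z (c 0)
    rw [hv, mink, Vec.form_comm, Vec.form_comb, Vec.form_comm unit A] at h5
    simp only [Real.cosh_zero, Real.sinh_zero, one_mul, zero_mul, add_zero] at h5
    exact lt_of_lt_of_le one_pos h5
  refine ⟨Real.arsinh (-b), ?_⟩
  apply eq_of_mink_eq_one
  have hcosh : Real.cosh (Real.arsinh (-b)) = a := by
    rw [Real.cosh_arsinh, show 1 + (-b) ^ 2 = a ^ 2 by linear_combination hab, Real.sqrt_sq ha.le]
  rw [hv, hcosh, Real.sinh_arsinh, mink, Vec.form_comb, Vec.form_comm unit A,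
    Vec.form_comm unit B]
  change a * a + -b * b = 1
  linear_combination -hab

/-- The polar of a spacelike vector is not empty. -/
theorem exists_mem_axisOf {n : Vec ℝ} (hn : mink n n = -(2 * unit)) : ∃ z, z ∈ axisOf n := by
  have hu := unit_pos
  simp only [mink, Vec.form] at hn
  have hr : 0 < n.x1 ^ 2 + n.x2 ^ 2 := by
    have : 0 < unit * (n.x1 ^ 2 + n.x2 ^ 2) := by nlinarith [mul_self_nonneg n.x0]
    exact (mul_pos_iff_of_pos_left hu).1 this
  set r := n.x1 ^ 2 + n.x2 ^ 2 with hrdef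
  have hx : 0 < √(r / 2) := Real.sqrt_pos.2 (by positivity)
  have hx2 : √(r / 2) ^ 2 = r / 2 := Real.sq_sqrt (by positivity)
  set x := √(r / 2)
  -- The witness is the foot of the perpendicular from the base point: its spatial part is parallel
  -- to that of `n`. Orthogonality fixes the ratio, and the unit norm then forces `x ^ 2 = r / 2`.
  obtain ⟨z, hz⟩ := exists_vec_eq ⟨x, x * n.x0 * n.x1 / (unit * r), x * n.x0 * n.x2 / (unit * r)⟩
    (by
      simp only [mink, Vec.form]
      have e : x * x - unit * (x * n.x0 * n.x1 / (unit * r) * (x * n.x0 * n.x1 / (unit * r)) +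
        x * n.x0 * n.x2 / (unit * r) * (x * n.x0 * n.x2 / (unit * r))) =
          x ^ 2 - unit * (x ^ 2 * n.x0 ^ 2 * (n.x1 ^ 2 + n.x2 ^ 2) / (unit * r) ^ 2) := by ring_nf
      rw [e, ← hrdef, hx2]
      field_simp
      linear_combination -hn + unit * hrdef) hx
  refine ⟨z, ?_⟩
  rw [axisOf, Set.mem_ofPred_eq, hz]
  simp only [mink, Vec.form]
  field_simp
  linear_combination n.x0 * hrdef

theorem smul_mem_axisOf {g : SL(2, ℝ)} {z : ℍ} {n : Vec ℝ} :
    g • z ∈ axisOf ((quat g).act unit n) ↔ z ∈ axisOf n := by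
  rw [axisOf, axisOf, Set.mem_ofPred_eq, Set.mem_ofPred_eq, vec_smul, mink_act]

/-! ### Closed geodesics of a quotient of the hyperbolic plane -/

/-- `π` identifies `X` with the quotient of the hyperbolic plane by the Bolza group. -/
structure IsOrbitMap {X : Type} [PseudoEMetricSpace X] (π : ℍ → X) : Prop where
  surjective : Function.Surjective π
  eq_iff : ∀ z w, π z = π w ↔ ∃ g ∈ bolzaGroup, g • z = w
  edist_eq : ∀ z w, edist (π z) (π w) = ⨅ g : bolzaGroup, edist z ((g : SL(2, ℝ)) • w)

section Orbit

variable {X : Type} [PseudoEMetricSpace X] {π : ℍ → X}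

theorem IsOrbitMap.smul_eq (hπ : IsOrbitMap π) {g : SL(2, ℝ)} (hg : g ∈ bolzaGroup) (z : ℍ) :
    π (g • z) = π z :=
  ((hπ.eq_iff z (g • z)).2 ⟨g, hg, rfl⟩).symm

/-- A translate of `w` closer to `z` than `w` itself would lie at distance less than `sysLength`
from `w`, hence be equal to `w`. -/
theorem IsOrbitMap.edist_of_near (hπ : IsOrbitMap π) {z w : ℍ} (h : dist z w ≤ sysLength / 2) :
    edist (π z) (π w) = edist z w := by
  rw [hπ.edist_eq]
  refine le_antisymm (iInf_le_of_le 1 (by simp)) (le_iInf fun g => ?_)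
  rw [edist_dist, edist_dist]
  apply ENNReal.ofReal_le_ofReal
  by_contra hlt
  push Not at hlt
  have h1 : dist w ((g : SL(2, ℝ)) • w) < sysLength := by
    have := dist_triangle_left w ((g : SL(2, ℝ)) • w) z
    linarith
  rw [smul_eq_self_of_dist_lt g.2 h1] at hlt
  exact lt_irrefl _ hlt

theorem IsOrbitMap.exists_lift (hπ : IsOrbitMap π) (z : ℍ) (x : X) {r : ℝ} (hr : 0 ≤ r)
    (hr' : r < sysLength / 2) (h : edist (π z) x = ENNReal.ofReal r) :
    ∃ w, π w = x ∧ dist z w = r := by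
  obtain ⟨w, rfl⟩ := hπ.surjective x
  have h1 : edist (π z) (π w) < ENNReal.ofReal (sysLength / 2) := by
    rw [h]; exact (ENNReal.ofReal_lt_ofReal_iff (half_pos sysLength_pos)).2 hr'
  rw [hπ.edist_eq, iInf_lt_iff] at h1
  obtain ⟨g, hg⟩ := h1
  rw [edist_dist, ENNReal.ofReal_lt_ofReal_iff (half_pos sysLength_pos)] at hg
  have h2 := hπ.edist_of_near hg.le
  rw [hπ.smul_eq g.2, h, edist_dist, ENNReal.ofReal_eq_ofReal_iff hr dist_nonneg] at h2
  exact ⟨_, hπ.smul_eq g.2 w, h2.symm⟩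

/-- Lines with the same projection near a common point are equal. -/
theorem IsOrbitMap.line_unique (hπ : IsOrbitMap π) {c c' : ℝ → ℍ} (hc : IsLine c)
    (hc' : IsLine c') {s ε : ℝ} (hε : 0 < ε) (h0 : c s = c' s)
    (h : ∀ u, |u - s| < ε → π (c u) = π (c' u)) : c = c' := by
  have hL := sysLength_pos
  -- With `δ ≤ sysLength / 4` the points `c (s + δ)` and `c' (s + δ)` are less than `sysLength`
  -- apart; being equivalent, they coincide.
  set δ := min (ε / 2) (sysLength / 4)
  have hδ : 0 < δ := lt_min (by positivity) (by positivity)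
  have hδ1 : δ < ε := lt_of_le_of_lt (min_le_left _ _) (by linarith)
  have hδ2 : δ ≤ sysLength / 4 := min_le_right _ _
  refine hc.eq_of_eq hc' (s := s) (t := s + δ) (by linarith) h0 ?_
  obtain ⟨g, hg, hgc⟩ := (hπ.eq_iff _ _).1 (h (s + δ) (by simpa [abs_of_pos hδ]))
  rw [← hgc]
  symm
  apply smul_eq_self_of_dist_lt hg (z := c (s + δ))
  rw [hgc]
  have h1 := dist_triangle (c (s + δ)) (c s) (c' (s + δ))
  rw [hc.dist_eq, h0, hc'.dist_eq] at h1
  simp [abs_of_pos hδ] at h1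
  linarith

/-- Points of `γ` within `sysLength / 4` of `γ s` lift at the right distance from one lift of `γ s`.
The lifts are then at most `sysLength / 2` apart, so their mutual distances are preserved as well
and they trace a piece of a line. -/
theorem IsOrbitMap.local_lift (hπ : IsOrbitMap π) {γ : ℝ → X} {L : ℝ}
    (hγ : IsClosedGeodesic γ L) (s : ℝ) :
    ∃ c, IsLine c ∧ ∃ ε > 0, ∀ u, |u - s| < ε → γ u = π (c u) := by
  obtain ⟨ε, hε, h⟩ := hγ.locally_isometric s
  have hL := sysLength_pos
  set δ := min ε (sysLength / 4)
  have hδ : 0 < δ := lt_min (by positivity) (by positivity)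
  have hδ1 : δ ≤ ε := min_le_left _ _
  have hδ2 : δ ≤ sysLength / 4 := min_le_right _ _
  obtain ⟨z, hz⟩ := hπ.surjective (γ s)
  have key : ∀ u, ∃ w, |u - s| < δ → π w = γ u ∧ dist z w = |u - s| := by
    intro u
    by_cases hu : |u - s| < δ
    · obtain ⟨w, hw⟩ := hπ.exists_lift z (γ u) (abs_nonneg (u - s)) (by linarith) (by
        rw [hz, h s u (by simpa) (by linarith), abs_sub_comm])
      exact ⟨w, fun _ => hw⟩
    · exact ⟨z, fun h => absurd h hu⟩
  choose f hf using key
  obtain ⟨c, hc, hcf⟩ := exists_line_of_isometric f s δ hδ (by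
    intro u v hu hv
    obtain ⟨h1, h2⟩ := hf u hu
    obtain ⟨h3, h4⟩ := hf v hv
    have h5 : dist (f u) (f v) ≤ sysLength / 2 := by
      have := dist_triangle_left (f u) (f v) z
      linarith
    have h6 := hπ.edist_of_near h5
    rw [h1, h3, h u v (by linarith) (by linarith), edist_dist,
      ENNReal.ofReal_eq_ofReal_iff (abs_nonneg _) dist_nonneg] at h6
    exact h6.symm)
  refine ⟨fun u => c (u + -s), hc.shift _, δ, hδ, fun u hu => ?_⟩
  have h1 : |u + -s| < δ := hu
  change γ u = π (c (u + -s))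
  rw [hcf _ h1, show s + (u + -s) = u by ring, (hf u hu).1]

/-- Closed geodesics lift to geodesic lines. -/
theorem IsOrbitMap.lift (hπ : IsOrbitMap π) {γ : ℝ → X} {L : ℝ} (hγ : IsClosedGeodesic γ L) :
    ∃ c, IsLine c ∧ ∀ u, γ u = π (c u) := by
  obtain ⟨c, hc, ε, hε, h⟩ := hπ.local_lift hγ 0
  refine ⟨c, hc, ?_⟩
  -- The parameters near which `c` lifts `γ` form a set that is open, closed and nonempty.
  set A : Set ℝ := {s | ∃ ε > 0, ∀ u, |u - s| < ε → γ u = π (c u)} with hA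
  have hop : IsOpen A := by
    rw [Metric.isOpen_iff]
    rintro s ⟨ε, hε, h⟩
    refine ⟨ε / 2, by positivity, fun s' hs' => ⟨ε / 2, by positivity, fun u hu => h u ?_⟩⟩
    rw [Metric.mem_ball, Real.dist_eq] at hs'
    have := abs_sub_le u s' s
    linarith
  have hcl : IsClosed A := by
    rw [← closure_subset_iff_isClosed]
    intro s hs
    obtain ⟨c', hc', ε, hε, h'⟩ := hπ.local_lift hγ s
    obtain ⟨s', ⟨ε', hε', h''⟩, hd⟩ := Metric.mem_closure_iff.1 hs ε hε
    rw [dist_comm, Real.dist_eq] at hd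
    -- At a limit point the local lift overlaps `c` up to a group element, and uniqueness of lines
    -- carries this to the whole interval.
    obtain ⟨g, hg, hgc⟩ := (hπ.eq_iff (c s') (c' s')).1 (by
      rw [← h'' s' (by simpa), ← h' s' hd])
    have he : (fun s => g • c s) = c' := by
      refine hπ.line_unique (hc.smul g) hc' (s := s') (ε := min ε' (ε - |s' - s|))
        (lt_min hε' (by linarith)) hgc fun u hu => ?_
      rw [lt_min_iff] at hu
      have h1 := abs_sub_le u s' s
      rw [hπ.smul_eq hg, ← h'' u hu.1, ← h' u (by linarith)]
    refine ⟨ε, hε, fun u hu => ?_⟩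
    rw [h' u hu, ← he, hπ.smul_eq hg]
  have huniv : A = Set.univ := IsClopen.eq_univ ⟨hcl, hop⟩ ⟨0, ε, hε, h⟩
  intro u
  obtain ⟨ε, hε, h⟩ := (huniv ▸ Set.mem_univ u : u ∈ A)
  exact h u (by simpa)

/-- The translated line and the shifted line project to the same curve and meet at one parameter, so
they are equal. -/
theorem IsOrbitMap.exists_period (hπ : IsOrbitMap π) {γ : ℝ → X} {L : ℝ}
    (hγ : IsClosedGeodesic γ L) : ∃ c, IsLine c ∧ (∀ u, γ u = π (c u)) ∧
      ∃ g ∈ bolzaGroup, ∀ s, g • c s = c (s + L) := by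
  obtain ⟨c, hc, h⟩ := hπ.lift hγ
  refine ⟨c, hc, h, ?_⟩
  have hp : ∀ u, π (c u) = π (c (u + L)) := fun u => by rw [← h, ← h, hγ.periodic u]
  obtain ⟨g, hg, hgc⟩ := (hπ.eq_iff _ _).1 (hp 0)
  refine ⟨g, hg, fun s => ?_⟩
  exact congrFun (hπ.line_unique (hc.smul g) (hc.shift L) one_pos hgc fun u _ => by
    rw [hπ.smul_eq hg, hp]) s

/-- The period element displaces a point of the lift by exactly `L`. If `L` were smaller than
`sysLength`, it would act trivially. -/
theorem IsOrbitMap.sysLength_le (hπ : IsOrbitMap π) {γ : ℝ → X} {L : ℝ}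
    (hγ : IsClosedGeodesic γ L) : sysLength ≤ L := by
  obtain ⟨c, hc, -, g, hg, h⟩ := hπ.exists_period hγ
  have hd : dist (c 0) (g • c 0) = L := by
    rw [h, hc.dist_eq]; simp [abs_of_pos hγ.pos]
  by_contra hlt
  have := smul_eq_self_of_dist_lt hg (hd.trans_lt (not_le.1 hlt)) (c 0)
  rw [this, dist_self] at hd
  exact hγ.pos.ne hd

/-! ### Systoles as projections of polars of vectors of norm `-2u` -/

/-- The normal vectors of the axes of the systoles. -/
structure IsSystoleVec (n : Vec (ℤ√2)) : Prop where
  form_self : n.form zunit n = -(2 * zunit)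
  even_x0 : Even n.x0.re
  even_add : Even (n.x1.re + n.x2.re)

theorem IsSystoleVec.mink_self {n : Vec (ℤ√2)} (hn : IsSystoleVec n) :
    mink (n.map emb) (n.map emb) = -(2 * unit) := by
  rw [mink, ← emb_zunit, Vec.map_form, hn.form_self]; simp

/-- The vector becomes the pure part of a group element with scalar part `zunit`; its norm is
`zunit² - 2 zunit = 1`. -/
theorem IsSystoleVec.admissible {n : Vec (ℤ√2)} (hn : IsSystoleVec n) :
    Admissible (Quat.ofPure zunit n) := by
  have h2 := hn.even_add
  refine ⟨by simp [Quat.ofPure, zunit], hn.even_x0, ?_, ?_⟩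
  · simp only [Quat.ofPure, Zsqrtd.re_neg]
    rw [Int.even_add] at h2 ⊢
    simp [h2]
  · have : (Quat.ofPure zunit n).norm zunit = zunit ^ 2 + n.form zunit n := by
      simp only [Quat.norm, Quat.ofPure, Vec.form]; ring
    rw [this, hn.form_self, zunit_sq]; ring

theorem sinh_sysLength : Real.sinh sysLength = 2 * unit * √(2 * unit) := by
  have hu := unit_pos
  rw [← abs_of_pos (Real.sinh_pos_iff.2 sysLength_pos), ← abs_of_pos (show 0 < 2 * unit *
    √(2 * unit) by positivity), ← sq_eq_sq_iff_abs_eq_abs, Real.sinh_sq, cosh_sysLength, mul_pow,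
    Real.sq_sqrt (by positivity)]
  linear_combination (4 * unit ^ 2) * unit_sq

/-- Every systole vector gives a closed geodesic. -/
theorem IsOrbitMap.exists_closedGeodesic (hπ : IsOrbitMap π) {n : Vec (ℤ√2)}
    (hn : IsSystoleVec n) :
    ∃ γ : ℝ → X, IsClosedGeodesic γ sysLength ∧ Set.range γ = π '' axisOf (n.map emb) := by
  have hnn := hn.mink_self
  obtain ⟨z, hz⟩ := exists_mem_axisOf hnn
  have hu := unit_pos
  set N := n.map emb with hN
  have hr : 0 < √(2 * unit) := Real.sqrt_pos.2 (by positivity)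
  have hr2 : √(2 * unit) ^ 2 = 2 * unit := Real.sq_sqrt (by positivity)
  set r := √(2 * unit)
  set C := Vec.cross unit (vec z) N with hC
  -- The vector product of the point and the normal is tangent to the axis and has norm `-2u`,
  -- whence the factor `1 / r`; the second summand is zero.
  set B : Vec ℝ := Vec.comb (1 / r) C 0 C with hB
  have hzn : mink (vec z) N = 0 := hz
  have hCC : mink C C = mink (vec z) (vec z) * mink N N - mink (vec z) N ^ 2 := by
    simp only [mink, Vec.form, hC, Vec.cross]; ring
  have hBx : ∀ x, mink B x = mink C x / r := by
    intro x; rw [hB, mink, Vec.form_comb]; ring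
  have hxB : ∀ x, mink x B = mink C x / r := by
    intro x; rw [mink, Vec.form_comm]; exact hBx x
  have hCN : mink C N = 0 := by
    simp only [mink, Vec.form, hC, Vec.cross]; ring
  have hCz : mink C (vec z) = 0 := by
    simp only [mink, Vec.form, hC, Vec.cross]; ring
  have hBB : mink B B = -1 := by
    rw [hBx, hxB, hCC, hzn, hnn, BolzaCross.mink_self]
    field_simp
    linear_combination hr2
  have hzB : mink (vec z) B = 0 := by rw [hxB, hCz, zero_div]
  obtain ⟨c, hc, hc0, hcv⟩ := exists_line z B hBB hzB
  have hmem : ∀ s, c s ∈ axisOf N := by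
    intro s
    rw [axisOf, Set.mem_ofPred_eq, hcv, mink, Vec.form_comb]
    change _ * mink (vec z) N + _ * mink B N = 0
    rw [hzn, hBx, hCN]; ring
  have hq := hn.admissible
  set q := Quat.ofPure zunit n with hqdef
  set g := toSL q hq.norm_eq
  have hgq : quat g = q.map emb := quat_toSL _ _
  have hpure : (q.map emb).pure = N := by
    ext <;> simp [hqdef, Quat.ofPure, Quat.map, Quat.pure, hN, Vec.map]
  have hqa : (q.map emb).a = unit := by simp [hqdef, Quat.ofPure, Quat.map]
  have hact : ∀ x, mink x N = 0 → (q.map emb).act unit x =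
      Vec.comb (2 * unit ^ 2 - 1) x (2 * unit) (Vec.cross unit x N) := by
    intro x hx
    rw [Quat.act_of_orthogonal _ _ _ (norm_map_emb hq.norm_eq) (by rw [hpure]; exact hx), hpure,
      hqa]
  -- By the double product formula, on the axis the product with `N` exchanges the point and its
  -- tangent up to scalars. The group element therefore translates the axis by `sysLength`.
  have hcc : Vec.cross unit C N = Vec.comb (-mink N N) (vec z) (mink (vec z) N) N := by
    ext <;> simp only [hC, Vec.cross, Vec.comb, mink, Vec.form] <;> ring
  rw [hnn, hzn] at hcc
  have hper : ∀ s, g • c s = c (s + sysLength) := by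
    intro s
    apply vec_injective
    rw [vec_smul, hgq, hact _ (hmem s), hcv, hcv, Real.cosh_add, Real.sinh_add, cosh_sysLength,
      sinh_sysLength]
    change _ = Vec.comb (_ + _ * (2 * unit * r)) _ (_ + _ * (2 * unit * r)) _
    have hlin : Vec.cross unit (Vec.comb (Real.cosh s) (vec z) (Real.sinh s) B) N =
        Vec.comb (Real.cosh s) C (Real.sinh s / r) (Vec.cross unit C N) := by
      ext <;> simp only [hB, Vec.comb, Vec.cross, hC] <;> field_simp <;> ring
    rw [hlin, hcc]
    ext <;> simp only [hB, Vec.comb] <;> field_simp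
    · linear_combination -(2 * unit * Real.sinh s * (vec z).x0) * hr2
    · linear_combination -(2 * unit * Real.sinh s * (vec z).x1) * hr2
    · linear_combination -(2 * unit * Real.sinh s * (vec z).x2) * hr2
  refine ⟨fun s => π (c s), ⟨sysLength_pos, ?_, ?_⟩, ?_⟩
  · intro s
    change π (c (s + sysLength)) = π (c s)
    rw [← hper, hπ.smul_eq (toSL_mem hq)]
  · intro s
    have hL := sysLength_pos
    refine ⟨sysLength / 4, by positivity, fun x y hx hy => ?_⟩
    have h1 : dist (c x) (c y) ≤ sysLength / 2 := by
      rw [hc.dist_eq]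
      have := abs_sub_le x s y
      rw [abs_sub_comm s y] at this
      linarith
    rw [hπ.edist_of_near h1, edist_dist, hc.dist_eq]
  · rw [← hc.range_eq_axisOf hnn hmem, ← Set.range_comp]; rfl

/-- The closed geodesics of minimal length come from systole vectors. -/
theorem IsOrbitMap.exists_systoleVec (hπ : IsOrbitMap π) {γ : ℝ → X}
    (hγ : IsClosedGeodesic γ sysLength) :
    ∃ n, IsSystoleVec n ∧ Set.range γ = π '' axisOf (n.map emb) := by
  obtain ⟨c, hc, hcγ, g, hg, h⟩ := hπ.exists_period hγ
  have hd : ∀ s, dist (c s) (g • c s) = sysLength := by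
    intro s
    rw [h, hc.dist_eq]; simp [abs_of_pos hγ.pos]
  have hg' := hg
  obtain ⟨q, hq, hgq⟩ := hg'
  have ha : unit ≤ |emb q.a| := by
    by_contra hlt
    obtain ⟨h1, h2, h3, h4⟩ := hq.abs_a (not_le.1 hlt)
    have ha : emb q.a ^ 2 = 1 := by rcases h4 with e | e <;> simp [e]
    have : g • c 0 = c 0 := by
      apply vec_injective
      rw [vec_smul, hgq]
      ext <;> simp [Quat.act, Quat.map, h1, h2, h3, ha]
    have h5 := hd 0
    rw [this, dist_self] at h5
    exact sysLength_pos.ne h5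
  have ha2 : unit ^ 2 ≤ emb q.a ^ 2 := by
    rw [← sq_abs (emb q.a)]; exact pow_le_pow_left₀ unit_pos.le ha 2
  have hpure : (quat g).pure = q.pure.map emb := by
    rw [hgq]; ext <;> simp [Quat.pure, Quat.map, Vec.map]
  have hqa : (quat g).a = emb q.a := by rw [hgq]; rfl
  -- The displacement along the line is the smallest possible. As `|a| ≥ u`, equality forces `|a| =
  -- u`, and every point of the line is orthogonal to the pure part.
  have heq : ∀ s, 2 * unit ^ 2 - 1 = 2 * emb q.a ^ 2 - 1 +
      2 * mink (vec (c s)) (q.pure.map emb) ^ 2 := by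
    intro s
    rw [← cosh_sysLength, ← hd s, cosh_dist_smul, hpure, hqa]
  have hform : ∀ s, c s ∈ axisOf (q.pure.map emb) := by
    intro s
    have : mink (vec (c s)) (q.pure.map emb) ^ 2 = 0 := by
      nlinarith [heq s, sq_nonneg (mink (vec (c s)) (q.pure.map emb))]
    exact pow_eq_zero_iff two_ne_zero |>.1 this
  have hqa2 : q.a ^ 2 = zunit ^ 2 := by
    apply emb_injective
    have h1 : mink (vec (c 0)) (q.pure.map emb) = 0 := hform 0
    have := heq 0
    rw [h1] at this
    rw [map_pow, map_pow, emb_zunit]; linarith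
  have hn : IsSystoleVec q.pure := by
    refine ⟨?_, hq.even_b, ?_⟩
    · have : q.pure.form zunit q.pure = q.norm zunit - q.a ^ 2 := by
        simp only [Quat.norm, Quat.pure, Vec.form]; ring
      rw [this, hq.norm_eq, hqa2, zunit_sq]; ring
    · have := hq.even_cd
      simp only [Quat.pure, Zsqrtd.re_neg]
      rw [Int.even_add] at this ⊢
      simp [this]
  refine ⟨q.pure, hn, ?_⟩
  rw [← hc.range_eq_axisOf hn.mink_self hform, ← Set.range_comp]
  congr 1
  funext u
  exact hcγ u

theorem IsOrbitMap.isLeast (hπ : IsOrbitMap π) {n : Vec (ℤ√2)} (hn : IsSystoleVec n) :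
    IsLeast (geodesicLengths X) sysLength := by
  obtain ⟨γ, hγ, -⟩ := hπ.exists_closedGeodesic hn
  exact ⟨⟨γ, hγ⟩, fun L ⟨γ', hγ'⟩ => hπ.sysLength_le hγ'⟩

theorem IsOrbitMap.systoles_eq (hπ : IsOrbitMap π) :
    systoles X = {S | ∃ n, IsSystoleVec n ∧ S = π '' axisOf (n.map emb)} := by
  ext S
  constructor
  · rintro ⟨γ, L, hγ, hL, rfl⟩
    -- Any one systole vector suffices here, to know that the least length is `sysLength`.
    have hn : IsSystoleVec ⟨0, ⟨0, 1⟩, 0⟩ := ⟨by decide, by simp, by simp⟩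
    obtain rfl := hL.unique (hπ.isLeast hn)
    exact hπ.exists_systoleVec hγ
  · rintro ⟨n, hn, rfl⟩
    obtain ⟨γ, hγ, hr⟩ := hπ.exists_closedGeodesic hn
    exact ⟨γ, sysLength, hγ, hπ.isLeast hn, hr.symm⟩

theorem IsOrbitMap.image_smul_axisOf (hπ : IsOrbitMap π) {g : SL(2, ℝ)} (hg : g ∈ bolzaGroup)
    (n : Vec ℝ) : π '' axisOf ((quat g).act unit n) = π '' axisOf n := by
  ext x
  constructor
  · rintro ⟨z, hz, rfl⟩
    refine ⟨g⁻¹ • z, ?_, hπ.smul_eq (inv_mem hg) z⟩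
    rw [← smul_mem_axisOf (g := g), smul_inv_smul]; exact hz
  · rintro ⟨z, hz, rfl⟩
    exact ⟨g • z, smul_mem_axisOf.2 hz, hπ.smul_eq hg z⟩

theorem axisOf_neg (n : Vec ℝ) : axisOf (-n) = axisOf n := by
  ext z
  rw [axisOf, axisOf, Set.mem_ofPred_eq, Set.mem_ofPred_eq, mink, Vec.form_neg, neg_eq_zero]

end Orbit

/-! ### The directions of the sides of the regular octagon -/

/-- `√2` times the unit vector in the direction `k * π / 4`. -/
def dir (k : Fin 8) : (ℤ√2) × (ℤ√2) :=
  ![(⟨0, 1⟩, 0), (1, 1), (0, ⟨0, 1⟩), (-1, 1), (⟨0, -1⟩, 0), (-1, -1), (0, ⟨0, -1⟩), (1, -1)] k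

/-- The inner product of a vector of the plane with `dir k`. -/
def dot (k : Fin 8) (x : Vec ℝ) : ℝ := emb (dir k).1 * x.x1 + emb (dir k).2 * x.x2

/-- The inner product of a vector of the plane with `dir k` turned by a right angle. -/
def perp (k : Fin 8) (x : Vec ℝ) : ℝ := -emb (dir k).2 * x.x1 + emb (dir k).1 * x.x2

theorem emb_sqrt : emb ⟨0, 1⟩ = √2 := by simp [emb_apply]

theorem dir_sq (k : Fin 8) : emb (dir k).1 ^ 2 + emb (dir k).2 ^ 2 = 2 := by
  rw [← map_pow, ← map_pow, ← map_add, ← emb_two]; congr 1; revert k; decide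

theorem dir_succ (k : Fin 8) : √2 * emb (dir (k + 1)).1 = emb (dir k).1 - emb (dir k).2 ∧
    √2 * emb (dir (k + 1)).2 = emb (dir k).1 + emb (dir k).2 := by
  rw [← emb_sqrt, ← map_mul, ← map_mul, ← map_sub, ← map_add]
  constructor <;> congr 1 <;> revert k <;> decide

theorem dir_pred (k : Fin 8) : √2 * emb (dir (k - 1)).1 = emb (dir k).1 + emb (dir k).2 ∧
    √2 * emb (dir (k - 1)).2 = emb (dir k).2 - emb (dir k).1 := by
  rw [← emb_sqrt, ← map_mul, ← map_mul, ← map_sub, ← map_add]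
  constructor <;> congr 1 <;> revert k <;> decide

theorem dot_succ (k : Fin 8) (x : Vec ℝ) : √2 * dot (k + 1) x = dot k x + perp k x := by
  obtain ⟨h1, h2⟩ := dir_succ k
  simp only [dot, perp]; linear_combination x.x1 * h1 + x.x2 * h2

theorem dot_pred (k : Fin 8) (x : Vec ℝ) : √2 * dot (k - 1) x = dot k x - perp k x := by
  obtain ⟨h1, h2⟩ := dir_pred k
  simp only [dot, perp]; linear_combination x.x1 * h1 + x.x2 * h2

theorem dot_sq_add_perp_sq (k : Fin 8) (x : Vec ℝ) :
    dot k x ^ 2 + perp k x ^ 2 = 2 * (x.x1 ^ 2 + x.x2 ^ 2) := by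
  simp only [dot, perp]; linear_combination (x.x1 ^ 2 + x.x2 ^ 2) * dir_sq k

/-- Every vector of the plane makes an angle of at most `π / 8` with one of the directions. -/
theorem exists_dir (x : Vec ℝ) :
    ∃ k, |perp k x| ≤ (√2 - 1) * dot k x := by
  -- The direction with the largest inner product is compared with its two neighbours; the constant
  -- is `tan (π / 8) = √2 - 1`.
  obtain ⟨k, hk⟩ := Finite.exists_max fun k => dot k x
  refine ⟨k, abs_le.2 ⟨?_, ?_⟩⟩
  · have h1 := hk (k - 1)
    have h2 := dot_pred k x
    nlinarith [sqrt_two_bounds.1]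
  · have h1 := hk (k + 1)
    have h2 := dot_succ k x
    nlinarith [sqrt_two_bounds.1]

/-- The quaternion of the side pairing translation in the direction `k * π / 4`. -/
def sidePairing (k : Fin 8) : Quat (ℤ√2) := ⟨zunit, 0, (dir k).1, (dir k).2⟩

theorem sidePairing_admissible (k : Fin 8) : Admissible (sidePairing k) := by
  refine ⟨by simp [sidePairing, zunit], by simp [sidePairing], ?_, ?_⟩ <;>
    revert k <;> decide

/-! ### The classification of the systoles -/

theorem IsSystoleVec.neg {n : Vec (ℤ√2)} (hn : IsSystoleVec n) : IsSystoleVec (-n) := by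
  obtain ⟨h1, h2, h3⟩ := hn
  refine ⟨?_, by simpa using h2, ?_⟩
  · rw [Vec.form_neg, Vec.form_comm, Vec.form_neg, neg_neg, h1]
  · rw [Int.even_add] at h3 ⊢; simpa using h3

theorem IsSystoleVec.act {n : Vec (ℤ√2)} (hn : IsSystoleVec n) {q : Quat (ℤ√2)}
    (hq : Admissible q) : IsSystoleVec (q.act zunit n) := by
  obtain ⟨h1, h2, h3⟩ := hn
  refine ⟨?_, ?_, ?_⟩
  · rw [Quat.form_act, hq.norm_eq, h1, one_pow, one_mul]
  · simp [Quat.act, zunit, Int.even_add, h2, show Even (4 : ℤ) by decide]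
  · have h4 := sameClass_act hq h3
    rw [Int.even_iff] at h3 ⊢
    unfold SameClass at h4
    omega

theorem IsSystoleVec.abs_emb'_x0_le {n : Vec (ℤ√2)} (hn : IsSystoleVec n) :
    |emb' n.x0| ≤ 1 := by
  have h1 := congrArg emb' hn.form_self
  obtain ⟨hs, hs'⟩ := sqrt_two_bounds
  have h2 : emb' 2 = 2 := map_ofNat emb' 2
  rw [← Vec.map_form, map_neg, map_mul, emb'_zunit, h2] at h1
  simp only [Vec.form, Vec.map] at h1
  have h3 : (0 : ℝ) ≤ √2 - 1 := by linarith
  apply abs_le_of_sq_le_sq _ zero_le_one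
  nlinarith [mul_nonneg h3 (sq_nonneg (emb' n.x1)), mul_nonneg h3 (sq_nonneg (emb' n.x2))]

section Orbit

variable {X : Type} [PseudoEMetricSpace X] {π : ℍ → X}

theorem IsOrbitMap.image_axisOf_act (hπ : IsOrbitMap π) {q : Quat (ℤ√2)} (hq : Admissible q)
    (n : Vec (ℤ√2)) : π '' axisOf ((q.act zunit n).map emb) = π '' axisOf (n.map emb) := by
  have := hπ.image_smul_axisOf (toSL_mem hq) (n.map emb)
  rwa [quat_toSL, ← emb_zunit, Quat.act_map] at this

/-- An axis far from the base point can be moved closer by a side pairing. -/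
theorem IsSystoleVec.exists_closer_of_pos {n : Vec (ℤ√2)} (hn : IsSystoleVec n)
    (h : 2 * unit < emb n.x0) :
    ∃ k, |emb ((sidePairing k).conj.act zunit n).x0| < emb n.x0 := by
  obtain ⟨k, hk⟩ := exists_dir (n.map emb)
  refine ⟨k, ?_⟩
  have hm := hn.mink_self
  have hsq := dot_sq_add_perp_sq k (n.map emb)
  -- By `u² = 2u + 1`, the new coordinate lies strictly between `-y` and `y` exactly when `M < y`
  -- and `2 * y < u * M`. The threshold `2u` for `y` corresponds to an axis tangent to the inscribed
  -- circle of the octagon.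
  have hx : emb ((sidePairing k).conj.act zunit n).x0 =
      (unit ^ 2 + 2 * unit) * emb n.x0 - 2 * unit ^ 2 * dot k (n.map emb) := by
    simp only [sidePairing, Quat.conj, Quat.act, dot, Vec.map, map_add, map_mul, map_sub, map_neg,
      map_pow, map_zero, emb_zunit, emb_two]
    linear_combination unit * emb n.x0 * dir_sq k
  rw [hx]
  have hu := unit_pos
  have hu2 := unit_sq
  obtain ⟨hs, hs'⟩ := sqrt_two_bounds
  have hss := sqrt_two_sq
  set M := dot k (n.map emb)
  set t := perp k (n.map emb)
  simp only [mink, Vec.form, Vec.map] at hm hsq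
  set y := emb n.x0
  set r := emb n.x1 ^ 2 + emb n.x2 ^ 2
  have hr : unit * r = y ^ 2 + 2 * unit := by simp only [r]; linear_combination -hm
  have hM0 : 0 ≤ M := by
    have := (abs_nonneg t).trans hk
    by_contra hn; nlinarith
  have ht : t ^ 2 ≤ ((√2 - 1) * M) ^ 2 := by
    rw [← sq_abs t]; exact pow_le_pow_left₀ (abs_nonneg t) hk 2
  have hy0 : 0 < y := by linarith
  -- The bound `M² ≤ 2r` and the norm equation reduce this to `y > 2u`.
  have hM1 : M < y := by
    apply lt_of_pow_lt_pow_left₀ 2 hy0.le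
    have h1 : M ^ 2 ≤ 2 * r := by nlinarith [sq_nonneg t]
    have h2 : unit ^ 2 * (y ^ 2 - 2 * r) = y ^ 2 - (2 * unit) ^ 2 := by
      linear_combination (-2 * unit) * hr + y ^ 2 * hu2
    have h3 : (2 * unit) ^ 2 < y ^ 2 := pow_lt_pow_left₀ h (by positivity) two_ne_zero
    have h4 : 0 < y ^ 2 - 2 * r := by
      by_contra hn; nlinarith [sq_nonneg unit]
    linarith
  -- Here the angle bound enters: it keeps `M` from being much smaller than `√(2r)`.
  have hM2 : 2 * y < unit * M := by
    apply lt_of_pow_lt_pow_left₀ 2 (by positivity)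
    have h1 : 2 * r ≤ (4 - 2 * √2) * M ^ 2 := by
      have e : ((√2 - 1) * M) ^ 2 = (3 - 2 * √2) * M ^ 2 := by linear_combination M ^ 2 * hss
      rw [e] at ht; linarith
    have h2 : unit * (2 + √2) * r ≤ 2 * unit * M ^ 2 := by
      have e : (2 + √2) * ((4 - 2 * √2) * M ^ 2) = 4 * M ^ 2 := by
        linear_combination (-2 * M ^ 2) * hss
      have : (2 + √2) * (2 * r) ≤ 4 * M ^ 2 := by
        rw [← e]; exact mul_le_mul_of_nonneg_left h1 (by positivity)
      nlinarith
    have h3 : unit * (2 + √2) * r = (2 + √2) * (y ^ 2 + 2 * unit) := by rw [← hr]; ring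
    have h4 : (unit * M) ^ 2 = unit / 2 * (2 * unit * M ^ 2) := by ring
    have h5 : (2 * y) ^ 2 < unit / 2 * ((2 + √2) * (y ^ 2 + 2 * unit)) := by
      have e1 : unit / 2 * (2 + √2) = (4 + 3 * √2) / 2 := by
        unfold unit; linear_combination hss / 2
      have : unit / 2 * ((2 + √2) * (y ^ 2 + 2 * unit)) = (4 + 3 * √2) / 2 * (y ^ 2 + 2 * unit) := by
        rw [← e1]; ring
      rw [this]
      nlinarith [sq_nonneg y]
    rw [h4]
    refine h5.trans_le ?_
    rw [← h3]
    exact mul_le_mul_of_nonneg_left h2 (by positivity)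
  rw [abs_lt, hu2]
  have h6 : unit * (unit * M) = (2 * unit + 1) * M := by rw [← hu2]; ring
  constructor <;> nlinarith

theorem IsSystoleVec.exists_closer {n : Vec (ℤ√2)} (hn : IsSystoleVec n)
    (h : 2 * unit < |emb n.x0|) :
    ∃ k, |emb ((sidePairing k).conj.act zunit n).x0| < |emb n.x0| := by
  rcases le_or_gt 0 (emb n.x0) with h0 | h0
  · rw [abs_of_nonneg h0] at *
    exact hn.exists_closer_of_pos h
  · rw [abs_of_neg h0] at *
    obtain ⟨k, hk⟩ := hn.neg.exists_closer_of_pos (by simpa using h)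
    refine ⟨k, ?_⟩
    rw [Quat.act_neg, Vec.neg_x0, map_neg, abs_neg, Vec.neg_x0, map_neg] at hk
    exact hk

/-- The descent stops because the coordinates `x0` that occur have bounded conjugates in both
embeddings and hence form a finite set. -/
theorem IsOrbitMap.exists_reduced (hπ : IsOrbitMap π) {n : Vec (ℤ√2)} (hn : IsSystoleVec n) :
    ∃ m, IsSystoleVec m ∧ π '' axisOf (m.map emb) = π '' axisOf (n.map emb) ∧
      |emb m.x0| ≤ 2 * unit := by
  set T : Set (ℤ√2) := {x | ∃ m, IsSystoleVec m ∧
    π '' axisOf (m.map emb) = π '' axisOf (n.map emb) ∧ |emb x| ≤ |emb n.x0| ∧ m.x0 = x} with hT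
  have hfin : T.Finite := by
    refine (finite_bounded |emb n.x0| 1).subset ?_
    rintro _ ⟨m, hm, -, h, rfl⟩
    exact ⟨h, hm.abs_emb'_x0_le⟩
  obtain ⟨x, ⟨m, hm, hmn, h, rfl⟩, hmin⟩ := Set.exists_min_image T (fun x => |emb x|) hfin
    ⟨n.x0, n, hn, rfl, le_rfl, rfl⟩
  refine ⟨m, hm, hmn, ?_⟩
  by_contra hlt
  obtain ⟨k, hk⟩ := hm.exists_closer (not_le.1 hlt)
  have hq := (sidePairing_admissible k).conj
  exact absurd (hmin _ ⟨_, hm.act hq, (hπ.image_axisOf_act hq m).trans hmn, (hk.le.trans h), rfl⟩)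
    (not_le.2 hk)

/-- Normal vectors of the twelve systoles. -/
def systoleVec (i : Fin 12) : Vec (ℤ√2) :=
  ![⟨0, ⟨0, 1⟩, 0⟩, ⟨0, 1, 1⟩, ⟨0, 0, ⟨0, 1⟩⟩, ⟨0, -1, 1⟩,
    ⟨⟨2, 1⟩, ⟨1, 1⟩, 1⟩, ⟨⟨2, 1⟩, 1, ⟨1, 1⟩⟩, ⟨⟨2, 1⟩, -1, ⟨1, 1⟩⟩, ⟨⟨2, 1⟩, ⟨-1, -1⟩, 1⟩,
    ⟨⟨2, 2⟩, ⟨2, 1⟩, 0⟩, ⟨⟨2, 2⟩, ⟨1, 1⟩, ⟨1, 1⟩⟩, ⟨⟨2, 2⟩, 0, ⟨2, 1⟩⟩,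
    ⟨⟨2, 2⟩, ⟨-1, -1⟩, ⟨1, 1⟩⟩] i

theorem systoleVec_isSystoleVec (i : Fin 12) : IsSystoleVec (systoleVec i) := by
  refine ⟨?_, ?_, ?_⟩ <;> revert i <;> decide

/-- The elements of the Bolza group used to identify the reduced systoles. -/
def reducer (k : Fin 9) : Quat (ℤ√2) :=
  Fin.cases ⟨1, 0, 0, 0⟩ sidePairing k

theorem reducer_admissible (k : Fin 9) : Admissible (reducer k) := by
  refine Fin.cases ?_ (fun k => ?_) k
  · exact ⟨by simp [reducer], by simp [reducer], by simp [reducer], by decide⟩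
  · exact sidePairing_admissible k

/-- A finite computation over the coordinates of reduced vectors. The parity of `p + q` need not be
assumed, since it follows from the norm equation and the parity of `x`. -/
theorem reduced_classification :
    ∀ x ∈ Finset.Icc (-2 : ℤ) 2, ∀ x' ∈ Finset.Icc (-2 : ℤ) 2,
    ∀ p ∈ Finset.Icc (-2 : ℤ) 2, ∀ q ∈ Finset.Icc (-2 : ℤ) 2,
    ∀ b ∈ Finset.Icc (-1 : ℤ) 1, ∀ e ∈ Finset.Icc (-1 : ℤ) 1,
    Vec.form zunit ⟨⟨x, x'⟩, ⟨p, b⟩, ⟨q, e⟩⟩ ⟨⟨x, x'⟩, ⟨p, b⟩, ⟨q, e⟩⟩ = -(2 * zunit) →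
    x % 2 = 0 → ∃ i : Fin 12, ∃ k : Fin 9,
      (reducer k).act zunit ⟨⟨x, x'⟩, ⟨p, b⟩, ⟨q, e⟩⟩ = systoleVec i ∨
      (reducer k).act zunit ⟨⟨x, x'⟩, ⟨p, b⟩, ⟨q, e⟩⟩ = -systoleVec i := by
  decide +kernel

theorem IsOrbitMap.exists_systoleVec_eq (hπ : IsOrbitMap π) {n : Vec (ℤ√2)}
    (hn : IsSystoleVec n) :
    ∃ i, π '' axisOf (n.map emb) = π '' axisOf ((systoleVec i).map emb) := by
  obtain ⟨m, hm, hmn, hle⟩ := hπ.exists_reduced hn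
  rw [← hmn]
  have hle' := hm.abs_emb'_x0_le
  have hform := hm.form_self
  have h0 := hm.even_x0
  obtain ⟨⟨x, x'⟩, ⟨p, b⟩, ⟨q, e⟩⟩ := m
  obtain ⟨hs, hs'⟩ := sqrt_two_bounds
  rw [emb_apply, abs_le, unit] at hle
  rw [emb'_apply, abs_le] at hle'
  simp only at hle hle' h0
  have a1 : x ≤ 2 := by
    have : (x : ℝ) < 3 := by linarith
    have : x < 3 := by exact_mod_cast this
    omega
  have a2 : -2 ≤ x := by
    have : (-3 : ℝ) < x := by linarith
    have : -3 < x := by exact_mod_cast this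
    omega
  have a3 : x' ≤ 2 := by
    have : (x' : ℝ) < 3 := by nlinarith
    have : x' < 3 := by exact_mod_cast this
    omega
  have a4 : -2 ≤ x' := by
    have : (-3 : ℝ) < x' := by nlinarith
    have : -3 < x' := by exact_mod_cast this
    omega
  have hre := congrArg Zsqrtd.re hform
  have him := congrArg Zsqrtd.im hform
  simp [Vec.form, zunit] at hre him
  -- Twice the irrational part of the norm equation minus its rational part eliminates the mixed
  -- term `p * b + q * e`.
  have hS : p * p + q * q + 2 * (b * b + e * e) ≤ 7 := by
    have h1 : p * p + q * q + 2 * (b * b + e * e) = 4 * (x * x') + 2 - x * x - 2 * (x' * x') := by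
      linarith
    rw [h1]
    nlinarith [sq_nonneg (x - 2 * x'), sq_nonneg (x - x'), sq_nonneg (x + x')]
  have b1 : -2 ≤ p ∧ p ≤ 2 := by constructor <;> nlinarith [sq_nonneg q, sq_nonneg b, sq_nonneg e]
  have b2 : -2 ≤ q ∧ q ≤ 2 := by constructor <;> nlinarith [sq_nonneg p, sq_nonneg b, sq_nonneg e]
  have b3 : -1 ≤ b ∧ b ≤ 1 := by constructor <;> nlinarith [sq_nonneg p, sq_nonneg q, sq_nonneg e]
  have b4 : -1 ≤ e ∧ e ≤ 1 := by constructor <;> nlinarith [sq_nonneg p, sq_nonneg b, sq_nonneg q]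
  obtain ⟨i, k, h⟩ := reduced_classification x (Finset.mem_Icc.2 ⟨a2, a1⟩)
    x' (Finset.mem_Icc.2 ⟨a4, a3⟩) p (Finset.mem_Icc.2 b1) q (Finset.mem_Icc.2 b2)
    b (Finset.mem_Icc.2 b3) e (Finset.mem_Icc.2 b4) hform (Int.even_iff.1 h0)
  refine ⟨i, ?_⟩
  rw [← hπ.image_axisOf_act (reducer_admissible k)]
  rcases h with h | h
  · rw [h]
  · rw [h, Vec.map_neg, axisOf_neg]

instance : Countable (Quat (ℤ√2)) := by
  have h : Function.Injective fun q : Quat (ℤ√2) =>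
      ((q.a.re, q.a.im), (q.b.re, q.b.im), (q.c.re, q.c.im), (q.d.re, q.d.im)) := by
    intro q r h
    simp only [Prod.mk.injEq] at h
    obtain ⟨⟨h1, h2⟩, ⟨h3, h4⟩, ⟨h5, h6⟩, h7, h8⟩ := h
    exact Quat.ext (Zsqrtd.ext h1 h2) (Zsqrtd.ext h3 h4) (Zsqrtd.ext h5 h6) (Zsqrtd.ext h7 h8)
  exact h.countable

/-- The form is negative definite on the complement of a timelike vector, which therefore contains
no nonzero isotropic vector. -/
theorem eq_zero_of_orthogonal {A E : Vec ℝ} (hA : mink A A = 1) (hAE : mink A E = 0)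
    (hE : mink E E = 0) : E.x0 = 0 ∧ E.x1 = 0 ∧ E.x2 = 0 := by
  have hu := unit_pos
  simp only [mink, Vec.form] at *
  have e1 : unit * (A.x1 * A.x1 + A.x2 * A.x2) = A.x0 ^ 2 - 1 := by linear_combination -hA
  have e2 : unit * (E.x1 * E.x1 + E.x2 * E.x2) = E.x0 ^ 2 := by linear_combination -hE
  have e3 : unit * (A.x1 * E.x1 + A.x2 * E.x2) = A.x0 * E.x0 := by linear_combination -hAE
  have e4 : unit ^ 2 * (A.x1 * E.x2 - A.x2 * E.x1) ^ 2 = -E.x0 ^ 2 := by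
    have : unit ^ 2 * (A.x1 * E.x2 - A.x2 * E.x1) ^ 2 =
      (unit * (A.x1 * A.x1 + A.x2 * A.x2)) * (unit * (E.x1 * E.x1 + E.x2 * E.x2))
        - (unit * (A.x1 * E.x1 + A.x2 * E.x2)) ^ 2 := by ring
    rw [this, e1, e2, e3]; ring
  have h0 : E.x0 ^ 2 = 0 := by
    have : 0 ≤ unit ^ 2 * (A.x1 * E.x2 - A.x2 * E.x1) ^ 2 := by positivity
    nlinarith [sq_nonneg E.x0]
  rw [h0] at e2
  have h1 := (mul_eq_zero.1 e2).resolve_left hu.ne'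
  exact ⟨pow_eq_zero_iff two_ne_zero |>.1 h0, by nlinarith [sq_nonneg E.x1, sq_nonneg E.x2],
    by nlinarith [sq_nonneg E.x1, sq_nonneg E.x2]⟩

/-- A line lies in the polars of at most one pair of opposite vectors of given norm. -/
theorem eq_or_eq_neg_of_mem_axisOf {c : ℝ → ℍ} (hc : IsLine c) {s t : ℝ} (hst : s ≠ t)
    {n m : Vec ℝ} (hn : mink n n = -(2 * unit)) (hm : mink m m = -(2 * unit))
    (hns : c s ∈ axisOf n) (hnt : c t ∈ axisOf n) (hms : c s ∈ axisOf m) (hmt : c t ∈ axisOf m) :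
    n = m ∨ n = -m := by
  obtain ⟨A, B, h1, h2, h3, hv⟩ := hc
  have hd : Real.sinh (t - s) ≠ 0 := by
    rw [Real.sinh_ne_zero]; exact sub_ne_zero.2 hst.symm
  rw [Real.sinh_sub] at hd
  have key : ∀ x : Vec ℝ, c s ∈ axisOf x → c t ∈ axisOf x → mink A x = 0 ∧ mink B x = 0 := by
    intro x hs ht
    rw [axisOf, Set.mem_ofPred_eq, hv, mink, Vec.form_comb] at hs ht
    constructor <;> apply mul_left_cancel₀ hd
    · simp only [mink]; linear_combination Real.sinh t * hs - Real.sinh s * ht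
    · simp only [mink]; linear_combination Real.cosh s * ht - Real.cosh t * hs
  obtain ⟨hAn, hBn⟩ := key n hns hnt
  obtain ⟨hAm, hBm⟩ := key m hms hmt
  have g1 := Vec.gram unit A B n A B n
  have g2 := Vec.gram unit A B n A B m
  have g3 := Vec.gram unit A B m A B m
  rw [Vec.form_comm unit B A, Vec.form_comm unit n A, Vec.form_comm unit n B] at g1 g2
  rw [Vec.form_comm unit B A, Vec.form_comm unit m A, Vec.form_comm unit m B] at g3
  simp only [mink] at *
  rw [h1, h2, h3, hAn, hBn, hn] at g1
  rw [h1, h2, h3, hAn, hBn] at g2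
  rw [h1, h2, h3, hAm, hBm, hm] at g3
  set x := Vec.form unit n m
  -- Both vectors are orthogonal to the plane of `A` and `B`, so the Gram identities give `x² =
  -- (2u)²`.
  have hx : (x - 2 * unit) * (x + 2 * unit) = 0 := by
    linear_combination (x - unit ^ 2 * (Vec.det A B n * Vec.det A B m)) * g2
      + (unit ^ 2 * (Vec.det A B m * Vec.det A B m)) * g1 + 2 * unit * g3
  -- For the right sign `r`, the vector `n + r m` is isotropic and orthogonal to `A`, hence zero.
  have hzero : ∀ r : ℝ, r ^ 2 = 1 → x * r = 2 * unit → n = Vec.comb (-r) m 0 m := by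
    intro r hr hxr
    obtain ⟨e0, e1, e2⟩ := eq_zero_of_orthogonal (A := A) (E := Vec.comb 1 n r m) h1
      (by rw [mink, Vec.form_comm, Vec.form_comb, Vec.form_comm unit n, Vec.form_comm unit m,
            hAn, hAm]; ring)
      (by
        have : mink (Vec.comb 1 n r m) (Vec.comb 1 n r m) =
            Vec.form unit n n + 2 * (x * r) + r ^ 2 * Vec.form unit m m := by
          simp only [mink, x, Vec.form, Vec.comb]; ring
        rw [this, hn, hm, hr, hxr]; ring)
    simp only [Vec.comb] at e0 e1 e2
    ext <;> simp only [Vec.comb] <;> linarith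
  rcases mul_eq_zero.1 hx with h | h
  · right
    rw [hzero 1 (by norm_num) (by linarith)]
    ext <;> simp [Vec.comb]
  · left
    rw [hzero (-1) (by norm_num) (by linarith)]
    ext <;> simp [Vec.comb]

theorem systoleVec_class : ∀ i j, SameClass (systoleVec i) (systoleVec j) ∨
    SameClass (systoleVec i) (-systoleVec j) → i = j := by
  decide

/-- If two of the curves agree, every point of one lifted line lies on a translate of each of the
two axes. There are uncountably many points and countably many pairs of translates, so two points
share a pair. The translated vectors are then equal up to sign, and `systoleVec_class` applies. -/
theorem IsOrbitMap.systoleVec_injective (hπ : IsOrbitMap π) :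
    Function.Injective fun i => π '' axisOf ((systoleVec i).map emb) := by
  intro i j hij
  have hi := systoleVec_isSystoleVec i
  have hj := systoleVec_isSystoleVec j
  obtain ⟨z, hz⟩ := exists_mem_axisOf hi.mink_self
  obtain ⟨γ, hγ, hr⟩ := hπ.exists_closedGeodesic hi
  obtain ⟨c, hc, hcγ⟩ := hπ.lift hγ
  have key : ∀ s, ∃ q q' : Quat (ℤ√2), Admissible q ∧ Admissible q' ∧
      c s ∈ axisOf ((q.act zunit (systoleVec i)).map emb) ∧
      c s ∈ axisOf ((q'.act zunit (systoleVec j)).map emb) := by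
    have aux : ∀ s n, π (c s) ∈ π '' axisOf (n.map emb) →
        ∃ q, Admissible q ∧ c s ∈ axisOf ((q.act zunit n).map emb) := by
      rintro s n ⟨w, hw, hwc⟩
      obtain ⟨g, ⟨q, hq, hgq⟩, hgw⟩ := (hπ.eq_iff _ _).1 hwc
      refine ⟨q, hq, ?_⟩
      rw [← Quat.act_map, emb_zunit, ← hgq, ← hgw]
      exact smul_mem_axisOf.2 hw
    intro s
    have h1 : π (c s) ∈ π '' axisOf ((systoleVec i).map emb) := by
      rw [← hr, ← hcγ]; exact Set.mem_range_self s
    obtain ⟨q, hq, h2⟩ := aux s _ h1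
    rw [show π '' axisOf ((systoleVec i).map emb) = _ from hij] at h1
    obtain ⟨q', hq', h3⟩ := aux s _ h1
    exact ⟨q, q', hq, hq', h2, h3⟩
  choose f f' hf hf' h1 h2 using key
  have hni : ¬Function.Injective fun s => (f s, f' s) := by
    intro hinj
    exact not_countable (α := ℝ) hinj.countable
  simp only [Function.Injective, not_forall] at hni
  obtain ⟨s, t, hst, hne⟩ := hni
  rw [Prod.mk.injEq] at hst
  have h3 := h1 t
  have h4 := h2 t
  rw [← hst.1] at h3
  rw [← hst.2] at h4
  have hn := hi.act (hf s)
  have hm := hj.act (hf' s)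
  have hci := sameClass_act (hf s) hi.even_add
  have hcj := sameClass_act (hf' s) hj.even_add
  apply systoleVec_class
  rcases eq_or_eq_neg_of_mem_axisOf hc hne hn.mink_self hm.mink_self (h1 s) h3 (h2 s) h4 with h | h
  · left
    rw [Vec.map_injective emb_injective h] at hci
    exact hci.symm.trans hcj
  · right
    rw [← Vec.map_neg] at h
    rw [Vec.map_injective emb_injective h, ← Quat.act_neg] at hci
    exact hci.symm.trans (sameClass_act (hf' s) hj.neg.even_add)

/-- The Bolza surface has exactly twelve systoles. -/
theorem IsOrbitMap.ncard_systoles (hπ : IsOrbitMap π) : (systoles X).ncard = 12 := by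
  have : systoles X = Set.range fun i => π '' axisOf ((systoleVec i).map emb) := by
    rw [hπ.systoles_eq]
    ext S
    constructor
    · rintro ⟨n, hn, rfl⟩
      obtain ⟨i, hi⟩ := hπ.exists_systoleVec_eq hn
      exact ⟨i, hi.symm⟩
    · rintro ⟨i, rfl⟩
      exact ⟨_, systoleVec_isSystoleVec i, rfl⟩
  rw [this, ← Set.image_univ, Set.ncard_image_of_injective _ hπ.systoleVec_injective,
    Set.ncard_univ, Nat.card_fin]

end Orbit

/-! ### Tessellations -/

/-- The maps `φ i` place the pieces of `G` in the hyperbolic plane in such a way that their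
translates by the Bolza group tile the plane, and points are glued when they are equivalent. -/
structure IsTessellation {ι : Type} (G : Gluing ι) (φ : ι → ℍ → ℍ) : Prop where
  isometry : ∀ i x y, dist (φ i x) (φ i y) = dist x y
  orbit_of_rel : ∀ i j x y, x ∈ G.piece i → y ∈ G.piece j → G.rel (i, x) (j, y) →
    ∃ g ∈ bolzaGroup, g • φ i x = φ j y
  eq_of_orbit : ∀ i j (x : G.piece i) (y : G.piece j), ∀ g ∈ bolzaGroup, g • φ i x = φ j y →
    G.pt i x = G.pt j y
  -- Having `z` and `w` in one common tile is what keeps the projection from increasing distances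
  -- near `z`.
  local_cover : ∀ z, ∃ ε > 0, ∀ w, dist z w < ε →
    ∃ i, ∃ g ∈ bolzaGroup, ∃ x y : G.piece i, g • φ i x = z ∧ g • φ i y = w

theorem Gluing.edist_pt_le {ι : Type} (G : Gluing ι) (i : ι) (x y : G.piece i) :
    edist (G.pt i x) (G.pt i y) ≤ edist x y :=
  (iInf₂_le _ (Gluing.Chain.snoc i x y Gluing.Chain.nil)).trans (by rw [zero_add])

/-- Two points of the hyperbolic plane are joined by a geodesic line. -/
theorem exists_line_through {z w : ℍ} (h : z ≠ w) :
    ∃ c, IsLine c ∧ c 0 = z ∧ c (dist z w) = w := by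
  set d := dist z w with hd
  have hd0 : 0 < d := dist_pos.2 h
  have hs : Real.sinh d ≠ 0 := (Real.sinh_pos_iff.2 hd0).ne'
  set A := vec z
  set C := vec w
  have hAA : mink A A = 1 := mink_self z
  have hCC : mink C C = 1 := mink_self w
  have hAC : mink A C = Real.cosh d := (cosh_dist_eq z w).symm
  set B : Vec ℝ := Vec.comb (1 / Real.sinh d) C (-(Real.cosh d / Real.sinh d)) A with hB
  have hBx : ∀ x, mink B x = (mink C x - Real.cosh d * mink A x) / Real.sinh d := by
    intro x
    rw [mink, hB, Vec.form_comb]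
    ring
  have hBA : mink B A = 0 := by
    rw [hBx, hAA, mink, Vec.form_comm]
    change (mink A C - _) / _ = 0
    rw [hAC]; simp
  have hAB : mink A B = 0 := by rw [mink, Vec.form_comm]; exact hBA
  have hBB : mink B B = -1 := by
    rw [hBx, hAB, mink, Vec.form_comm]
    change (mink B C - _) / _ = _
    rw [hBx, hCC, hAC]
    field_simp
    linear_combination -(Real.cosh_sq d)
  obtain ⟨c, hc, hc0, hcv⟩ := exists_line z B hBB hAB
  refine ⟨c, hc, hc0, vec_injective ?_⟩
  rw [hcv]
  ext <;> simp only [hB, Vec.comb, A, C] <;> field_simp <;> ring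

/-- A curve whose speed is at most one, in the sense that every parameter has a neighbourhood on
which the distance to its image is bounded by the difference of the parameters. -/
theorem edist_le_of_local {X : Type} [PseudoEMetricSpace X] (f : ℝ → X)
    (h : ∀ s, ∃ ε > 0, ∀ t, |s - t| < ε → edist (f s) (f t) ≤ ENNReal.ofReal |s - t|) {d : ℝ}
    (hd : 0 ≤ d) : edist (f 0) (f d) ≤ ENNReal.ofReal d := by
  have hcont : Continuous f := by
    rw [continuous_iff_continuousAt]
    intro s
    obtain ⟨ε, hε, hf⟩ := h s
    rw [ContinuousAt, tendsto_iff_edist_tendsto_0]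
    have h1 : Filter.Tendsto (fun t => ENNReal.ofReal |s - t|) (nhds s) (nhds 0) := by
      have : Continuous fun t => ENNReal.ofReal |s - t| :=
        ENNReal.continuous_ofReal.comp (by fun_prop)
      simpa using this.tendsto s
    refine tendsto_of_tendsto_of_tendsto_of_le_of_le' tendsto_const_nhds h1
      (Filter.Eventually.of_forall fun _ => zero_le) ?_
    filter_upwards [Metric.ball_mem_nhds s hε] with t ht
    rw [edist_comm]
    apply hf
    rwa [Metric.mem_ball, dist_comm, Real.dist_eq] at ht
  set S : Set ℝ := {s | edist (f 0) (f s) ≤ ENNReal.ofReal s}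
  have hS : IsClosed S := isClosed_le (continuous_const.edist hcont) ENNReal.continuous_ofReal
  -- Continuous induction: the set of good parameters is closed and can always be extended to the
  -- right.
  have := IsClosed.Icc_subset_of_forall_exists_gt (a := 0) (b := d) (s := S)
    (hS.inter isClosed_Icc) (by simp [S]) (by
      rintro x ⟨hx, hx0, -⟩ y hy
      obtain ⟨ε, hε, hf⟩ := h x
      have hy : x < y := hy
      set t := min (x + ε / 2) y
      have ht : x < t := lt_min (by linarith) hy
      have ht2 : t ≤ x + ε / 2 := min_le_left _ _
      refine ⟨t, ?_, ht, min_le_right _ _⟩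
      have h1 : |x - t| = t - x := by rw [abs_sub_comm, abs_of_pos (by linarith)]
      have h2 := hf t (by rw [h1]; linarith)
      refine (edist_triangle _ (f x) _).trans ((add_le_add hx h2).trans ?_)
      rw [h1, ← ENNReal.ofReal_add hx0 (by linarith)]
      apply ENNReal.ofReal_le_ofReal; linarith)
  exact this ⟨hd, le_rfl⟩

section Tessellation

variable {ι : Type} {G : Gluing ι} {φ : ι → ℍ → ℍ}

/-- A tessellation identifies the glued space with the quotient by the Bolza group. -/
theorem IsTessellation.exists_isOrbitMap (h : IsTessellation G φ) :
    ∃ π : ℍ → G.Space, IsOrbitMap π := by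
  have hex : ∀ z, ∃ i, ∃ g ∈ bolzaGroup, ∃ x : G.piece i, g • φ i x = z := by
    intro z
    obtain ⟨ε, hε, hz⟩ := h.local_cover z
    obtain ⟨i, g, hg, x, -, hx, -⟩ := hz z (by simpa)
    exact ⟨i, g, hg, x, hx⟩
  choose I g₀ hg₀ x₀ hx₀ using hex
  set π : ℍ → G.Space := fun z => G.pt (I z) (x₀ z) with hπ
  have hπ_eq : ∀ i (x : G.piece i), ∀ g ∈ bolzaGroup, π (g • φ i x) = G.pt i x := by
    intro i x g hg
    refine h.eq_of_orbit _ _ _ _ (g⁻¹ * g₀ (g • φ i x)) (mul_mem (inv_mem hg) (hg₀ _)) ?_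
    rw [mul_smul, hx₀, inv_smul_smul]
  have hπ_smul : ∀ z, ∀ g ∈ bolzaGroup, π (g • z) = π z := by
    intro z g hg
    have := hπ_eq (I z) (x₀ z) (g * g₀ z) (mul_mem hg (hg₀ z))
    rwa [mul_smul, hx₀] at this
  -- The map from glued points back to orbits shows that the gluing identifies nothing beyond the
  -- group action.
  let D : G.Space → MulAction.orbitRel.Quotient bolzaGroup ℍ :=
    Quot.lift (fun p => Quotient.mk (MulAction.orbitRel bolzaGroup ℍ) (φ p.1 p.2)) (by
      rintro ⟨i, x⟩ ⟨j, y⟩ hr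
      obtain ⟨g, hg, hgx⟩ := h.orbit_of_rel i j x y x.2 y.2 hr
      refine (Quotient.sound (s := MulAction.orbitRel bolzaGroup ℍ) ?_).symm
      exact ⟨⟨g, hg⟩, hgx⟩)
  have hD : ∀ z, D (π z) = Quotient.mk (MulAction.orbitRel bolzaGroup ℍ) z := by
    intro z
    refine (Quotient.sound (s := MulAction.orbitRel bolzaGroup ℍ) ?_).symm
    exact ⟨⟨g₀ z, hg₀ z⟩, hx₀ z⟩
  have heq : ∀ z w, π z = π w ↔ ∃ g ∈ bolzaGroup, g • z = w := by
    intro z w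
    constructor
    · intro hzw
      have h1 := congrArg D hzw
      rw [hD, hD] at h1
      obtain ⟨⟨g, hg⟩, hgz⟩ := Quotient.exact (s := MulAction.orbitRel bolzaGroup ℍ) h1.symm
      exact ⟨g, hg, hgz⟩
    · rintro ⟨g, hg, rfl⟩
      exact (hπ_smul z g hg).symm
  have hsurj : Function.Surjective π := by
    rintro ⟨i, x⟩
    have h1 := hπ_eq i x 1 (one_mem _)
    rw [one_smul] at h1
    exact ⟨φ i x, h1⟩
  -- Along the geodesic from `z` to `w` the projection is locally within single pieces, where the
  -- quotient distance is at most the hyperbolic one.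
  have hle : ∀ z w, edist (π z) (π w) ≤ edist z w := by
    intro z w
    rcases eq_or_ne z w with rfl | hzw
    · simp
    obtain ⟨c, hc, hc0, hcd⟩ := exists_line_through hzw
    have := edist_le_of_local (fun s => π (c s)) (by
      intro s
      obtain ⟨ε, hε, hs⟩ := h.local_cover (c s)
      refine ⟨ε, hε, fun t ht => ?_⟩
      obtain ⟨i, g, hg, x, y, hx, hy⟩ := hs (c t) (by rwa [hc.dist_eq])
      rw [← hx, ← hy, hπ_eq i x g hg, hπ_eq i y g hg]
      refine (G.edist_pt_le i x y).trans ?_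
      rw [← hc.dist_eq, ← hx, ← hy, dist_smul, h.isometry, Subtype.edist_eq, edist_dist])
      (dist_nonneg (x := z) (y := w))
    simp only [hc0, hcd] at this
    rwa [edist_dist]
  -- A chain lifts move by move, after transporting each piece to the current endpoint by a group
  -- element. Hence no chain is shorter than the distance between the orbits.
  have hchain : ∀ (a b : G.Space) (ℓ : ENNReal), G.Chain a b ℓ → ∀ z, π z = a →
      ∃ w, π w = b ∧ edist z w ≤ ℓ := by
    intro a b ℓ hch z hz
    induction hch with
    | nil => exact ⟨z, hz, by simp⟩
    | snoc i x y _ ih =>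
      obtain ⟨w, hw, hzw⟩ := ih
      have h1 := hπ_eq i x 1 (one_mem _)
      rw [one_smul] at h1
      obtain ⟨g, hg, hgw⟩ := (heq (φ i x) w).1 (h1.trans hw.symm)
      refine ⟨g • φ i y, hπ_eq i y g hg, (edist_triangle _ w _).trans (add_le_add hzw ?_)⟩
      rw [← hgw, edist_smul_left, edist_dist, h.isometry, Subtype.edist_eq, edist_dist]
  have hge : ∀ z w, (⨅ g : bolzaGroup, edist z ((g : SL(2, ℝ)) • w)) ≤ edist (π z) (π w) := by
    intro z w
    change _ ≤ ⨅ (ℓ : ENNReal) (_ : G.Chain (π z) (π w) ℓ), ℓ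
    refine le_iInf₂ fun ℓ hℓ => ?_
    obtain ⟨w', hw', hzw'⟩ := hchain _ _ ℓ hℓ z rfl
    obtain ⟨g, hg, rfl⟩ := (heq w w').1 hw'.symm
    exact (iInf_le (fun g : bolzaGroup => edist z ((g : SL(2, ℝ)) • w)) ⟨g, hg⟩).trans hzw'
  refine ⟨π, hsurj, heq, fun z w => le_antisymm (le_iInf fun g => ?_) (hge z w)⟩
  have := hle z ((g : SL(2, ℝ)) • w)
  rwa [hπ_smul w g g.2] at this

end Tessellation

/-- Two quotients of the hyperbolic plane by the Bolza group are isometric. -/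
theorem IsOrbitMap.nonempty_isometryEquiv {X Y : Type} [PseudoEMetricSpace X]
    [PseudoEMetricSpace Y] {π : ℍ → X} {ρ : ℍ → Y} (hπ : IsOrbitMap π) (hρ : IsOrbitMap ρ) :
    Nonempty (X ≃ᵢ Y) := by
  have h1 := Function.rightInverse_surjInv hπ.surjective
  have h2 := Function.rightInverse_surjInv hρ.surjective
  have h3 : ∀ z w, π z = π w ↔ ρ z = ρ w := fun z w => by rw [hπ.eq_iff, hρ.eq_iff]
  refine ⟨⟨⟨fun x => ρ (Function.surjInv hπ.surjective x),
    fun y => π (Function.surjInv hρ.surjective y), fun x => ?_, fun y => ?_⟩, fun x y => ?_⟩⟩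
  · conv_rhs => rw [← h1 x]
    rw [h3, h2]
  · conv_rhs => rw [← h2 y]
    rw [← h3, h1]
  · conv_rhs => rw [← h1 x, ← h1 y]
    change edist (ρ _) (ρ _) = _
    rw [hπ.edist_eq, hρ.edist_eq]

/-- Near every point, a locally finite set of centres has a common nearest element. -/
theorem exists_common_nearest (C : Set ℍ) (hC : C.Nonempty)
    (hlat : ∀ c ∈ C, ∃ x, IsLattice c x) (z : ℍ) :
    ∃ ε > 0, ∀ w, dist z w < ε → ∃ c ∈ C, (∀ c' ∈ C, dist z c ≤ dist z c') ∧
      ∀ c' ∈ C, dist w c ≤ dist w c' := by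
  have hfin : ∀ (y : ℍ) M, {c ∈ C | dist y c ≤ M}.Finite := fun y M =>
    (finite_lattice_near y M).subset fun c hc => ⟨hlat c hc.1, hc.2⟩
  have hmin : ∀ y, ∃ c ∈ C, ∀ c' ∈ C, dist y c ≤ dist y c' := by
    intro y
    obtain ⟨c₀, hc₀⟩ := hC
    obtain ⟨c, hc, h⟩ := Set.exists_min_image {c ∈ C | dist y c ≤ dist y c₀} (dist y)
      (hfin y _) ⟨c₀, hc₀, le_rfl⟩
    refine ⟨c, hc.1, fun c' hc' => ?_⟩
    by_cases h' : dist y c' ≤ dist y c₀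
    · exact h c' ⟨hc', h'⟩
    · exact hc.2.trans (not_le.1 h').le
  obtain ⟨c₁, hc₁, hmin₁⟩ := hmin z
  -- By local finiteness there is a gap `ε` between the smallest and the next distance from `z`. A
  -- centre nearest to a point within `ε / 2` of `z` cannot lie beyond this gap.
  set T := {c ∈ C | dist z c ≤ dist z c₁ + 1 ∧ dist z c₁ < dist z c}
  have hT : T.Finite := (hfin z (dist z c₁ + 1)).subset fun c hc => ⟨hc.1, hc.2.1⟩
  have hε : ∃ ε > 0, ε ≤ 1 ∧ ∀ c ∈ T, dist z c₁ + ε ≤ dist z c := by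
    by_cases hne : T.Nonempty
    · obtain ⟨c, hc, h⟩ := Set.exists_min_image T (dist z) hT hne
      refine ⟨dist z c - dist z c₁, by linarith [hc.2.2], by linarith [hc.2.1], fun c' hc' => ?_⟩
      linarith [h c' hc']
    · exact ⟨1, one_pos, le_rfl, fun c hc => absurd ⟨c, hc⟩ hne⟩
  obtain ⟨ε, hε0, hε1, hε⟩ := hε
  refine ⟨ε / 2, by positivity, fun w hw => ?_⟩
  obtain ⟨c, hc, hmin_w⟩ := hmin w
  refine ⟨c, hc, ?_, hmin_w⟩
  have h1 : dist z c < dist z c₁ + ε := by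
    have := hmin_w c₁ hc₁
    have h2 := dist_triangle z w c
    have h3 := dist_triangle_left w c₁ z
    linarith
  have h2 : dist z c ≤ dist z c₁ := by
    by_contra hlt
    have := hε c ⟨hc, by linarith, not_le.1 hlt⟩
    linarith
  exact fun c' hc' => h2.trans (hmin₁ c' hc')

/-! ### Polar coordinates in the hyperboloid model -/

theorem quat_rot (θ : ℝ) : quat (rot θ) = ⟨Real.cos (θ / 2), Real.sin (θ / 2), 0, 0⟩ := by
  ext <;> simp [quat, rot]

theorem quat_trans (ℓ : ℝ) :
    quat (trans ℓ) = ⟨Real.cosh (ℓ / 2), 0, Real.sinh (ℓ / 2) / eta, 0⟩ := by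
  have := eta_pos.ne'
  ext <;> simp [quat, trans, Real.cosh_eq, Real.sinh_eq]
  field_simp

theorem vec_rot_smul (θ : ℝ) (z : ℍ) : vec (rot θ • z) =
    ⟨(vec z).x0, Real.cos θ * (vec z).x1 - Real.sin θ * (vec z).x2,
      Real.sin θ * (vec z).x1 + Real.cos θ * (vec z).x2⟩ := by
  have h1 : Real.cos θ = Real.cos (θ / 2) ^ 2 - Real.sin (θ / 2) ^ 2 := by
    rw [← Real.cos_two_mul', mul_div_cancel₀ _ two_ne_zero]
  have h2 : Real.sin θ = 2 * Real.sin (θ / 2) * Real.cos (θ / 2) := by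
    rw [← Real.sin_two_mul, mul_div_cancel₀ _ two_ne_zero]
  rw [vec_smul, quat_rot, h1, h2]
  ext <;> simp only [Quat.act]
  · linear_combination (vec z).x0 * Real.cos_sq_add_sin_sq (θ / 2)
  · ring
  · ring

theorem vec_trans_smul (ℓ : ℝ) (z : ℍ) : vec (trans ℓ • z) =
    ⟨Real.cosh ℓ * (vec z).x0 + eta * Real.sinh ℓ * (vec z).x1,
      Real.cosh ℓ * (vec z).x1 + Real.sinh ℓ / eta * (vec z).x0, (vec z).x2⟩ := by
  have he := eta_pos.ne'
  have h1 : Real.cosh ℓ = Real.cosh (ℓ / 2) ^ 2 + Real.sinh (ℓ / 2) ^ 2 := by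
    rw [← Real.cosh_two_mul, mul_div_cancel₀ _ two_ne_zero]
  have h2 : Real.sinh ℓ = 2 * Real.sinh (ℓ / 2) * Real.cosh (ℓ / 2) := by
    rw [← Real.sinh_two_mul, mul_div_cancel₀ _ two_ne_zero]
  have h3 := Real.cosh_sq (ℓ / 2)
  rw [vec_smul, quat_trans, h1, h2, ← eta_sq]
  generalize Real.cosh (ℓ / 2) = c at *
  generalize Real.sinh (ℓ / 2) = s at *
  ext <;> simp only [Quat.act] <;> field_simp
  · ring
  · ring
  · linear_combination (vec z).x2 * eta * h3

theorem vec_polar (d θ : ℝ) : vec (polar d θ) =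
    ⟨Real.cosh d, Real.sinh d / eta * Real.cos θ, Real.sinh d / eta * Real.sin θ⟩ := by
  rw [polar, mul_smul, vec_rot_smul, vec_trans_smul, vec_I]
  ext <;> simp only [Vec.base] <;> ring

theorem vec_foot (d θ s : ℝ) : vec (foot d θ s) =
    ⟨Real.cosh s * Real.cosh d,
      (Real.cosh s * Real.sinh d * Real.cos θ - Real.sinh s * Real.sin θ) / eta,
      (Real.cosh s * Real.sinh d * Real.sin θ + Real.sinh s * Real.cos θ) / eta⟩ := by
  have he := eta_pos.ne'
  rw [foot, mul_smul, mul_smul, mul_smul, vec_rot_smul, vec_trans_smul, vec_rot_smul,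
    vec_trans_smul, vec_I]
  ext <;> simp only [Vec.base, Real.cos_pi_div_two, Real.sin_pi_div_two] <;> field_simp <;> ring

/-! ### The Bolza surface as a quotient of the hyperbolic plane -/

-- Induction by rotation through `π / 4`; the cast to `Fin 8` supplies the periodicity.
open Fin.NatCast in
theorem sqrt_two_mul_cos_sin (n : ℕ) :
    √2 * Real.cos (n * (Real.pi / 4)) = emb (dir (n : Fin 8)).1 ∧
    √2 * Real.sin (n * (Real.pi / 4)) = emb (dir (n : Fin 8)).2 := by
  induction n with
  | zero => simp [dir, emb_sqrt]
  | succ n ih =>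
    obtain ⟨h1, h2⟩ := dir_succ (n : Fin 8)
    have hs := sqrt_two_sq
    have h0 : √2 ≠ 0 := by positivity
    push_cast
    rw [add_mul, one_mul, Real.cos_add, Real.sin_add, Real.cos_pi_div_four, Real.sin_pi_div_four]
    rw [← ih.1, ← ih.2] at h1 h2
    constructor <;> apply mul_left_cancel₀ h0
    · rw [h1]; linear_combination (√2 * (Real.cos (n * (Real.pi / 4)) -
        Real.sin (n * (Real.pi / 4))) / 2) * hs
    · rw [h2]; linear_combination (√2 * (Real.cos (n * (Real.pi / 4)) +
        Real.sin (n * (Real.pi / 4))) / 2) * hs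

theorem dir_eq (k : Fin 8) : √2 * Real.cos (bolzaDirection k) = emb (dir k).1 ∧
    √2 * Real.sin (bolzaDirection k) = emb (dir k).2 := by
  have := sqrt_two_mul_cos_sin k
  rwa [Fin.cast_val_eq_self] at this

/-- Coordinates adapted to the side `k` make all later computations uniform in `k`. The frame
vectors have squared length `2`, whence the factor `unit / 2`. -/
theorem mink_eq (k : Fin 8) (x y : Vec ℝ) :
    mink x y = x.x0 * y.x0 - unit / 2 * (dot k x * dot k y + perp k x * perp k y) := by
  simp only [mink, Vec.form, dot, perp]
  linear_combination (unit / 2 * (x.x1 * y.x1 + x.x2 * y.x2)) * dir_sq k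

theorem vec_ext_dir (k : Fin 8) {x y : Vec ℝ} (h0 : x.x0 = y.x0) (h1 : dot k x = dot k y)
    (h2 : perp k x = perp k y) : x = y := by
  have h := dir_sq k
  simp only [dot, perp] at h1 h2
  ext
  · exact h0
  · linear_combination (emb (dir k).1 * h1 - emb (dir k).2 * h2 - (x.x1 - y.x1) * h) / 2
  · linear_combination (emb (dir k).2 * h1 + emb (dir k).1 * h2 - (x.x2 - y.x2) * h) / 2

/-- The side pairing translation in the direction `k * π / 4`. -/
def sideElt (k : Fin 8) : SL(2, ℝ) := toSL (sidePairing k) (sidePairing_admissible k).norm_eq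

theorem sideElt_mem (k : Fin 8) : sideElt k ∈ bolzaGroup := toSL_mem (sidePairing_admissible k)

theorem isLattice_sideElt_smul_I (k : Fin 8) :
    IsLattice (sideElt k • I) ⟨zunit ^ 2 + 2 * zunit, 2 * zunit * (dir k).1,
      2 * zunit * (dir k).2⟩ := by
  have e : (sidePairing k).act zunit Vec.base = ⟨zunit ^ 2 + 2 * zunit, 2 * zunit * (dir k).1,
      2 * zunit * (dir k).2⟩ := by
    revert k; decide
  have h := isLattice_I.smul (quat_toSL (sidePairing k) (sidePairing_admissible k).norm_eq)
  rwa [e] at h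

theorem vec_sideElt_smul_I (k : Fin 8) : (vec (sideElt k • I)).x0 = unit ^ 2 + 2 * unit ∧
    dot k (vec (sideElt k • I)) = 4 * unit ∧ perp k (vec (sideElt k • I)) = 0 := by
  have h := dir_sq k
  rw [isLattice_sideElt_smul_I k]
  simp only [Vec.map, dot, perp, map_add, map_mul, map_pow, emb_zunit, emb_two]
  refine ⟨trivial, ?_, ?_⟩
  · linear_combination 2 * unit * h
  · ring

theorem mink_sideElt_smul_I (k : Fin 8) (x : Vec ℝ) :
    mink x (vec (sideElt k • I)) = (unit ^ 2 + 2 * unit) * x.x0 - 2 * unit ^ 2 * dot k x := by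
  obtain ⟨h1, h2, h3⟩ := vec_sideElt_smul_I k
  rw [mink_eq k, h1, h2, h3]; ring

theorem vec_sideElt_inv_smul (k : Fin 8) (z : ℍ) :
    (vec ((sideElt k)⁻¹ • z)).x0 = (unit ^ 2 + 2 * unit) * (vec z).x0
      - 2 * unit ^ 2 * dot k (vec z) ∧
    dot k (vec ((sideElt k)⁻¹ • z)) = (unit ^ 2 + 2 * unit) * dot k (vec z)
      - 4 * unit * (vec z).x0 ∧
    perp k (vec ((sideElt k)⁻¹ • z)) = perp k (vec z) := by
  have h := dir_sq k
  have hu := unit_sq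
  rw [vec_smul, quat_inv, sideElt, quat_toSL]
  simp only [Quat.map, Quat.conj, Quat.act, sidePairing, dot, perp, emb_zunit, map_zero]
  generalize emb (dir k).1 = a at *
  generalize emb (dir k).2 = b at *
  generalize vec z = x at *
  refine ⟨?_, ?_, ?_⟩
  · linear_combination unit * x.x0 * h
  · linear_combination (unit * (a * x.x1 + b * x.x2) - 2 * unit * x.x0) * h
  · linear_combination (-b * x.x1 + a * x.x2) * (hu - unit * h)

theorem cosh_bolzaInradius : Real.cosh bolzaInradius = unit :=
  Real.cosh_arcosh one_lt_unit.le

theorem sinh_bolzaInradius : Real.sinh bolzaInradius = √2 * eta := by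
  have h : (1 : ℝ) ≤ 1 + √2 := one_lt_unit.le
  rw [bolzaInradius, Real.sinh_arcosh h, eta, ← Real.sqrt_mul zero_le_two]
  congr 1
  change unit ^ 2 - 1 = _
  rw [unit_sq]; ring

/-- The sides of the octagon thereby lie on bisectors between the base point and its translates by
the side pairings. -/
theorem polar_bolza (k : Fin 8) :
    polar (2 * bolzaInradius) (bolzaDirection k) = sideElt k • I := by
  apply vec_injective
  have he := eta_pos.ne'
  have hs := sqrt_two_sq
  obtain ⟨h1, h2⟩ := dir_eq k
  obtain ⟨e0, e1, e2⟩ := vec_sideElt_smul_I k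
  have hd := dir_sq k
  rw [vec_polar, Real.cosh_two_mul, Real.sinh_two_mul, cosh_bolzaInradius, sinh_bolzaInradius]
  apply vec_ext_dir k
  · rw [e0, mul_pow, eta_sq]; linear_combination unit * hs
  · rw [e1]; simp only [dot]
    rw [← h1, ← h2] at hd ⊢
    field_simp
    linear_combination 2 * unit * hd
  · rw [e2]; simp only [perp]
    rw [← h1, ← h2]; ring

theorem mem_bolza_piece (i : Unit) (z : ℍ) :
    z ∈ bolza.piece i ↔ ∀ k, unit * dot k (vec z) ≤ 2 * (vec z).x0 := by
  have hu := unit_pos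
  have hu2 := unit_sq
  refine forall_congr' fun k => ?_
  rw [halfPlane, Set.mem_ofPred_eq, polar_bolza, dist_le_dist_iff, mink_sideElt_smul_I, vec_I,
    mink, Vec.form_base]
  have e : (unit ^ 2 + 2 * unit) * (vec z).x0 - 2 * unit ^ 2 * dot k (vec z) - (vec z).x0 =
      2 * (unit * (2 * (vec z).x0) - unit * (unit * dot k (vec z))) := by
    linear_combination (vec z).x0 * hu2
  rw [← sub_nonneg, e, mul_nonneg_iff_of_pos_left two_pos, sub_nonneg, mul_le_mul_iff_right₀ hu]

theorem vec_bolza_foot (k : Fin 8) (s : ℝ) :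
    (vec (foot bolzaInradius (bolzaDirection k) s)).x0 = unit * Real.cosh s ∧
    dot k (vec (foot bolzaInradius (bolzaDirection k) s)) = 2 * Real.cosh s ∧
    perp k (vec (foot bolzaInradius (bolzaDirection k) s)) = √2 * Real.sinh s / eta := by
  have he := eta_pos.ne'
  have hs := sqrt_two_sq
  obtain ⟨h1, h2⟩ := dir_eq k
  have hd := Real.cos_sq_add_sin_sq (bolzaDirection k)
  rw [vec_foot, cosh_bolzaInradius, sinh_bolzaInradius]
  simp only [dot, perp, ← h1, ← h2]
  refine ⟨by ring, ?_, ?_⟩ <;> field_simp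
  · linear_combination Real.cosh s * eta * (√2 * √2 * hd + hs)
  · linear_combination Real.sinh s * hd

theorem vec_bolza_foot_opposite (k : Fin 8) (s : ℝ) :
    (vec (foot bolzaInradius (bolzaDirection k + Real.pi) (-s))).x0 = unit * Real.cosh s ∧
    dot k (vec (foot bolzaInradius (bolzaDirection k + Real.pi) (-s))) = -(2 * Real.cosh s) ∧
    perp k (vec (foot bolzaInradius (bolzaDirection k + Real.pi) (-s))) =
      √2 * Real.sinh s / eta := by
  have he := eta_pos.ne'
  have hs := sqrt_two_sq
  obtain ⟨h1, h2⟩ := dir_eq k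
  have hd := Real.cos_sq_add_sin_sq (bolzaDirection k)
  rw [vec_foot, cosh_bolzaInradius, sinh_bolzaInradius, Real.cos_add_pi, Real.sin_add_pi,
    Real.cosh_neg, Real.sinh_neg]
  simp only [dot, perp, ← h1, ← h2]
  refine ⟨by ring, ?_, ?_⟩ <;> field_simp
  · linear_combination -Real.cosh s * eta * (√2 * √2 * hd + hs)
  · linear_combination Real.sinh s * hd

theorem sideElt_inv_smul_foot (k : Fin 8) (s : ℝ) :
    (sideElt k)⁻¹ • foot bolzaInradius (bolzaDirection k) s =
      foot bolzaInradius (bolzaDirection k + Real.pi) (-s) := by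
  have hu := unit_sq
  apply vec_injective
  obtain ⟨h0, h1, h2⟩ := vec_sideElt_inv_smul k (foot bolzaInradius (bolzaDirection k) s)
  obtain ⟨e0, e1, e2⟩ := vec_bolza_foot k s
  obtain ⟨f0, f1, f2⟩ := vec_bolza_foot_opposite k s
  rw [e0, e1] at h0 h1
  apply vec_ext_dir k
  · rw [h0, f0]; linear_combination unit * Real.cosh s * hu
  · rw [h1, f1]; linear_combination -2 * Real.cosh s * hu
  · rw [h2, e2, f2]

theorem exists_eq_bolza_foot (k : Fin 8) (z : ℍ) (h : unit * dot k (vec z) = 2 * (vec z).x0) :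
    ∃ s, z = foot bolzaInradius (bolzaDirection k) s := by
  have hu := unit_pos
  have hs := sqrt_two_sq
  have hs0 : √2 ≠ 0 := by positivity
  have he := eta_pos.ne'
  refine ⟨Real.arsinh (eta * perp k (vec z) / √2), ?_⟩
  have hm := mink_self z
  rw [mink_eq k] at hm
  have hp := vec_x0_pos z
  have hd : 0 < dot k (vec z) := by
    rw [← mul_pos_iff_of_pos_left hu]; linarith
  have hc : Real.cosh (Real.arsinh (eta * perp k (vec z) / √2)) = dot k (vec z) / 2 := by
    rw [Real.cosh_arsinh, ← Real.sqrt_sq (show 0 ≤ dot k (vec z) / 2 by positivity)]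
    congr 1
    rw [div_pow, mul_pow, eta_sq, Real.sq_sqrt zero_le_two]
    have hx : (vec z).x0 = unit * dot k (vec z) / 2 := by linarith
    rw [hx] at hm
    linear_combination -hm + dot k (vec z) ^ 2 / 4 * unit_sq
  apply vec_injective
  obtain ⟨e0, e1, e2⟩ := vec_bolza_foot k (Real.arsinh (eta * perp k (vec z) / √2))
  apply vec_ext_dir k
  · rw [e0, hc]; linarith
  · rw [e1, hc]; ring
  · rw [e2, Real.sinh_arsinh]; field_simp

/-! ### The Dirichlet domain of the base point -/

/-- The vertices of the regular octagon. -/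
def vertex (k : Fin 8) : Vec (ℤ√2) :=
  ⟨zunit ^ 2, ⟨0, 1⟩ * ((dir k).1 + (dir (k + 1)).1), ⟨0, 1⟩ * ((dir k).2 + (dir (k + 1)).2)⟩

theorem vertex_form_self (k : Fin 8) : (vertex k).form zunit (vertex k) = 1 := by
  revert k; decide

theorem exists_vertex (k : Fin 8) : ∃ z, IsLattice z (vertex k) := by
  apply exists_vec_eq
  · rw [mink, ← emb_zunit, Vec.map_form, vertex_form_self, map_one]
  · have := unit_pos
    simp only [vertex, Vec.map, map_pow, emb_zunit]; positivity

/-- The vertices of the regular octagon are nearest to its centre among the centres. -/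
theorem unit_sq_le_mink_vertex (k : Fin 8) {z : ℍ} (hz : IsLattice z (vertex k)) {g : SL(2, ℝ)}
    (hg : g ∈ bolzaGroup) : unit ^ 2 ≤ mink (vec z) (vec (g • I)) := by
  obtain ⟨q, hq, hgq⟩ := hg
  have hw := isLattice_I.smul hgq
  have h1 := one_le_mink z (g • I)
  have h2 := abs_emb'_form_le _ _ hz.form_self hw.form_self
  rw [hz.mink_eq hw] at *
  -- The product is congruent to `u² = 3 + 2√2` modulo `4`. As it is at least `1` and its conjugate
  -- is at most `1` in absolute value, its irrational part is `2` or at least `6`, and `u²` is the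
  -- least possibility.
  have key : ((vertex k).form zunit (q.act zunit Vec.base)).re % 4 = 3 ∧
      ((vertex k).form zunit (q.act zunit Vec.base)).im % 4 = 2 := by
    -- Using the norm equation in the first coordinate isolates `1` plus an even term.
    have hX : q.act zunit Vec.base = ⟨1 + 2 * zunit * (q.c ^ 2 + q.d ^ 2),
        2 * (q.a * q.c - q.b * q.d), 2 * (q.a * q.d + q.b * q.c)⟩ := by
      have hn := hq.norm_eq
      simp only [Quat.norm] at hn
      ext : 1 <;> simp only [Quat.act, Vec.base]
      · linear_combination hn
      · ring
      · ring
    rw [hX]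
    obtain ⟨h1, h2, h3, -⟩ := hq
    obtain ⟨⟨a0, m⟩, ⟨b0, n⟩, ⟨c0, c1⟩, ⟨d0, d1⟩⟩ := q
    obtain ⟨k', rfl⟩ := Int.not_even_iff_odd.1 h1
    obtain ⟨l, rfl⟩ := even_iff_exists_two_mul.1 h2
    obtain ⟨r, hr⟩ := even_iff_exists_two_mul.1 h3
    obtain rfl : d0 = 2 * r - c0 := by simp only at hr; linarith
    fin_cases k <;>
    · simp [Vec.form, vertex, dir, zunit, pow_two]
      constructor <;> ring_nf <;> omega
  generalize (vertex k).form zunit (q.act zunit Vec.base) = t at *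
  rw [emb_apply] at h1 ⊢
  rw [emb'_apply, abs_le] at h2
  obtain ⟨hs, hs'⟩ := sqrt_two_bounds
  have hpos : 0 ≤ t.im := by
    have : (-1 : ℝ) < t.im := by nlinarith
    have : -1 < t.im := by exact_mod_cast this
    omega
  rw [unit_sq, unit]
  rcases (show t.im = 2 ∨ 6 ≤ t.im by omega) with h | h
  · rw [h] at h1 h2 ⊢
    have : 1 < t.re := by
      have : (1 : ℝ) < t.re := by push_cast at h2; linarith [h2.1]
      exact_mod_cast this
    have : (3 : ℝ) ≤ t.re := by exact_mod_cast (show 3 ≤ t.re by omega)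
    push_cast; linarith
  · have : (6 : ℝ) ≤ t.im := by exact_mod_cast h
    nlinarith

theorem vec_vertex (k : Fin 8) {z : ℍ} (hz : IsLattice z (vertex k)) :
    (vec z).x0 = unit ^ 2 ∧ dot k (vec z) = 2 * unit ∧ perp k (vec z) = 2 := by
  rw [hz]
  refine ⟨by simp [vertex, Vec.map], ?_, ?_⟩
  · have : 2 * unit = emb (2 * zunit) := by simp
    rw [this]
    simp only [dot, Vec.map]
    rw [← map_mul, ← map_mul, ← map_add]
    congr 1; clear hz; revert k; decide
  · rw [← emb_two]
    simp only [perp, Vec.map]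
    rw [← map_neg, ← map_mul, ← map_mul, ← map_add]
    congr 1; clear hz; revert k; decide

theorem vec_vertex_pred (k : Fin 8) {z : ℍ} (hz : IsLattice z (vertex (k - 1))) :
    (vec z).x0 = unit ^ 2 ∧ dot k (vec z) = 2 * unit ∧ perp k (vec z) = -2 := by
  rw [hz]
  refine ⟨by simp [vertex, Vec.map], ?_, ?_⟩
  · have : 2 * unit = emb (2 * zunit) := by simp
    rw [this]
    simp only [dot, Vec.map]
    rw [← map_mul, ← map_mul, ← map_add]
    congr 1; clear hz; revert k; decide
  · rw [← emb_two, ← map_neg]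
    simp only [perp, Vec.map]
    rw [← map_neg, ← map_mul, ← map_mul, ← map_add]
    congr 1; clear hz; revert k; decide

/-- In the sector around the direction `k`, every point of the octagon is a combination of the
centre and of two vertices. -/
theorem mink_sector (k : Fin 8) {p q : ℍ} (hp : IsLattice p (vertex (k - 1)))
    (hq : IsLattice q (vertex k)) (x y : Vec ℝ) : mink x y =
      (x.x0 - unit * dot k x / 2) * y.x0 +
      (dot k x / unit - perp k x) / 4 * mink (vec p) y +
      (dot k x / unit + perp k x) / 4 * mink (vec q) y := by
  have hu := unit_pos.ne'
  obtain ⟨p0, p1, p2⟩ := vec_vertex_pred k hp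
  obtain ⟨q0, q1, q2⟩ := vec_vertex k hq
  rw [mink_eq k, mink_eq k (vec p), mink_eq k (vec q), p0, p1, p2, q0, q1, q2]
  field_simp
  ring

theorem sector_nonneg {k : Fin 8} {x : Vec ℝ} (h : |perp k x| ≤ (√2 - 1) * dot k x) :
    0 ≤ dot k x / unit - perp k x ∧ 0 ≤ dot k x / unit + perp k x := by
  have e : dot k x / unit = (√2 - 1) * dot k x := by
    rw [div_eq_iff unit_pos.ne', unit]; linear_combination -dot k x * sqrt_two_sq
  rw [e]
  constructor <;> linarith [abs_le.1 h]

/-- The octagon is contained in the Dirichlet domain of the Bolza group. -/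
theorem x0_le_mink {z : ℍ} (hz : ∀ k, unit * dot k (vec z) ≤ 2 * (vec z).x0) {g : SL(2, ℝ)}
    (hg : g ∈ bolzaGroup) : (vec z).x0 ≤ mink (vec z) (vec (g • I)) := by
  obtain ⟨k, hk⟩ := exists_dir (vec z)
  obtain ⟨hs, ht⟩ := sector_nonneg hk
  obtain ⟨p, hp⟩ := exists_vertex (k - 1)
  obtain ⟨q, hq⟩ := exists_vertex k
  have h1 := one_le_mink (g • I) I
  rw [vec_I, mink, Vec.form_base] at h1
  have h2 := unit_sq_le_mink_vertex _ hp hg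
  have h3 := unit_sq_le_mink_vertex _ hq hg
  have ha := hz k
  -- Both sides of the inequality are linear in `z`, with nonnegative coefficients on the centre and
  -- two vertices, so it is enough to compare at these three points.
  have e : (vec z).x0 = ((vec z).x0 - unit * dot k (vec z) / 2) * 1 +
      (dot k (vec z) / unit - perp k (vec z)) / 4 * unit ^ 2 +
      (dot k (vec z) / unit + perp k (vec z)) / 4 * unit ^ 2 := by
    have hu := unit_pos.ne'
    field_simp; ring
  rw [mink_sector k hp hq]
  calc _ = _ := e
    _ ≤ _ := by gcongr; linarith

/-- A side line meets a boundary ray of its sector in one point: the norm equation gives `r = ±2`,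
and the upper sheet selects the sign. -/
theorem eq_vertex_of_sector (k : Fin 8) {z : ℍ} {s : ℝ} (hs : s ^ 2 = 1)
    (h : perp k (vec z) = s * (dot k (vec z) / unit))
    (h0 : (vec z).x0 = unit * dot k (vec z) / 2) :
    (vec z).x0 = unit ^ 2 ∧ dot k (vec z) = 2 * unit ∧ perp k (vec z) = s * 2 := by
  have hu := unit_pos
  have hu2 := unit_sq
  have hm := mink_self z
  have hx := vec_x0_pos z
  have hd : dot k (vec z) / unit * unit = dot k (vec z) := div_mul_cancel₀ _ hu.ne'
  rw [mink_eq k] at hm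
  generalize dot k (vec z) / unit = r at *
  rw [h0, h, ← hd] at hm
  rw [h0, ← hd] at hx
  have hr2 : (r - 2) * (r + 2) = 0 := by
    linear_combination 4 * hm - r ^ 2 * ((unit ^ 2 + 1) * hu2 - 2 * unit * hs)
  have hr0 : 0 < r := by
    have : 0 < unit ^ 2 / 2 * r := by linear_combination hx
    exact pos_of_mul_pos_right this (by positivity)
  have hr : r = 2 := by
    rcases mul_eq_zero.1 hr2 with e | e <;> linarith
  rw [h0, ← hd, h, hr]
  exact ⟨by ring, by ring, by ring⟩

/-- The two equations put the centre on the axis of symmetry of the sector. The norm equation there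
has two roots, the base point and its mirror image in the side. -/
theorem side_centre_of_sector (k : Fin 8) {z : ℍ}
    (h1 : unit ^ 2 * (vec z).x0 - unit / 2 * (2 * unit * dot k (vec z) + -2 * perp k (vec z))
      = unit ^ 2)
    (h2 : unit ^ 2 * (vec z).x0 - unit / 2 * (2 * unit * dot k (vec z) + 2 * perp k (vec z))
      = unit ^ 2) :
    perp k (vec z) = 0 ∧ dot k (vec z) = (vec z).x0 - 1 ∧
      ((vec z).x0 = 1 ∨ (vec z).x0 = unit ^ 2 + 2 * unit) := by
  have hu := unit_pos
  have hw := mink_self z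
  rw [mink_eq k] at hw
  generalize vec z = y at *
  have f2 : perp k y = 0 := by
    have : unit * perp k y = 0 := by linarith
    exact (mul_eq_zero.1 this).resolve_left hu.ne'
  have f1 : dot k y = y.x0 - 1 := by
    have : unit ^ 2 * (dot k y - (y.x0 - 1)) = 0 := by rw [f2] at h1; linear_combination -h1
    exact sub_eq_zero.1 ((mul_eq_zero.1 this).resolve_left (by positivity))
  refine ⟨f2, f1, ?_⟩
  rw [f1, f2] at hw
  have e : (y.x0 - 1) * ((y.x0 + 1) - unit / 2 * (y.x0 - 1)) = 0 := by linear_combination hw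
  rcases mul_eq_zero.1 e with h | h
  · exact Or.inl (sub_eq_zero.1 h)
  · right; linear_combination (-2 * unit) * h - y.x0 * unit_sq

/-- The equality cases of the Dirichlet inequality. -/
theorem dirichlet_eq {z : ℍ} (hz : ∀ k, unit * dot k (vec z) ≤ 2 * (vec z).x0) {g : SL(2, ℝ)}
    (hg : g ∈ bolzaGroup) (h : mink (vec z) (vec (g • I)) = (vec z).x0) :
    g • I = I ∨ (∃ k, unit * dot k (vec z) = 2 * (vec z).x0 ∧ g • I = sideElt k • I) ∨
      ∃ k, IsLattice z (vertex k) := by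
  obtain ⟨k, hk⟩ := exists_dir (vec z)
  obtain ⟨hs, ht⟩ := sector_nonneg hk
  obtain ⟨p, hp⟩ := exists_vertex (k - 1)
  obtain ⟨q, hq⟩ := exists_vertex k
  have h1 := one_le_mink (g • I) I
  rw [vec_I, mink, Vec.form_base] at h1
  have h2 := unit_sq_le_mink_vertex _ hp hg
  have h3 := unit_sq_le_mink_vertex _ hq hg
  have ha := hz k
  have hu := unit_pos
  have hu2 := unit_sq
  rw [mink_sector k hp hq] at h
  have e : (vec z).x0 = ((vec z).x0 - unit * dot k (vec z) / 2) * 1 +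
      (dot k (vec z) / unit - perp k (vec z)) / 4 * unit ^ 2 +
      (dot k (vec z) / unit + perp k (vec z)) / 4 * unit ^ 2 := by
    have hu := unit_pos.ne'
    field_simp; ring
  have a1 : 0 ≤ ((vec z).x0 - unit * dot k (vec z) / 2) * ((vec (g • I)).x0 - 1) :=
    mul_nonneg (by linarith) (by linarith)
  have a2 : 0 ≤ (dot k (vec z) / unit - perp k (vec z)) / 4 *
      (mink (vec p) (vec (g • I)) - unit ^ 2) := mul_nonneg (by linarith) (by linarith)
  have a3 : 0 ≤ (dot k (vec z) / unit + perp k (vec z)) / 4 *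
      (mink (vec q) (vec (g • I)) - unit ^ 2) := mul_nonneg (by linarith) (by linarith)
  -- Three nonnegative terms have sum zero, so each of them vanishes.
  have b1 : ((vec z).x0 - unit * dot k (vec z) / 2) * ((vec (g • I)).x0 - 1) = 0 := by linarith
  have b2 : (dot k (vec z) / unit - perp k (vec z)) / 4 *
      (mink (vec p) (vec (g • I)) - unit ^ 2) = 0 := by linarith
  have b3 : (dot k (vec z) / unit + perp k (vec z)) / 4 *
      (mink (vec q) (vec (g • I)) - unit ^ 2) = 0 := by linarith
  obtain ⟨p0, p1, p2⟩ := vec_vertex_pred k hp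
  obtain ⟨q0, q1, q2⟩ := vec_vertex k hq
  rcases mul_eq_zero.1 b1 with c1 | c1
  swap
  · left
    apply eq_of_mink_eq_one
    rw [vec_I, mink, Vec.form_base]; linarith
  have hvert : ∀ s : ℝ, s ^ 2 = 1 → perp k (vec z) = s * (dot k (vec z) / unit) →
      (vec z).x0 = unit ^ 2 ∧ dot k (vec z) = 2 * unit ∧ perp k (vec z) = s * 2 :=
    fun s h2 h3 => eq_vertex_of_sector k h2 h3 (sub_eq_zero.1 c1)
  rcases mul_eq_zero.1 b2 with c2 | c2
  · right; right
    obtain ⟨d0, d1, d2⟩ := hvert 1 (by ring) (by linarith)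
    refine ⟨k, ?_⟩
    rw [IsLattice, ← hq]
    exact vec_ext_dir k (by rw [d0, q0]) (by rw [d1, q1]) (by rw [d2, q2]; ring)
  rcases mul_eq_zero.1 b3 with c3 | c3
  · right; right
    obtain ⟨d0, d1, d2⟩ := hvert (-1) (by ring) (by linarith)
    refine ⟨k - 1, ?_⟩
    rw [IsLattice, ← hp]
    exact vec_ext_dir k (by rw [d0, p0]) (by rw [d1, p1]) (by rw [d2, p2]; ring)
  rw [mink_eq k, p0, p1, p2] at c2
  rw [mink_eq k, q0, q1, q2] at c3
  obtain ⟨f2, f1, h⟩ := side_centre_of_sector k (z := g • I)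
    (by linear_combination c2) (by linear_combination c3)
  rcases h with h | h
  · left
    apply eq_of_mink_eq_one
    rw [vec_I, mink, Vec.form_base]; exact h
  · right; left
    refine ⟨k, by linarith, ?_⟩
    apply vec_injective
    obtain ⟨e0, e1, e2⟩ := vec_sideElt_smul_I k
    apply vec_ext_dir k
    · rw [e0, h]
    · rw [e1, f1, h]; linear_combination hu2
    · rw [e2, f2]

theorem vertex_mem_piece (k : Fin 8) {z : ℍ} (hz : IsLattice z (vertex k)) (j : Fin 8) :
    unit * dot j (vec z) ≤ 2 * (vec z).x0 := by
  have h := unit_sq_le_mink_vertex k hz (sideElt_mem j)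
  have h0 : (vec z).x0 = unit ^ 2 := (vec_vertex k hz).1
  rw [mink_sideElt_smul_I, h0] at h
  have hu := unit_pos
  have hu2 := unit_sq
  rw [h0]
  have : unit ^ 2 * (unit * dot j (vec z)) ≤ unit ^ 2 * (2 * unit ^ 2) := by
    have e : unit ^ 2 * (2 * unit ^ 2) - unit ^ 2 * (unit * dot j (vec z)) =
      unit / 2 * ((unit ^ 2 + 2 * unit) * unit ^ 2 - 2 * unit ^ 2 * dot j (vec z) - unit ^ 2) := by
        linear_combination -unit ^ 3 / 2 * hu2
    have := mul_nonneg (half_pos hu).le (sub_nonneg.2 h)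
    linarith
  exact le_of_mul_le_mul_left this (by positivity)

theorem bolza_orbit_of_rel (i j : Unit) (x y : ℍ) (h : BolzaRel (i, x) (j, y)) :
    ∃ g ∈ bolzaGroup, g • x = y := by
  cases h with
  | side j s => exact ⟨_, inv_mem (sideElt_mem j), sideElt_inv_smul_foot j s⟩

theorem bolza_pt_eq_of_side {k : Fin 8} {x y : bolza.piece ()}
    (h : unit * dot k (vec x) = 2 * (vec x).x0) (hxy : (sideElt k)⁻¹ • (x : ℍ) = y) :
    bolza.pt () x = bolza.pt () y := by
  obtain ⟨s, hs⟩ := exists_eq_bolza_foot k x h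
  apply Quot.sound
  rw [hs, sideElt_inv_smul_foot] at hxy
  have : BolzaRel ((), foot bolzaInradius (bolzaDirection k) s)
    ((), foot bolzaInradius (bolzaDirection k + Real.pi) (-s)) := BolzaRel.side k s
  rwa [← hs, hxy] at this

theorem bolza_pt_vertex_add_three (k : Fin 8) {x y : bolza.piece ()}
    (hx : IsLattice x (vertex k)) (hy : IsLattice y (vertex (k + 3))) :
    bolza.pt () x = bolza.pt () y := by
  obtain ⟨h0, h1, h2⟩ := vec_vertex k hx
  apply bolza_pt_eq_of_side (k := k)
  · rw [h0, h1]; ring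
  have e : (sidePairing k).conj.act zunit (vertex k) = vertex (k + 3) := by
    clear hx hy h0 h1 h2; revert k; decide
  have hq : quat (sideElt k)⁻¹ = (sidePairing k).conj.map emb := by
    rw [quat_inv, sideElt, quat_toSL]; ext <;> simp [Quat.conj, Quat.map]
  have := hx.smul hq
  rw [e] at this
  exact this.eq hy

theorem bolza_pt_vertex (k l : Fin 8) {x y : bolza.piece ()}
    (hx : IsLattice x (vertex k)) (hy : IsLattice y (vertex l)) :
    bolza.pt () x = bolza.pt () y := by
  have hmem : ∀ k, ∃ z : bolza.piece (), IsLattice z (vertex k) := by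
    intro k
    obtain ⟨z, hz⟩ := exists_vertex k
    exact ⟨⟨z, (mem_bolza_piece () z).2 (vertex_mem_piece k hz)⟩, hz⟩
  choose v hv using hmem
  have hstep : ∀ k, bolza.pt () (v k) = bolza.pt () (v (k + 3)) := fun k =>
    bolza_pt_vertex_add_three k (hv k) (hv (k + 3))
  -- Since `3` generates the integers modulo `8`, the steps `k ↦ k + 3` connect all the vertices.
  have hall : ∀ f : Fin 8 → bolza.Space, (∀ k, f k = f (k + 3)) → ∀ k, f k = f 0 := by
    intro f hf k
    have h0 : f 0 = f 3 := hf 0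
    have h1 : f 1 = f 4 := hf 1
    have h3 : f 3 = f 6 := hf 3
    have h4 : f 4 = f 7 := hf 4
    have h5 : f 5 = f 0 := hf 5
    have h6 : f 6 = f 1 := hf 6
    have h7 : f 7 = f 2 := hf 7
    have e3 := h0.symm
    have e6 := h3.symm.trans e3
    have e1 := h6.symm.trans e6
    have e4 := h1.symm.trans e1
    have e7 := h4.symm.trans e4
    have e2 := h7.symm.trans e7
    fin_cases k
    exacts [rfl, e1, e2, e3, e4, h5, e6, e7]
  have hx' : x = v k := Subtype.ext (hx.eq (hv k))
  have hy' : y = v l := Subtype.ext (hy.eq (hv l))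
  rw [hx', hy', hall _ hstep k, hall _ hstep l]

/-- The Dirichlet inequality for `x` and for `y` forces them to be equally far from the base point,
so both are equality cases. The motion is then trivial or a side pairing, or both points are
vertices. -/
theorem bolza_eq_of_orbit (x y : bolza.piece ()) {g : SL(2, ℝ)} (hg : g ∈ bolzaGroup)
    (h : g • (x : ℍ) = y) : bolza.pt () x = bolza.pt () y := by
  have hx := (mem_bolza_piece () _).1 x.2
  have hy := (mem_bolza_piece () _).1 y.2
  have hinv : ∀ (a : ℍ) (f : SL(2, ℝ)), mink (vec a) (vec (f⁻¹ • I)) = (vec (f • a)).x0 := by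
    intro a f
    rw [← cosh_dist_eq, ← dist_smul f, smul_inv_smul, cosh_dist_eq, vec_I, mink, Vec.form_base]
  have e1 := x0_le_mink hx (inv_mem hg)
  rw [hinv, h] at e1
  have e2 := x0_le_mink hy hg
  have h' : g⁻¹ • (y : ℍ) = x := by rw [← h, inv_smul_smul]
  have e2' := hinv y g⁻¹
  rw [inv_inv, h'] at e2'
  rw [e2'] at e2
  have e1' := hinv x g
  rw [h] at e1'
  rcases dirichlet_eq hx (inv_mem hg) (e1'.trans (le_antisymm e2 e1)) with c | ⟨k, hk, c⟩ | ⟨k, hk⟩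
  · have := smul_eq_self_of_fixed (inv_mem hg) c y
    rw [h'] at this
    rw [Subtype.ext this]
  · apply bolza_pt_eq_of_side hk
    have hm : (sideElt k)⁻¹ * g⁻¹ ∈ bolzaGroup := mul_mem (inv_mem (sideElt_mem k)) (inv_mem hg)
    have := smul_eq_self_of_fixed hm (z := I) (by rw [mul_smul, c, inv_smul_smul]) y
    rwa [mul_smul, h'] at this
  · rcases dirichlet_eq hy hg (e2'.trans (le_antisymm e1 e2)) with c | ⟨l, hl, c⟩ | ⟨l, hl⟩
    · have := smul_eq_self_of_fixed hg c x
      rw [h] at this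
      rw [Subtype.ext this]
    · symm
      apply bolza_pt_eq_of_side hl
      have hm : (sideElt l)⁻¹ * g ∈ bolzaGroup := mul_mem (inv_mem (sideElt_mem l)) hg
      have := smul_eq_self_of_fixed hm (z := I) (by rw [mul_smul, c, inv_smul_smul]) x
      rwa [mul_smul, h] at this
    · exact bolza_pt_vertex k l hk hl

theorem bolza_isTessellation : IsTessellation bolza fun _ => id where
  isometry _ _ _ := rfl
  orbit_of_rel i j x y _ _ h := bolza_orbit_of_rel i j x y h
  eq_of_orbit _ _ x y g hg h := bolza_eq_of_orbit x y hg h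
  local_cover z := by
    obtain ⟨ε, hε, h⟩ := exists_common_nearest {c | ∃ g ∈ bolzaGroup, c = g • I}
      ⟨I, 1, one_mem _, (one_smul _ _).symm⟩
      (by rintro _ ⟨g, hg, rfl⟩; exact exists_isLattice_smul isLattice_I hg) z
    refine ⟨ε, hε, fun w hw => ?_⟩
    obtain ⟨_, ⟨g, hg, rfl⟩, h1, h2⟩ := h w hw
    -- If `g • I` is a nearest centre to `a`, moving back by `g` puts `a` in the octagon.
    have key : ∀ a, (∀ c' ∈ {c | ∃ g ∈ bolzaGroup, c = g • I}, dist a (g • I) ≤ dist a c') →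
        g⁻¹ • a ∈ bolza.piece () := by
      intro a ha k
      rw [halfPlane, Set.mem_ofPred_eq, polar_bolza, ← dist_smul g, smul_inv_smul,
        ← dist_smul g (g⁻¹ • a), smul_inv_smul, ← mul_smul]
      exact ha _ ⟨_, mul_mem hg (sideElt_mem k), rfl⟩
    exact ⟨(), g, hg, ⟨_, key z h1⟩, ⟨_, key w h2⟩, smul_inv_smul _ _, smul_inv_smul _ _⟩

/-! ### The right-angled octagon and its mirror image -/

section Ring

variable {R S : Type} [CommRing R] [CommRing S]

/-- The identity and the reflection which exchanges the base point and the vertex number `1` of the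
regular octagon with angles `π / 4`, where `s` stands for `√2`. -/
def tileVec (s : R) : Bool → Vec R → Vec R
  | true, x => x
  | false, x => ⟨(3 + 2 * s) * x.x0 - (2 + s) * x.x1 - (4 + 3 * s) * x.x2,
      s * x.x0 - (1 + s) * x.x2, (2 + s) * x.x0 - (1 + s) * x.x1 - (2 + 2 * s) * x.x2⟩

theorem tileVec_map (f : R →+* S) (s : R) (b : Bool) (x : Vec R) :
    tileVec (f s) b (x.map f) = (tileVec s b x).map f := by
  have h2 : f 2 = 2 := map_ofNat f 2
  have h3 : f 3 = 3 := map_ofNat f 3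
  have h4 : f 4 = 4 := map_ofNat f 4
  cases b <;> simp [tileVec, Vec.map, h2, h3, h4]

theorem tileVec_tileVec {s : R} (hs : s * s = 2) (b : Bool) (x : Vec R) :
    tileVec s b (tileVec s b x) = x := by
  cases b
  · ext <;> simp only [tileVec] <;> grind
  · rfl

theorem form_tileVec {s : R} (hs : s * s = 2) (b : Bool) (x y : Vec R) :
    (tileVec s b x).form (1 + s) (tileVec s b y) = x.form (1 + s) y := by
  cases b
  · simp only [tileVec, Vec.form]; grind
  · rfl

theorem tileVec_comb (s p q : R) (b : Bool) (x y : Vec R) :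
    tileVec s b (Vec.comb p x q y) = Vec.comb p (tileVec s b x) q (tileVec s b y) := by
  cases b
  · ext <;> simp only [tileVec, Vec.comb] <;> ring
  · rfl

/-- The identity for odd `k` and the half turn about the base point for even `k`. -/
def edgeTurn (k : Fin 8) (x : Vec R) : Vec R :=
  if k.val % 2 = 1 then x else ⟨x.x0, -x.x1, -x.x2⟩

theorem edgeTurn_map (f : R →+* S) (k : Fin 8) (x : Vec R) :
    edgeTurn k (x.map f) = (edgeTurn k x).map f := by
  unfold edgeTurn; split_ifs <;> simp [Vec.map]

theorem edgeTurn_comb (k : Fin 8) (s t : R) (x y : Vec R) :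
    edgeTurn k (Vec.comb s x t y) = Vec.comb s (edgeTurn k x) t (edgeTurn k y) := by
  unfold edgeTurn; split_ifs
  · rfl
  · ext <;> simp only [Vec.comb] <;> ring

end Ring

theorem exists_tile (b : Bool) (z : ℍ) : ∃ w, vec w = tileVec √2 b (vec z) := by
  have hs := sqrt_two_sq
  apply exists_vec_eq
  · rw [mink, unit, form_tileVec hs]; exact mink_self z
  · obtain ⟨p, hp⟩ := exists_vertex 1
    have e : tileVec √2 false Vec.base = vec p := by
      rw [hp, ← emb_sqrt, ← Vec.map_base emb, tileVec_map]; congr 1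
    cases b
    · have : (tileVec √2 false (vec z)).x0 = mink (vec z) (vec p) := by
        rw [← Vec.form_base (1 + √2), ← e, mink, unit]
        conv_lhs => rw [← tileVec_tileVec hs false Vec.base]
        rw [form_tileVec hs]
      rw [this]
      linarith [one_le_mink z p]
    · exact vec_x0_pos z

/-- The isometry of the upper half-plane given by `tileVec`. -/
def tile (b : Bool) (z : ℍ) : ℍ := (exists_tile b z).choose

theorem vec_tile (b : Bool) (z : ℍ) : vec (tile b z) = tileVec √2 b (vec z) :=
  (exists_tile b z).choose_spec

theorem tile_true (z : ℍ) : tile true z = z := vec_injective (vec_tile true z)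

theorem tile_tile (b : Bool) (z : ℍ) : tile b (tile b z) = z := by
  apply vec_injective
  rw [vec_tile, vec_tile, tileVec_tileVec sqrt_two_sq]

theorem mink_tile (b : Bool) (z w : ℍ) :
    mink (vec (tile b z)) (vec (tile b w)) = mink (vec z) (vec w) := by
  rw [vec_tile, vec_tile]; exact form_tileVec sqrt_two_sq b _ _

theorem dist_tile (b : Bool) (z w : ℍ) : dist (tile b z) (tile b w) = dist z w := by
  apply le_antisymm <;> rw [dist_le_dist_iff, mink_tile]

theorem tile_injective (b : Bool) : Function.Injective (tile b) :=
  Function.LeftInverse.injective (tile_tile b)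

theorem IsLattice.tile {z : ℍ} {x : Vec (ℤ√2)} (h : IsLattice z x) (b : Bool) :
    IsLattice (tile b z) (tileVec ⟨0, 1⟩ b x) := by
  rw [IsLattice, vec_tile, h, ← emb_sqrt, tileVec_map]

theorem exists_isLattice_tile (b : Bool) {g : SL(2, ℝ)} (hg : g ∈ bolzaGroup) :
    ∃ x, IsLattice (g • BolzaCross.tile b I) x ∧
      SameClass x (tileVec ⟨0, 1⟩ b Vec.base) := by
  obtain ⟨q, hq, hgq⟩ := hg
  refine ⟨_, (isLattice_I.tile b).smul hgq, sameClass_act hq ?_⟩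
  revert b; decide

/-- The identity for odd `k` and the half turn about `i` for even `k`. -/
def edgeMap (k : Fin 8) (z : ℍ) : ℍ := if k.val % 2 = 1 then z else rot Real.pi • z

theorem vec_edgeMap (k : Fin 8) (z : ℍ) : vec (edgeMap k z) = edgeTurn k (vec z) := by
  unfold edgeMap edgeTurn
  split_ifs
  · rfl
  · rw [vec_rot_smul]; simp

theorem IsLattice.edgeMap {z : ℍ} {x : Vec (ℤ√2)} (h : IsLattice z x) (k : Fin 8) :
    IsLattice (edgeMap k z) (edgeTurn k x) := by
  rw [IsLattice, vec_edgeMap, h, edgeTurn_map]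

/-- The vertices of the right-angled octagon. -/
def corner (k : Fin 8) : Vec (ℤ√2) := ⟨zunit, (dir k).1, (dir k).2⟩

theorem exists_corner (k : Fin 8) : ∃ z, IsLattice z (corner k) := by
  apply exists_vec_eq
  · rw [mink, ← emb_zunit, Vec.map_form, ← map_one emb]; congr 1; revert k; decide
  · simp only [corner, Vec.map, emb_zunit]; exact unit_pos

theorem vec_corner (k : Fin 8) {z : ℍ} (hz : IsLattice z (corner k)) :
    (vec z).x0 = unit ∧ dot k (vec z) = 2 ∧ perp k (vec z) = 0 := by
  rw [hz]
  refine ⟨by simp [corner, Vec.map], ?_, ?_⟩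
  · simp only [dot, corner, Vec.map]; linear_combination dir_sq k
  · simp only [perp, corner, Vec.map]; ring

theorem vec_corner_succ (k : Fin 8) {z : ℍ} (hz : IsLattice z (corner (k + 1))) :
    (vec z).x0 = unit ∧ dot k (vec z) = √2 ∧ perp k (vec z) = √2 := by
  rw [hz]
  refine ⟨by simp [corner, Vec.map], ?_, ?_⟩
  · simp only [dot, corner, Vec.map, ← emb_sqrt, ← map_mul, ← map_add]
    congr 1; clear hz; revert k; decide
  · simp only [perp, corner, Vec.map, ← emb_sqrt, ← map_neg, ← map_mul, ← map_add]
    congr 1; clear hz; revert k; decide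

/-- The functional whose vanishing defines the `k`-th side of the right-angled octagon. -/
def edgeForm (k : Fin 8) (x : Vec ℝ) : ℝ := 2 * x.x0 - unit * dot k x - perp k x

/-- The `k`-th side of the right-angled octagon lies on the bisector of the base point and the Bolza
vertex `k`, which is thus the centre of the neighbouring tile. -/
theorem mink_vertex_sub (k : Fin 8) {p : ℍ} (hp : IsLattice p (vertex k)) (x : Vec ℝ) :
    mink x (vec p) - x.x0 = unit * edgeForm k x := by
  obtain ⟨p0, p1, p2⟩ := vec_vertex k hp
  rw [mink_eq k, p0, p1, p2, edgeForm]
  linear_combination x.x0 * unit_sq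

theorem mink_corner_sector (k : Fin 8) {p q : ℍ} (hp : IsLattice p (corner k))
    (hq : IsLattice q (corner (k + 1))) (x y : Vec ℝ) : mink x y =
      edgeForm k x / 2 * y.x0 + (dot k x - perp k x) / 2 * mink (vec p) y +
        √2 / 2 * perp k x * mink (vec q) y := by
  have hs := sqrt_two_sq
  obtain ⟨p0, p1, p2⟩ := vec_corner k hp
  obtain ⟨q0, q1, q2⟩ := vec_corner_succ k hq
  rw [mink_eq k, mink_eq k (vec p), mink_eq k (vec q), p0, p1, p2, q0, q1, q2, edgeForm, unit]
  linear_combination (-(perp k x * y.x0) / 2 +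
    (1 + √2) / 4 * perp k x * (dot k y + perp k y)) * hs

theorem perp_pred (k : Fin 8) (x : Vec ℝ) : √2 * perp (k - 1) x = dot k x + perp k x := by
  obtain ⟨h1, h2⟩ := dir_pred k
  simp only [dot, perp]; linear_combination -x.x1 * h2 + x.x2 * h1

theorem exists_sector (x : Vec ℝ) : ∃ k, 0 ≤ perp k x ∧ perp k x ≤ dot k x := by
  obtain ⟨k, hk⟩ := exists_dir x
  obtain ⟨hs, hs'⟩ := sqrt_two_bounds
  have hd : 0 ≤ dot k x := by
    have := (abs_nonneg _).trans hk
    by_contra hn; nlinarith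
  rw [abs_le] at hk
  rcases le_total 0 (perp k x) with h | h
  · exact ⟨k, h, by nlinarith⟩
  · have h1 := perp_pred k x
    have h2 := dot_pred k x
    refine ⟨k - 1, ?_, ?_⟩
    · have : 0 ≤ √2 * perp (k - 1) x := by rw [h1]; nlinarith
      exact nonneg_of_mul_nonneg_right this (by linarith)
    · have : √2 * perp (k - 1) x ≤ √2 * dot (k - 1) x := by rw [h1, h2]; linarith
      exact le_of_mul_le_mul_left this (by linarith)

/-- Membership in the right-angled octagon whose corners are the lattice points `corner k`. -/
def InOctagon (z : ℍ) : Prop := ∀ k, 0 ≤ edgeForm k (vec z)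

/-- The points that are at least as far from every corner as the base point is. -/
def FarFromCorners (q : ℍ) : Prop :=
  ∀ k z, IsLattice z (corner k) → unit ≤ mink (vec z) (vec q)

/-- Linearity again reduces the Voronoi inequality to the centre and two consecutive corners, and
the hypothesis on `q` is the inequality at the corners. -/
theorem InOctagon.x0_le_mink {z q : ℍ} (hz : InOctagon z) (hq : FarFromCorners q) :
    (vec z).x0 ≤ mink (vec z) (vec q) := by
  obtain ⟨k, h1, h2⟩ := exists_sector (vec z)
  obtain ⟨p, hp⟩ := exists_corner k
  obtain ⟨r, hr⟩ := exists_corner (k + 1)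
  have h3 := one_le_mink q I
  rw [vec_I, mink, Vec.form_base] at h3
  have h4 := hq _ _ hp
  have h5 := hq _ _ hr
  have h6 := hz k
  have e : (vec z).x0 = edgeForm k (vec z) / 2 * 1 + (dot k (vec z) - perp k (vec z)) / 2 * unit +
        √2 / 2 * perp k (vec z) * unit := by
    rw [edgeForm, unit]; linear_combination -(perp k (vec z)) / 2 * sqrt_two_sq
  rw [mink_corner_sector k hp hr]
  calc _ = _ := e
    _ ≤ _ := by gcongr

theorem corner_of_sector (k : Fin 8) {z : ℍ} (h : edgeForm k (vec z) = 0)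
    (h' : dot k (vec z) - perp k (vec z) = 0 ∨ perp k (vec z) = 0) :
    ∃ l, IsLattice z (corner l) := by
  have hm := mink_self z
  have hx := vec_x0_pos z
  have hu := unit_pos
  have hu2 := unit_sq
  have hs := sqrt_two_sq
  rw [mink_eq k] at hm
  rw [edgeForm] at h
  rcases h' with h' | h'
  · obtain ⟨r, hr⟩ := exists_corner (k + 1)
    obtain ⟨r0, r1, r2⟩ := vec_corner_succ k hr
    have e : perp k (vec z) = dot k (vec z) := (sub_eq_zero.1 h').symm
    rw [e] at h hm
    have hx0 : (vec z).x0 = (unit + 1) * dot k (vec z) / 2 := by linear_combination h / 2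
    rw [hx0] at hm hx
    have e2 : (dot k (vec z) - √2) * (dot k (vec z) + √2) = 0 := by
      linear_combination 2 * hm - dot k (vec z) ^ 2 / 2 * hu2 - hs
    have hd : dot k (vec z) = √2 := by
      rcases mul_eq_zero.1 e2 with h | h
      · exact sub_eq_zero.1 h
      · exfalso
        have : dot k (vec z) = -√2 := by linarith
        rw [this] at hx
        have : 0 < (unit + 1) * √2 := by positivity
        linarith
    refine ⟨k + 1, ?_⟩
    rw [IsLattice, ← hr]
    apply vec_ext_dir k
    · rw [r0, hx0, hd, unit]; linear_combination hs / 2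
    · rw [r1, hd]
    · rw [r2, e, hd]
  · obtain ⟨r, hr⟩ := exists_corner k
    obtain ⟨r0, r1, r2⟩ := vec_corner k hr
    rw [h'] at h hm
    have hx0 : (vec z).x0 = unit * dot k (vec z) / 2 := by linear_combination h / 2
    rw [hx0] at hm hx
    have e2 : (dot k (vec z) - 2) * (dot k (vec z) + 2) = 0 := by
      linear_combination 4 * hm - dot k (vec z) ^ 2 * hu2
    have hd : dot k (vec z) = 2 := by
      rcases mul_eq_zero.1 e2 with h | h
      · exact sub_eq_zero.1 h
      · exfalso
        have : dot k (vec z) = -2 := by linarith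
        rw [this] at hx
        linarith
    refine ⟨k, ?_⟩
    rw [IsLattice, ← hr]
    apply vec_ext_dir k
    · rw [r0, hx0, hd]; ring
    · rw [r1, hd]
    · rw [r2, h']

/-- Two points of the plane have the prescribed distances from two consecutive corners, and they are
mirror images in the side joining them. -/
theorem eq_of_near_corners (k : Fin 8) {p r q : ℍ} (hp : IsLattice p (corner k))
    (hr : IsLattice r (corner (k + 1))) (h1 : mink (vec p) (vec q) = unit)
    (h2 : mink (vec r) (vec q) = unit) : q = I ∨ IsLattice q (vertex k) := by
  have hu := unit_pos
  have hs := sqrt_two_sq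
  have hw := mink_self q
  obtain ⟨p0, p1, p2⟩ := vec_corner k hp
  obtain ⟨r0, r1, r2⟩ := vec_corner_succ k hr
  rw [mink_eq k, p0, p1, p2] at h1
  rw [mink_eq k, r0, r1, r2] at h2
  rw [mink_eq k] at hw
  have f1 : dot k (vec q) = (vec q).x0 - 1 := by
    have : unit * (dot k (vec q) - ((vec q).x0 - 1)) = 0 := by linear_combination -h1
    exact sub_eq_zero.1 ((mul_eq_zero.1 this).resolve_left hu.ne')
  have f2 : perp k (vec q) = (√2 - 1) * ((vec q).x0 - 1) := by
    have : unit * (perp k (vec q) - (√2 - 1) * ((vec q).x0 - 1)) = 0 := by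
      rw [f1] at h2
      linear_combination -√2 * h2 - unit * ((vec q).x0 - 1 + perp k (vec q)) / 2 * hs
    exact sub_eq_zero.1 ((mul_eq_zero.1 this).resolve_left hu.ne')
  rw [f1, f2] at hw
  have e : ((vec q).x0 - 1) * ((vec q).x0 - unit ^ 2) = 0 := by
    have e1 : ((vec q).x0 - 1) * ((vec q).x0 + 1 - √2 * ((vec q).x0 - 1)) = 0 := by
      rw [unit] at hw
      linear_combination hw + ((vec q).x0 - 1) ^ 2 * (√2 - 1) / 2 * hs
    rw [unit]
    linear_combination -(1 + √2) * e1 - ((vec q).x0 - 1) * (vec q).x0 * hs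
  rcases mul_eq_zero.1 e with h | h
  · left
    apply eq_of_mink_eq_one
    rw [vec_I, mink, Vec.form_base]; exact sub_eq_zero.1 h
  · right
    have h := sub_eq_zero.1 h
    obtain ⟨v, hv⟩ := exists_vertex k
    obtain ⟨v0, v1, v2⟩ := vec_vertex k hv
    rw [IsLattice, ← hv]
    apply vec_ext_dir k
    · rw [v0, h]
    · rw [v1, f1, h, unit_sq]; ring
    · rw [v2, f2, h, unit_sq, unit]; linear_combination 2 * hs

/-- The equality cases of the Voronoi inequality. -/
theorem InOctagon.eq_cases {z q : ℍ} (hz : InOctagon z) (hq : FarFromCorners q)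
    (h : mink (vec z) (vec q) = (vec z).x0) :
    q = I ∨ (∃ k, edgeForm k (vec z) = 0 ∧ IsLattice q (vertex k)) ∨
      ∃ k, IsLattice z (corner k) := by
  obtain ⟨k, h1, h2⟩ := exists_sector (vec z)
  obtain ⟨p, hp⟩ := exists_corner k
  obtain ⟨r, hr⟩ := exists_corner (k + 1)
  have h3 := one_le_mink q I
  rw [vec_I, mink, Vec.form_base] at h3
  have h4 := hq _ _ hp
  have h5 := hq _ _ hr
  have h6 := hz k
  have e : (vec z).x0 = edgeForm k (vec z) / 2 * 1 + (dot k (vec z) - perp k (vec z)) / 2 * unit +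
        √2 / 2 * perp k (vec z) * unit := by
    rw [edgeForm, unit]; linear_combination -(perp k (vec z)) / 2 * sqrt_two_sq
  rw [mink_corner_sector k hp hr] at h
  have a1 : 0 ≤ edgeForm k (vec z) / 2 * ((vec q).x0 - 1) :=
    mul_nonneg (by linarith) (by linarith)
  have a2 : 0 ≤ (dot k (vec z) - perp k (vec z)) / 2 * (mink (vec p) (vec q) - unit) :=
    mul_nonneg (by linarith) (by linarith)
  have a3 : 0 ≤ √2 / 2 * perp k (vec z) * (mink (vec r) (vec q) - unit) :=
    mul_nonneg (by positivity) (by linarith)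
  have b1 : edgeForm k (vec z) / 2 * ((vec q).x0 - 1) = 0 := by linarith
  have b2 : (dot k (vec z) - perp k (vec z)) / 2 * (mink (vec p) (vec q) - unit) = 0 := by
    linarith
  have b3 : √2 / 2 * perp k (vec z) * (mink (vec r) (vec q) - unit) = 0 := by linarith
  rcases mul_eq_zero.1 b1 with c1 | c1
  swap
  · left
    apply eq_of_mink_eq_one
    rw [vec_I, mink, Vec.form_base]; linarith
  have c1 : edgeForm k (vec z) = 0 := by linarith
  rcases mul_eq_zero.1 b2 with c2 | c2
  · exact Or.inr (Or.inr (corner_of_sector k c1 (Or.inl (by linarith))))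
  rcases mul_eq_zero.1 b3 with c3 | c3
  · refine Or.inr (Or.inr (corner_of_sector k c1 (Or.inr ?_)))
    exact (mul_eq_zero.1 c3).resolve_left (by positivity)
  rcases eq_of_near_corners k hp hr (sub_eq_zero.1 c2) (sub_eq_zero.1 c3) with d | d
  · exact Or.inl d
  · exact Or.inr (Or.inl ⟨k, c1, d⟩)

/-- Distinct lattice points have product at least `u`, and a centre cannot be a corner because their
congruence classes differ. -/
theorem farFromCorners (i j : Bool) {g : SL(2, ℝ)} (hg : g ∈ bolzaGroup) :
    FarFromCorners (tile i (g • tile j I)) := by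
  intro k z hz
  rw [← mink_tile i, tile_tile]
  obtain ⟨x, hx, hc⟩ := exists_isLattice_tile j hg
  refine (hz.tile i).unit_le_mink hx ?_
  intro h
  rw [← h] at hx
  rw [hx.unique (hz.tile i)] at hc
  clear hz hx h
  revert i j k; decide

/-- The side pairings of the two octagons: the `k`-th side of the first octagon is moved to the
`k`-th side of the second one for odd `k`, and to the opposite side for even `k`. -/
def crossPairing (k : Fin 8) : Quat (ℤ√2) :=
  -- Entry `1` is the identity because the second octagon is the mirror image of the first one in
  -- side `1`.
  ![⟨⟨1, 1⟩, ⟨-2, -2⟩, ⟨-1, -1⟩, ⟨1, 1⟩⟩, ⟨1, 0, 0, 0⟩, ⟨⟨1, 1⟩, ⟨2, 2⟩, ⟨2, 1⟩, 0⟩,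
    ⟨⟨1, 1⟩, ⟨2, 1⟩, ⟨1, 1⟩, 1⟩, ⟨⟨1, 1⟩, 0, 1, 1⟩, ⟨⟨3, 2⟩, 0, ⟨0, 1⟩, ⟨2, 1⟩⟩,
    ⟨⟨1, 1⟩, 0, 0, ⟨0, 1⟩⟩, ⟨⟨1, 1⟩, ⟨-2, -1⟩, -1, ⟨1, 1⟩⟩] k

theorem crossPairing_admissible (k : Fin 8) : Admissible (crossPairing k) := by
  refine ⟨?_, ?_, ?_, ?_⟩ <;> revert k <;> decide

/-- The side pairings of the two octagons, as matrices. -/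
def crossElt (k : Fin 8) : SL(2, ℝ) := toSL (crossPairing k) (crossPairing_admissible k).norm_eq

theorem crossElt_mem (k : Fin 8) : crossElt k ∈ bolzaGroup :=
  toSL_mem (crossPairing_admissible k)

theorem quat_crossElt (k : Fin 8) : quat (crossElt k) = (crossPairing k).map emb :=
  quat_toSL _ _

/-- On the hyperboloid the points of a side are combinations of its two corners and all the maps are
linear, so it is enough to check the corners. -/
theorem crossElt_smul_of_edgeForm_eq_zero (k : Fin 8) {z : ℍ} (hz : edgeForm k (vec z) = 0) :
    crossElt k • z = tile false (edgeMap k z) := by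
  obtain ⟨p, hp⟩ := exists_corner k
  obtain ⟨q, hq⟩ := exists_corner (k + 1)
  have e : vec z = Vec.comb ((dot k (vec z) - perp k (vec z)) / 2) ((corner k).map emb)
      (√2 / 2 * perp k (vec z)) ((corner (k + 1)).map emb) := by
    obtain ⟨p0, p1, p2⟩ := vec_corner k hp
    obtain ⟨q0, q1, q2⟩ := vec_corner_succ k hq
    have hs := sqrt_two_sq
    rw [hp] at p0 p1 p2
    rw [hq] at q0 q1 q2
    rw [edgeForm, unit] at hz
    apply vec_ext_dir k
    · simp only [Vec.comb, p0, q0, unit]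
      linear_combination hz / 2 - perp k (vec z) / 2 * hs
    · have : ∀ s t (x y : Vec ℝ), dot k (Vec.comb s x t y) = s * dot k x + t * dot k y := by
        intro s t x y; simp only [dot, Vec.comb]; ring
      rw [this, p1, q1]; linear_combination -perp k (vec z) / 2 * hs
    · have : ∀ s t (x y : Vec ℝ), perp k (Vec.comb s x t y) = s * perp k x + t * perp k y := by
        intro s t x y; simp only [perp, Vec.comb]; ring
      rw [this, p2, q2]; linear_combination -perp k (vec z) / 2 * hs
  have h1 : (crossPairing k).act zunit (corner k) =
      tileVec ⟨0, 1⟩ false (edgeTurn k (corner k)) := by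
    clear hp hq hz e; revert k; decide
  have h2 : (crossPairing k).act zunit (corner (k + 1)) =
      tileVec ⟨0, 1⟩ false (edgeTurn k (corner (k + 1))) := by
    clear hp hq hz e h1; revert k; decide
  apply vec_injective
  rw [vec_smul, vec_tile, vec_edgeMap, quat_crossElt, ← emb_sqrt, ← emb_zunit]
  generalize vec z = x at *
  rw [e, Quat.act_comb, edgeTurn_comb, tileVec_comb, Quat.act_map, Quat.act_map, edgeTurn_map,
    edgeTurn_map, tileVec_map, tileVec_map, h1, h2]

theorem crossElt_smul_vertex (k : Fin 8) {p : ℍ} (hp : IsLattice p (vertex k)) :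
    crossElt k • p = tile false I := by
  have e : (crossPairing k).act zunit (vertex k) = tileVec ⟨0, 1⟩ false Vec.base := by
    clear hp; revert k; decide
  have := hp.smul (quat_crossElt k)
  rw [e] at this
  exact this.eq (isLattice_I.tile false)

theorem crossElt_smul_I (k : Fin 8) {p : ℍ} (hp : IsLattice p (vertex k)) :
    crossElt k • I = tile false (edgeMap k p) := by
  have e : (crossPairing k).act zunit Vec.base =
      tileVec ⟨0, 1⟩ false (edgeTurn k (vertex k)) := by
    clear hp; revert k; decide
  have := isLattice_I.smul (quat_crossElt k)
  rw [e] at this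
  exact this.eq ((hp.edgeMap k).tile false)

/-- The number of the side to which the `k`-th side is moved by `edgeMap k`. -/
def oppositeEdge (k : Fin 8) : Fin 8 := if k.val % 2 = 1 then k else k + 4

theorem edgeMap_oppositeEdge (k : Fin 8) (z : ℍ) : edgeMap (oppositeEdge k) (edgeMap k z) = z := by
  apply vec_injective
  rw [vec_edgeMap, vec_edgeMap]
  have : ∀ x : Vec ℝ, (⟨x.x0, - -x.x1, - -x.x2⟩ : Vec ℝ) = x := by intro x; ext <;> simp
  fin_cases k <;> simp [edgeTurn, oppositeEdge]

theorem edgeForm_edgeMap (k : Fin 8) (z : ℍ) :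
    edgeForm (oppositeEdge k) (vec (edgeMap k z)) = edgeForm k (vec z) := by
  rw [vec_edgeMap]
  fin_cases k <;> simp [edgeTurn, oppositeEdge, edgeForm, dot, perp, dir, emb_apply]

theorem isLattice_edgeMap_vertex (k : Fin 8) {p q : ℍ} (hp : IsLattice p (vertex k))
    (hq : IsLattice q (vertex (oppositeEdge k))) : edgeMap (oppositeEdge k) q = p := by
  have e : edgeTurn (oppositeEdge k) (vertex (oppositeEdge k)) = vertex k := by
    clear hp hq; revert k; decide
  have := hq.edgeMap (oppositeEdge k)
  rw [e] at this
  exact this.eq hp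

/-! ### The glued cross as a quotient of the hyperbolic plane -/

/-- Every point of the perpendicular bisector of `i` and `polar (2 * d) θ` is a `foot`. -/
theorem exists_eq_foot {d : ℝ} (hd : d ≠ 0) (θ : ℝ) {z : ℍ}
    (h : dist z I = dist z (polar (2 * d) θ)) : ∃ s, z = foot d θ s := by
  have he := eta_pos.ne'
  have hs : Real.sinh d ≠ 0 := Real.sinh_ne_zero.2 hd
  have hc := Real.cosh_pos d
  have hcs := Real.cosh_sq d
  have ht := Real.cos_sq_add_sin_sq θ
  have hm := mink_self z
  have hx := vec_x0_pos z
  have h := congrArg Real.cosh h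
  rw [cosh_dist_eq, cosh_dist_eq, vec_I, vec_polar, mink, Vec.form_base, Real.cosh_two_mul,
    Real.sinh_two_mul] at h
  simp only [mink, Vec.form, ← eta_sq] at h hm
  refine ⟨Real.arsinh (eta * (-Real.sin θ * (vec z).x1 + Real.cos θ * (vec z).x2)), ?_⟩
  have hc' := Real.cosh_sq (Real.arsinh (eta * (-Real.sin θ * (vec z).x1 + Real.cos θ * (vec z).x2)))
  have hp' := Real.cosh_pos (Real.arsinh (eta * (-Real.sin θ * (vec z).x1 + Real.cos θ * (vec z).x2)))
  apply vec_injective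
  rw [vec_foot, Real.sinh_arsinh]
  rw [Real.sinh_arsinh] at hc'
  generalize Real.cosh (Real.arsinh
    (eta * (-Real.sin θ * (vec z).x1 + Real.cos θ * (vec z).x2))) = c' at *
  generalize vec z = x at *
  generalize Real.cosh d = c at *
  generalize Real.sinh d = s at *
  generalize Real.cos θ = a at *
  generalize Real.sin θ = b at *
  have h1 : s * x.x0 = eta * c * (a * x.x1 + b * x.x2) := by
    have : 2 * s * (s * x.x0 - eta * c * (a * x.x1 + b * x.x2)) = 0 := by
      field_simp at h
      linear_combination -h - x.x0 * hcs
    exact sub_eq_zero.1 ((mul_eq_zero.1 this).resolve_left (by positivity))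
  have h2 : x.x0 = c' * c := by
    have : x.x0 ^ 2 = (c' * c) ^ 2 := by
      linear_combination c ^ 2 * hm - c ^ 2 * hc' - x.x0 ^ 2 * hcs
        - (s * x.x0 + eta * c * (a * x.x1 + b * x.x2)) * h1
        - c ^ 2 * eta ^ 2 * (x.x1 ^ 2 + x.x2 ^ 2) * ht
    exact (sq_eq_sq₀ hx.le (by positivity)).1 this
  have h3 : c' * s = eta * (a * x.x1 + b * x.x2) := by
    apply mul_left_cancel₀ hc.ne'
    linear_combination h1 - s * h2
  ext
  · exact h2
  · simp only []
    rw [h3]; field_simp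
    linear_combination -x.x1 * ht
  · simp only []
    rw [h3]; field_simp
    linear_combination -x.x2 * ht

theorem dist_foot (d θ s : ℝ) : dist (foot d θ s) I = dist (foot d θ s) (polar (2 * d) θ) := by
  have he := eta_pos.ne'
  have ht := Real.cos_sq_add_sin_sq θ
  have hcs := Real.cosh_sq d
  have : mink (vec (foot d θ s)) (vec I) = mink (vec (foot d θ s)) (vec (polar (2 * d) θ)) := by
    rw [vec_I, vec_polar, vec_foot, mink, Vec.form_base, Real.cosh_two_mul, Real.sinh_two_mul]
    simp only [mink, Vec.form, ← eta_sq]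
    generalize Real.cosh d = c at *
    generalize Real.sinh d = e at *
    generalize Real.cos θ = a at *
    generalize Real.sin θ = b at *
    field_simp
    linear_combination 2 * c * Real.cosh s * e ^ 2 * ht - c * Real.cosh s * hcs
  exact le_antisymm ((dist_le_dist_iff _ _ _ _).2 this.le) ((dist_le_dist_iff _ _ _ _).2 this.ge)

theorem rot_smul_I (θ : ℝ) : rot θ • I = I := by
  apply vec_injective
  rw [vec_rot_smul, vec_I]; ext <;> simp [Vec.base]

theorem rot_smul_rot_smul (θ θ' : ℝ) (z : ℍ) : rot θ • rot θ' • z = rot θ' • rot θ • z := by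
  apply vec_injective
  rw [vec_rot_smul, vec_rot_smul, vec_rot_smul, vec_rot_smul]; ext <;> simp only [] <;> ring

theorem rot_pi_smul_foot (d θ s : ℝ) : rot Real.pi • foot d θ s = foot d (θ + Real.pi) s := by
  apply vec_injective
  rw [vec_rot_smul, vec_foot, vec_foot, Real.cos_add_pi, Real.sin_add_pi, Real.cos_pi,
    Real.sin_pi]
  ext <;> simp only [] <;> ring

/-! ### The octagon at the parameter of equal lengths -/

/-- The inradius of the regular right-angled octagon. -/
def apothem : ℝ := Real.arsinh eta

theorem sinh_apothem : Real.sinh apothem = eta := Real.sinh_arsinh _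

theorem apothem_pos : 0 < apothem := Real.arsinh_pos_iff.2 eta_pos

theorem cosh_apothem_sq : Real.cosh apothem ^ 2 = 2 + √2 := by
  rw [Real.cosh_sq, sinh_apothem, eta_sq, unit]; ring

theorem cosh_apothem : Real.cosh apothem = 2 * Real.cos (Real.pi / 8) := by
  have h0 : 0 < Real.cos (Real.pi / 8) :=
    Real.cos_pos_of_mem_Ioo ⟨by linarith [Real.pi_pos], by linarith [Real.pi_pos]⟩
  apply (sq_eq_sq₀ (Real.cosh_pos _).le (by positivity)).1
  have := Real.cos_sq (Real.pi / 8)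
  rw [show 2 * (Real.pi / 8) = Real.pi / 4 by ring, Real.cos_pi_div_four] at this
  rw [cosh_apothem_sq, mul_pow, this]; ring

theorem cosh_apothem_mul_sin : Real.cosh apothem * Real.sin (Real.pi / 8) = √2 / 2 := by
  have := Real.sin_two_mul (Real.pi / 8)
  rw [show 2 * (Real.pi / 8) = Real.pi / 4 by ring, Real.sin_pi_div_four] at this
  rw [cosh_apothem, this]; ring

section

variable {t : ℝ}

/-- Here `coth² t = 1 + √2 = eta²`. With `wLen_eq`, all eight sides are at the same distance from
the centre. -/
theorem uLen_eq (ht : 0 < t) (h : Real.sinh t ^ 2 = √2 / 2) : uLen t = apothem := by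
  have hs := Real.sinh_pos_iff.2 ht
  have hc := Real.cosh_pos t
  rw [uLen, apothem]
  congr 1
  apply (sq_eq_sq₀ (by positivity) eta_pos.le).1
  rw [div_pow, Real.cosh_sq, h, eta_sq, unit]
  have := sqrt_two_sq
  field_simp
  linear_combination -this

theorem wLen_eq (h : Real.sinh t ^ 2 = √2 / 2) : wLen t = apothem := by
  rw [wLen, ← Real.arcosh_cosh apothem_pos.le]
  congr 1
  apply (sq_eq_sq₀ (by positivity) (Real.cosh_pos _).le).1
  rw [cosh_apothem_sq, mul_pow, Real.cosh_sq, h, Real.sq_sqrt zero_le_two]; ring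

/-- The rotation by `π / 8` brings the corners to the directions `dir k`, where they and the mirror
images of the centre have coordinates in `ℤ[√2]`. -/
theorem isLattice_rot_polar (k : Fin 8) :
    IsLattice (rot (Real.pi / 8) • polar (2 * apothem) (bolzaDirection k)) (vertex k) := by
  obtain ⟨p, hp⟩ := exists_vertex k
  obtain ⟨p0, p1, p2⟩ := vec_vertex k hp
  have he := eta_pos.ne'
  have hs := sqrt_two_sq
  obtain ⟨h1, h2⟩ := dir_eq k
  have hd := Real.cos_sq_add_sin_sq (bolzaDirection k)
  have hc := cosh_apothem
  have hq := cosh_apothem_sq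
  have hm := cosh_apothem_mul_sin
  have e : 2 * eta * Real.cosh apothem / eta = 2 * Real.cosh apothem := by field_simp
  rw [IsLattice, ← hp, vec_rot_smul, vec_polar, Real.cosh_two_mul, Real.sinh_two_mul, sinh_apothem,
    e]
  apply vec_ext_dir k
  · rw [p0, hq, eta_sq, unit_sq, unit]; ring
  · rw [p1]
    simp only [dot, ← h1, ← h2]
    rw [unit]
    linear_combination 2 * √2 * Real.cosh apothem * Real.cos (Real.pi / 8) * hd
      - √2 * Real.cosh apothem * hc + √2 * hq + hs
  · rw [p2]
    simp only [perp, ← h1, ← h2]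
    linear_combination 2 * √2 * Real.cosh apothem * Real.sin (Real.pi / 8) * hd
      + 2 * √2 * hm + hs

theorem mem_halfPlane_iff (k : Fin 8) (z : ℍ) : z ∈ halfPlane apothem (bolzaDirection k) ↔
    0 ≤ edgeForm k (vec (rot (Real.pi / 8) • z)) := by
  have h := mink_vertex_sub k (isLattice_rot_polar k) (vec (rot (Real.pi / 8) • z))
  rw [halfPlane, Set.mem_ofPred_eq, ← dist_smul (rot (Real.pi / 8)) z I, rot_smul_I,
    ← dist_smul (rot (Real.pi / 8)) z, dist_le_dist_iff, vec_I, mink, Vec.form_base, ← sub_nonneg,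
    h, mul_nonneg_iff_of_pos_left unit_pos]

theorem edgeForm_eq_zero_iff (k : Fin 8) (z : ℍ) :
    edgeForm k (vec (rot (Real.pi / 8) • z)) = 0 ↔
      dist z I = dist z (polar (2 * apothem) (bolzaDirection k)) := by
  have h := mink_vertex_sub k (isLattice_rot_polar k) (vec (rot (Real.pi / 8) • z))
  rw [← dist_smul (rot (Real.pi / 8)) z I, rot_smul_I, ← dist_smul (rot (Real.pi / 8)) z,
    le_antisymm_iff (a := dist _ _), dist_le_dist_iff, dist_le_dist_iff, ← le_antisymm_iff,
    vec_I, mink, Vec.form_base]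
  constructor
  · intro h0; rw [h0, mul_zero] at h; linarith
  · intro h0; rw [← h0, sub_self] at h
    exact (mul_eq_zero.1 h.symm).resolve_left unit_pos.ne'

theorem axis_eq (j : Fin 4) : axis j = bolzaDirection ⟨2 * j, by omega⟩ := by
  simp only [axis, bolzaDirection]; push_cast; ring

theorem diagonal_eq (j : Fin 4) : diagonal j = bolzaDirection ⟨2 * j + 1, by omega⟩ := by
  simp only [diagonal, bolzaDirection]; push_cast; ring

theorem fin_eight_cases (k : Fin 8) :
    ∃ j : Fin 4, k = ⟨2 * j, by omega⟩ ∨ k = ⟨2 * j + 1, by omega⟩ := by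
  revert k; decide

theorem mem_octagon_iff (ht : 0 < t) (h : Real.sinh t ^ 2 = √2 / 2) (z : ℍ) :
    z ∈ octagon t ↔ InOctagon (rot (Real.pi / 8) • z) := by
  rw [octagon, Set.mem_ofPred_eq, uLen_eq ht h, wLen_eq h]
  constructor
  · intro hz k
    rw [← mem_halfPlane_iff]
    obtain ⟨j, rfl | rfl⟩ := fin_eight_cases k
    · rw [← axis_eq]; exact (hz j).1
    · rw [← diagonal_eq]; exact (hz j).2
  · intro hz j
    rw [axis_eq, diagonal_eq, mem_halfPlane_iff, mem_halfPlane_iff]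
    exact ⟨hz _, hz _⟩

/-- Odd sides are the seams and are glued by the identity. Even sides carry the half twist, which on
the octagons is the half turn about the centre. -/
theorem cross_pt_eq_of_edge (ht : 0 < t) (h : Real.sinh t ^ 2 = √2 / 2) (k : Fin 8)
    {x : (crossGluing t).piece true} {y : (crossGluing t).piece false}
    (hx : edgeForm k (vec (rot (Real.pi / 8) • (x : ℍ))) = 0)
    (hxy : rot (Real.pi / 8) • (y : ℍ) = edgeMap k (rot (Real.pi / 8) • (x : ℍ))) :
    (crossGluing t).pt true x = (crossGluing t).pt false y := by
  obtain ⟨s, hs⟩ := exists_eq_foot apothem_pos.ne' _ ((edgeForm_eq_zero_iff k x).1 hx)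
  apply Quot.sound
  change CrossRel t (true, x) (false, y)
  obtain ⟨j, rfl | rfl⟩ := fin_eight_cases k
  · rw [edgeMap, if_neg (by simp), rot_smul_rot_smul, smul_left_cancel_iff, hs, rot_pi_smul_foot,
      ← axis_eq] at hxy
    rw [← axis_eq] at hs
    rw [hxy, hs, ← uLen_eq ht h]
    exact CrossRel.twist j s
  · rw [edgeMap, if_pos (by simp), smul_left_cancel_iff] at hxy
    rw [← diagonal_eq] at hs
    rw [hxy, hs, ← wLen_eq h]
    exact CrossRel.seam j s

theorem cross_orbit_of_rel (ht : 0 < t) (h : Real.sinh t ^ 2 = √2 / 2) {i j : Bool} {x y : ℍ}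
    (hr : CrossRel t (i, x) (j, y)) : ∃ g ∈ bolzaGroup,
      g • tile i (rot (Real.pi / 8) • x) = tile j (rot (Real.pi / 8) • y) := by
  cases hr with
  | seam j s =>
    refine ⟨_, crossElt_mem ⟨2 * j + 1, by omega⟩, ?_⟩
    rw [tile_true, crossElt_smul_of_edgeForm_eq_zero, edgeMap, if_pos (by simp)]
    rw [edgeForm_eq_zero_iff, ← diagonal_eq, wLen_eq h, dist_foot]
  | twist j s =>
    refine ⟨_, crossElt_mem ⟨2 * j, by omega⟩, ?_⟩
    rw [tile_true, crossElt_smul_of_edgeForm_eq_zero, edgeMap, if_neg (by simp),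
      rot_smul_rot_smul, rot_pi_smul_foot]
    rw [edgeForm_eq_zero_iff, ← axis_eq, uLen_eq ht h, dist_foot]

/-- Tiles that share a side are of opposite kinds, front and back. -/
theorem sameClass_tileVec_vertex : ∀ i j k,
    SameClass (tileVec ⟨0, 1⟩ i (vertex k)) (tileVec ⟨0, 1⟩ j Vec.base) → i = !j := by
  decide

theorem sameClass_tileVec_base : ∀ i j,
    SameClass (tileVec ⟨0, 1⟩ i Vec.base) (tileVec ⟨0, 1⟩ j Vec.base) → i = j := by
  decide

theorem even_tileVec_corner : ∀ i k, Even ((tileVec ⟨0, 1⟩ i (corner k)).x1.re +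
    (tileVec ⟨0, 1⟩ i (corner k)).x2.re) := by
  decide

theorem sameClass_tileVec_corner : ∀ i j k l,
    SameClass (tileVec ⟨0, 1⟩ j (corner l)) (tileVec ⟨0, 1⟩ i (corner k)) →
      l = k ∨ l = k + 4 := by
  decide +kernel

/-- Equivalent points are glued if one of them lies on a side of its octagon and the other one
belongs to the neighbouring tile along that side. -/
theorem cross_pt_eq_of_neighbour (ht : 0 < t) (h : Real.sinh t ^ 2 = √2 / 2) {i j : Bool}
    {x : (crossGluing t).piece i} {y : (crossGluing t).piece j} {g : SL(2, ℝ)}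
    (hg : g ∈ bolzaGroup)
    (hxy : g • tile i (rot (Real.pi / 8) • (x : ℍ)) = tile j (rot (Real.pi / 8) • (y : ℍ)))
    (k : Fin 8) (hx : edgeForm k (vec (rot (Real.pi / 8) • (x : ℍ))) = 0)
    (hq : IsLattice (tile i (g⁻¹ • tile j I)) (vertex k)) :
    (crossGluing t).pt i x = (crossGluing t).pt j y := by
  have hij : SameClass (tileVec ⟨0, 1⟩ i (vertex k)) (tileVec ⟨0, 1⟩ j Vec.base) := by
    obtain ⟨v, hv, hc⟩ := exists_isLattice_tile j (inv_mem hg)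
    have := hq.tile i
    rw [tile_tile] at this
    rwa [hv.unique this] at hc
  have hij : i = !j := sameClass_tileVec_vertex _ _ _ hij
  cases j
  · obtain rfl : i = true := hij
    rw [tile_true] at hq hxy
    -- The product `crossElt k * g⁻¹` fixes a centre, hence acts trivially, and so `g` acts as the
    -- side pairing.
    have h1 : crossElt k • g⁻¹ • tile false I = tile false I := crossElt_smul_vertex k hq
    rw [← mul_smul] at h1
    have h2 := smul_eq_self_of_fixed (mul_mem (crossElt_mem k) (inv_mem hg)) h1
      (tile false (rot (Real.pi / 8) • (y : ℍ)))
    rw [← hxy, mul_smul, inv_smul_smul, crossElt_smul_of_edgeForm_eq_zero k hx, hxy] at h2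
    exact cross_pt_eq_of_edge ht h k hx (tile_injective _ h2.symm)
  · obtain rfl : i = false := hij
    rw [tile_true] at hq hxy
    obtain ⟨p, hp⟩ := exists_vertex (oppositeEdge k)
    have h1 := crossElt_smul_I _ hp
    rw [isLattice_edgeMap_vertex k hq hp, tile_tile, eq_inv_smul_iff, ← mul_smul] at h1
    have h2 := smul_eq_self_of_fixed (mul_mem hg (crossElt_mem (oppositeEdge k))) h1
      (edgeMap k (rot (Real.pi / 8) • (x : ℍ)))
    rw [mul_smul, crossElt_smul_of_edgeForm_eq_zero _ ((edgeForm_edgeMap k _).trans hx),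
      edgeMap_oppositeEdge, hxy] at h2
    symm
    refine cross_pt_eq_of_edge ht h (oppositeEdge k) ?_ ?_
    · rw [h2, edgeForm_edgeMap, hx]
    · rw [h2, edgeMap_oppositeEdge]

theorem edgeForm_corner (k : Fin 8) {z : ℍ} (hz : IsLattice z (corner k)) :
    edgeForm k (vec z) = 0 ∧ edgeForm (k - 1) (vec z) = 0 := by
  obtain ⟨h0, h1, h2⟩ := vec_corner k hz
  obtain ⟨k0, k1, k2⟩ := vec_corner_succ (k - 1) (z := z) (by rwa [sub_add_cancel])
  rw [edgeForm, edgeForm, h0, h1, h2, k1, k2, unit]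
  exact ⟨by ring, by linear_combination -sqrt_two_sq⟩

theorem inOctagon_corner (k : Fin 8) {z : ℍ} (hz : IsLattice z (corner k)) : InOctagon z := by
  intro j
  obtain ⟨p, hp⟩ := exists_vertex j
  have h1 := mink_vertex_sub j hp (vec z)
  have h2 : unit ≤ mink (vec z) (vec p) := by
    refine hz.unit_le_mink hp ?_
    rintro rfl
    have := hz.unique hp
    clear hz hp h1
    revert j k; decide
  rw [(vec_corner k hz).1] at h1
  have : 0 ≤ unit * edgeForm j (vec z) := by linarith
  exact nonneg_of_mul_nonneg_right this unit_pos

/-- Opposite corners of both octagons are glued to the same point. -/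
theorem cross_pt_corner (ht : 0 < t) (h : Real.sinh t ^ 2 = √2 / 2) {i j : Bool}
    {x : (crossGluing t).piece i} {y : (crossGluing t).piece j} {k l : Fin 8}
    (hx : IsLattice (rot (Real.pi / 8) • (x : ℍ)) (corner k))
    (hy : IsLattice (rot (Real.pi / 8) • (y : ℍ)) (corner l)) (hkl : l = k ∨ l = k + 4) :
    (crossGluing t).pt i x = (crossGluing t).pt j y := by
  have hmem : ∀ k, ∃ z ∈ octagon t, IsLattice (rot (Real.pi / 8) • z) (corner k) := by
    intro k
    obtain ⟨z, hz⟩ := exists_corner k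
    refine ⟨(rot (Real.pi / 8))⁻¹ • z, ?_, by rwa [smul_inv_smul]⟩
    rw [mem_octagon_iff ht h, smul_inv_smul]
    exact inOctagon_corner k hz
  choose c hc hcl using hmem
  -- Each corner lies on one seam and on one twisted side. The seam identifies it with the same
  -- corner of the other octagon, the twisted side with the opposite corner.
  have key : ∀ m n e, (e = m ∨ e = m - 1) → edgeTurn e (corner m) = corner n →
      (crossGluing t).pt true ⟨c m, hc m⟩ = (crossGluing t).pt false ⟨c n, hc n⟩ := by
    intro m n e he hmn
    obtain ⟨e1, e2⟩ := edgeForm_corner m (hcl m)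
    refine cross_pt_eq_of_edge ht h e (by rcases he with rfl | rfl <;> assumption) ?_
    have := (hcl m).edgeMap e
    rw [hmn] at this
    exact (hcl n).eq this
  have k1 : ∀ m, (crossGluing t).pt true ⟨c m, hc m⟩ = (crossGluing t).pt false ⟨c m, hc m⟩ := by
    intro m
    have : ∃ e, (e = m ∨ e = m - 1) ∧ edgeTurn e (corner m) = corner m := by
      revert m; decide
    obtain ⟨e, he, hm⟩ := this
    exact key m m e he hm
  have k2 : ∀ m, (crossGluing t).pt true ⟨c m, hc m⟩ =
      (crossGluing t).pt false ⟨c (m + 4), hc (m + 4)⟩ := by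
    intro m
    have : ∃ e, (e = m ∨ e = m - 1) ∧ edgeTurn e (corner m) = corner (m + 4) := by
      revert m; decide
    obtain ⟨e, he, hm⟩ := this
    exact key m (m + 4) e he hm
  have k3 : ∀ b m, (crossGluing t).pt b ⟨c m, hc m⟩ = (crossGluing t).pt true ⟨c m, hc m⟩ := by
    intro b m
    cases b
    · exact (k1 m).symm
    · rfl
  have hx' : x = ⟨c k, hc k⟩ := Subtype.ext (smul_left_cancel _ (hx.eq (hcl k)))
  have hy' : y = ⟨c l, hc l⟩ := Subtype.ext (smul_left_cancel _ (hy.eq (hcl l)))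
  rw [hx', hy', k3, k3 j]
  rcases hkl with rfl | rfl
  · rfl
  · rw [k2, k1]

/-- The distance from `y` to its own centre is the distance from `x` to another centre, which lets
the Voronoi inequality compare `x` with `y`. -/
theorem mink_eq_x0 {i j : Bool} {x y : ℍ} {g : SL(2, ℝ)} (hxy : g • tile i x = tile j y) :
    mink (vec x) (vec (tile i (g⁻¹ • tile j I))) = (vec y).x0 := by
  rw [← mink_tile i, tile_tile, ← cosh_dist_eq, ← dist_smul g, smul_inv_smul, hxy, dist_tile,
    cosh_dist_eq, vec_I, mink, Vec.form_base]

theorem cross_eq_of_orbit_of_eq (ht : 0 < t) (h : Real.sinh t ^ 2 = √2 / 2) {i j : Bool}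
    {x : (crossGluing t).piece i} {y : (crossGluing t).piece j} {g : SL(2, ℝ)}
    (hg : g ∈ bolzaGroup)
    (hxy : g • tile i (rot (Real.pi / 8) • (x : ℍ)) = tile j (rot (Real.pi / 8) • (y : ℍ)))
    (h0 : (vec (rot (Real.pi / 8) • (y : ℍ))).x0 = (vec (rot (Real.pi / 8) • (x : ℍ))).x0) :
    (crossGluing t).pt i x = (crossGluing t).pt j y ∨
      ∃ k, IsLattice (rot (Real.pi / 8) • (x : ℍ)) (corner k) := by
  have hx := (mem_octagon_iff ht h _).1 x.2
  rcases hx.eq_cases (farFromCorners i j (inv_mem hg)) ((mink_eq_x0 hxy).trans h0) with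
    c | ⟨k, hk, hq⟩ | c
  · left
    have c' := congrArg (tile i) c
    rw [tile_tile] at c'
    have hij : i = j := by
      obtain ⟨v, hv, hc⟩ := exists_isLattice_tile j (inv_mem hg)
      rw [c'] at hv
      rw [hv.unique (isLattice_I.tile i)] at hc
      exact sameClass_tileVec_base i j hc
    subst hij
    have := smul_eq_self_of_fixed (inv_mem hg) c' (tile i (rot (Real.pi / 8) • (y : ℍ)))
    rw [← hxy, inv_smul_smul, hxy] at this
    rw [Subtype.ext (smul_left_cancel _ (tile_injective i this))]
  · exact Or.inl (cross_pt_eq_of_neighbour ht h hg hxy k hk hq)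
  · exact Or.inr c

/-- Both Voronoi inequalities are equalities. Outside the case of two corners, the points coincide
or lie on a common side; for corners the congruence class allows only the same or the opposite one.
-/
theorem cross_eq_of_orbit (ht : 0 < t) (h : Real.sinh t ^ 2 = √2 / 2) {i j : Bool}
    (x : (crossGluing t).piece i) (y : (crossGluing t).piece j) {g : SL(2, ℝ)}
    (hg : g ∈ bolzaGroup)
    (hxy : g • tile i (rot (Real.pi / 8) • (x : ℍ)) = tile j (rot (Real.pi / 8) • (y : ℍ))) :
    (crossGluing t).pt i x = (crossGluing t).pt j y := by
  have hx := (mem_octagon_iff ht h _).1 x.2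
  have hy := (mem_octagon_iff ht h _).1 y.2
  have hyx : g⁻¹ • tile j (rot (Real.pi / 8) • (y : ℍ)) = tile i (rot (Real.pi / 8) • (x : ℍ)) := by
    rw [← hxy, inv_smul_smul]
  have e1 := hx.x0_le_mink (farFromCorners i j (inv_mem hg))
  rw [mink_eq_x0 hxy] at e1
  have e2 := hy.x0_le_mink (farFromCorners j i (inv_mem (inv_mem hg)))
  rw [mink_eq_x0 hyx] at e2
  rcases cross_eq_of_orbit_of_eq ht h hg hxy (le_antisymm e2 e1) with c | ⟨k, hk⟩
  · exact c
  rcases cross_eq_of_orbit_of_eq ht h (inv_mem hg) hyx (le_antisymm e1 e2) with c | ⟨l, hl⟩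
  · exact c.symm
  refine cross_pt_corner ht h hk hl ?_
  obtain ⟨q, hq, hgq⟩ := hg
  have h1 := (hk.tile i).smul hgq
  rw [hxy] at h1
  have h2 : SameClass (q.act zunit (tileVec ⟨0, 1⟩ i (corner k))) (tileVec ⟨0, 1⟩ i (corner k)) :=
    sameClass_act hq (even_tileVec_corner i k)
  rw [h1.unique (hl.tile j)] at h2
  exact sameClass_tileVec_corner _ _ _ _ h2

theorem cross_isTessellation (ht : 0 < t) (h : Real.sinh t ^ 2 = √2 / 2) :
    IsTessellation (crossGluing t) fun i z => tile i (rot (Real.pi / 8) • z) where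
  isometry i x y := by rw [dist_tile, dist_smul]
  orbit_of_rel _ _ _ _ _ _ hr := cross_orbit_of_rel ht h hr
  eq_of_orbit _ _ x y _ hg hxy := cross_eq_of_orbit ht h x y hg hxy
  local_cover z := by
    set C : Set ℍ := {c | ∃ i, ∃ g ∈ bolzaGroup, c = g • tile i I}
    obtain ⟨ε, hε, hc⟩ := exists_common_nearest C ⟨_, true, 1, one_mem _, rfl⟩
      (by rintro _ ⟨i, g, hg, rfl⟩; exact exists_isLattice_smul (isLattice_I.tile i) hg) z
    -- The mirror images of a centre in the sides of its tile belong to `C`, so being nearest to a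
    -- centre implies all eight side inequalities.
    have hvert : ∀ i k p, IsLattice p (vertex k) →
        ∃ j, ∃ g ∈ bolzaGroup, tile i p = g • tile j I := by
      intro i k p hp
      cases i
      · refine ⟨true, _, crossElt_mem (oppositeEdge k), ?_⟩
        obtain ⟨q, hq⟩ := exists_vertex (oppositeEdge k)
        rw [tile_true, crossElt_smul_I _ hq, isLattice_edgeMap_vertex k hp hq]
      · refine ⟨false, _, inv_mem (crossElt_mem k), ?_⟩
        rw [tile_true, ← crossElt_smul_vertex k hp, inv_smul_smul]
    refine ⟨ε, hε, fun w hw => ?_⟩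
    obtain ⟨_, ⟨i, g, hg, rfl⟩, h1, h2⟩ := hc w hw
    have key : ∀ a, (∀ c' ∈ C, dist a (g • tile i I) ≤ dist a c') →
        ∃ x : (crossGluing t).piece i, g • tile i (rot (Real.pi / 8) • (x : ℍ)) = a := by
      intro a ha
      refine ⟨⟨(rot (Real.pi / 8))⁻¹ • tile i (g⁻¹ • a), ?_⟩, ?_⟩
      · refine (mem_octagon_iff ht h _).2 ?_
        rw [smul_inv_smul]
        intro k
        obtain ⟨p, hp⟩ := exists_vertex k
        obtain ⟨j, f, hf, hpf⟩ := hvert i k p hp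
        have := ha _ ⟨j, g * f, mul_mem hg hf, rfl⟩
        rw [mul_smul, ← hpf, ← dist_smul g⁻¹, ← dist_smul g⁻¹ a, inv_smul_smul, inv_smul_smul,
          ← dist_tile i, ← dist_tile i (g⁻¹ • a), tile_tile, tile_tile, dist_le_dist_iff, vec_I,
          mink, Vec.form_base, ← sub_nonneg, mink_vertex_sub k hp,
          mul_nonneg_iff_of_pos_left unit_pos] at this
        exact this
      · rw [smul_inv_smul, tile_tile, smul_inv_smul]
    obtain ⟨x, hx⟩ := key z h1
    obtain ⟨y, hy⟩ := key w h2
    exact ⟨i, g, hg, x, y, hx, hy⟩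

end

/-! ### The parameter of the cross and the length of its systoles -/

theorem mink_foot_opposite (d t : ℝ) : mink (vec (foot d 0 t)) (vec (foot d Real.pi t)) =
    2 * (Real.cosh t * Real.cosh d) ^ 2 - 1 := by
  have he := eta_pos.ne'
  rw [vec_foot, vec_foot]
  simp only [mink, Vec.form, Real.cos_zero, Real.sin_zero, Real.cos_pi, Real.sin_pi, ← eta_sq]
  field_simp
  linear_combination -Real.cosh t ^ 2 * Real.cosh_sq d - Real.cosh_sq t

theorem mink_foot_adjacent (d t : ℝ) :
    mink (vec (foot d 0 t)) (vec (foot d (Real.pi / 2) (-t))) =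
      (Real.cosh t * Real.cosh d) ^ 2 - 2 * Real.cosh t * Real.sinh d * Real.sinh t := by
  have he := eta_pos.ne'
  rw [vec_foot, vec_foot]
  simp only [mink, Vec.form, Real.cos_zero, Real.sin_zero, Real.cos_pi_div_two,
    Real.sin_pi_div_two, Real.cosh_neg, Real.sinh_neg, ← eta_sq]
  field_simp
  ring

theorem cosh_aLen (t : ℝ) :
    Real.cosh (aLen t) = 2 * (Real.cosh t * Real.cosh (uLen t)) ^ 2 - 1 := by
  rw [aLen, cosh_dist_eq, mink_foot_opposite]

theorem cosh_cLen (t : ℝ) : Real.cosh (cLen t) = 2 * ((Real.cosh t * Real.cosh (uLen t)) ^ 2 -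
    2 * Real.cosh t * Real.sinh (uLen t) * Real.sinh t) ^ 2 - 1 := by
  rw [cLen, Real.cosh_two_mul, Real.sinh_sq, cosh_dist_eq, mink_foot_adjacent]; ring

theorem aLen_eq_cLen_iff {t : ℝ} (ht : 0 < t) : aLen t = cLen t ↔ Real.sinh t ^ 2 = √2 / 2 := by
  have hs := Real.sinh_pos_iff.2 ht
  have hc := Real.cosh_sq t
  have hu : Real.sinh (uLen t) = Real.cosh t / Real.sinh t := Real.sinh_arsinh _
  have hv := Real.cosh_sq (uLen t)
  rw [hu] at hv
  have h1 : aLen t = cLen t ↔ Real.cosh (aLen t) = Real.cosh (cLen t) := by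
    refine ⟨fun h => by rw [h], fun h => Real.cosh_injOn (Set.mem_Ici.2 dist_nonneg)
      (Set.mem_Ici.2 (mul_nonneg zero_le_two dist_nonneg)) h⟩
  rw [h1, cosh_aLen, cosh_cLen, hu, mul_pow, hv]
  set S := Real.sinh t ^ 2 with hS
  have hS0 : 0 < S := by positivity
  have e1 : Real.cosh t ^ 2 * ((Real.cosh t / Real.sinh t) ^ 2 + 1) =
      (S + 1) * (2 * S + 1) / S := by
    rw [div_pow, ← hS, hc]; field_simp; ring
  have e2 : 2 * Real.cosh t * (Real.cosh t / Real.sinh t) * Real.sinh t = 2 * (S + 1) := by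
    field_simp; linear_combination hc
  rw [e1, e2]
  -- In terms of `S = sinh² t`, the difference of the hyperbolic cosines is a positive multiple of
  -- `2 S² - 1`, so `S = √2 / 2`.
  have e3 : 2 * ((S + 1) * (2 * S + 1) / S) - 1 -
      (2 * ((S + 1) * (2 * S + 1) / S - 2 * (S + 1)) ^ 2 - 1) =
      2 * (S + 1) ^ 2 / S ^ 2 * (2 * S ^ 2 - 1) / (S + 1) := by
    field_simp; ring
  rw [← sub_eq_zero, e3]
  have h2 := sqrt_two_sq
  constructor
  · intro h
    have h3 : 2 * S ^ 2 - 1 = 0 := by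
      have : 2 * (S + 1) ^ 2 / S ^ 2 ≠ 0 := by positivity
      rcases div_eq_zero_iff.1 h with h | h
      · exact (mul_eq_zero.1 h).resolve_left this
      · linarith
    apply (sq_eq_sq₀ hS0.le (by positivity)).1
    linear_combination h3 / 2 - h2 / 4
  · intro h
    have : 2 * S ^ 2 - 1 = 0 := by rw [h]; linear_combination h2 / 2
    rw [this]; simp

theorem sinh_sq_eq_iff {t : ℝ} (ht : 0 < t) :
    Real.sinh t ^ 2 = √2 / 2 ↔ t = Real.arsinh √(√2 / 2) := by
  have hs := Real.sinh_pos_iff.2 ht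
  constructor
  · intro h
    rw [← h, Real.sqrt_sq hs.le, Real.arsinh_sinh]
  · intro h
    rw [h, Real.sinh_arsinh, Real.sq_sqrt (by positivity)]

/-- With `a` and `b` as exponentials this transfers bounds from `exp` to `2 cosh`. -/
theorem add_inv_lt_add_inv {a b : ℝ} (ha : 1 < a) (hab : a < b) : a + a⁻¹ < b + b⁻¹ := by
  have hb : 0 < b := by linarith
  have ha' : 0 < a := by linarith
  have e : b + b⁻¹ - (a + a⁻¹) = (b - a) * (a * b - 1) / (a * b) := by field_simp; ring
  have h1 : 0 < a * b - 1 := by nlinarith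
  have h2 : 0 < b - a := by linarith
  have : 0 < (b - a) * (a * b - 1) / (a * b) := by positivity
  linarith

theorem abs_sysLength_sub_lt : |2 * Real.arcosh (1 + √2) - 3.057| < 0.0005 := by
  have h1 : (1 : ℝ) ≤ 1 + √2 := one_lt_unit.le
  have hc := Real.cosh_arcosh h1
  have hA := Real.arcosh_nonneg h1
  obtain ⟨hs, hs'⟩ := sqrt_two_bounds
  have hlt : ∀ x : ℝ, 0 ≤ x → Real.cosh x < 1 + √2 → x < Real.arcosh (1 + √2) := by
    intro x hx h
    rwa [← hc, Real.cosh_lt_cosh, abs_of_nonneg hx, abs_of_nonneg hA] at h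
  have hgt : ∀ x : ℝ, 0 ≤ x → 1 + √2 < Real.cosh x → Real.arcosh (1 + √2) < x := by
    intro x hx h
    rwa [← hc, Real.cosh_lt_cosh, abs_of_nonneg hx, abs_of_nonneg hA] at h
  have e1 := Real.exp_one_gt_d9
  have e2 := Real.exp_one_lt_d9
  -- The bounds `1.52825` and `1.52875` are half of `3.057 ∓ 0.0005`. Splitting off one factor `exp
  -- 1` leaves an exponent in the unit interval, where six Taylor terms suffice.
  have lower : 1.52825 < Real.arcosh (1 + √2) := by
    apply hlt _ (by norm_num)
    have h2 := Real.exp_bound' (x := 0.52825) (by norm_num) (by norm_num) (n := 6) (by norm_num)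
    have h3 : Real.exp 0.52825 < 1.69628 := by
      refine h2.trans_lt ?_
      norm_num [Finset.sum_range_succ, Nat.factorial]
    have h4 : Real.exp 1.52825 < 4.611 := by
      rw [show (1.52825 : ℝ) = 1 + 0.52825 by norm_num, Real.exp_add]
      nlinarith [Real.exp_pos 0.52825]
    have h5 := add_inv_lt_add_inv (Real.one_lt_exp_iff.2 (by norm_num : (0 : ℝ) < 1.52825)) h4
    rw [Real.cosh_eq, Real.exp_neg]
    norm_num at h5 ⊢
    linarith
  have upper : Real.arcosh (1 + √2) < 1.52875 := by
    apply hgt _ (by norm_num)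
    have h2 := Real.sum_le_exp_of_nonneg (x := 0.52875) (by norm_num) 6
    have h3 : 1.69667 < Real.exp 0.52875 := by
      refine lt_of_lt_of_le ?_ h2
      norm_num [Finset.sum_range_succ, Nat.factorial]
    have h4 : 4.612 < Real.exp 1.52875 := by
      rw [show (1.52875 : ℝ) = 1 + 0.52875 by norm_num, Real.exp_add]
      nlinarith
    have h5 := add_inv_lt_add_inv (by norm_num) h4
    rw [Real.cosh_eq, Real.exp_neg]
    norm_num at h5 ⊢
    linarith
  rw [abs_lt]
  constructor <;> linarith

end BolzaCross

end

/-- Let `t₁` be the unique `t > 0` with `a(t) = c(t)`. The closed surface obtained from the cross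
`C(t₁)` by gluing opposite boundaries with half twists is isometric to the Bolza surface, its
systole is `2 arcosh (1 + √2) ≈ 3.057`, and it has exactly `12` systoles. -/
theorem mainTheorem6 :
    ∃ t₁ : ℝ, (0 < t₁ ∧ BolzaCross.aLen t₁ = BolzaCross.cLen t₁) ∧
      (∀ t : ℝ, 0 < t → BolzaCross.aLen t = BolzaCross.cLen t → t = t₁) ∧
      Nonempty ((BolzaCross.crossGluing t₁).Space ≃ᵢ BolzaCross.bolza.Space) ∧
      IsLeast (BolzaCross.geodesicLengths (BolzaCross.crossGluing t₁).Space)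
        (2 * Real.arcosh (1 + √2)) ∧
      |2 * Real.arcosh (1 + √2) - 3.057| < 0.0005 ∧
      (BolzaCross.systoles (BolzaCross.crossGluing t₁).Space).ncard = 12 := by
  have ht : 0 < Real.arsinh √(√2 / 2) := Real.arsinh_pos_iff.2 (by positivity)
  have h := (BolzaCross.sinh_sq_eq_iff ht).2 rfl
  obtain ⟨π, hπ⟩ := (BolzaCross.cross_isTessellation ht h).exists_isOrbitMap
  obtain ⟨ρ, hρ⟩ := BolzaCross.bolza_isTessellation.exists_isOrbitMap
  refine ⟨_, ⟨ht, (BolzaCross.aLen_eq_cLen_iff ht).2 h⟩, fun t ht' hac => ?_,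
    hπ.nonempty_isometryEquiv hρ, hπ.isLeast (BolzaCross.systoleVec_isSystoleVec 0),
    BolzaCross.abs_sysLength_sub_lt, hπ.ncard_systoles⟩
  exact (BolzaCross.sinh_sq_eq_iff ht').1 ((BolzaCross.aLen_eq_cLen_iff ht').1 hac)
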